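/- **Setting.** Fix $d\ge 2$, a full-rank sublattice $\mathcal L$ of $\mathbb Z^d$, and $E\in\{\mathbb Z,\mathbb R\}$ with its Borel $\sigma$-algebra and with $\lambda$ the counting measure ($E=\mathbb Z$) or Lebesgue measure ($E=\mathbb R$). Let $\Omega$ be the set of functions $\phi:\mathbb Z^d\to E$. Write $\Lambda\subset\subset\mathbb Z^d$ if $\Lambda$ is a finite subset, $d_1$ for the graph distance of the square lattice, and $\Pi_n=[0,n)^d\cap\mathbb Z^d$. For $\Lambda\subset\mathbb Z^d$ let $\mathcal F^\nabla_\Lambda=\sigma(\phi(y)-\phi(x):x,y\in\Lambda)$ and $\mathcal F^\nabla=\mathcal F^\nabla_{\mathbb Z^d}$. For $x\in\mathcal L$ put $(\theta_x\phi)(y)=\phi(y+x)$. $\mathcal P(\Omega,\mathcal F^\nabla)$ is the set of probability measures on $\mathcal F^\nabla$ and $\mathcal P_{\mathcal L}(\Omega,\mathcal F^\nabla)$ the subset of those invariant under all $\theta_x$, $x\in\mathcal L$. The topology of *local convergence* (resp. *weak local convergence*) on $\mathcal P(\Omega,\mathcal F^\nabla)$ is the coarsest one making $\mu\mapsto\mu(f)$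 continuous for every bounded function $f$ that is $\mathcal F^\nabla_\Lambda$-measurable for some $\Lambda\subset\subset\mathbb Z^d$ (resp. every such $f$ that is moreover continuous for the topology of uniform convergence on $\Omega$). **Potentials.** A *periodic gradient potential* is a family $\Phi=(\Phi_\Lambda)_{\Lambda\subset\subset\mathbb Z^d}$ of $\mathcal F^\nabla_\Lambda$-measurable functions $\Phi_\Lambda:\Omega\to\mathbb R\cup\{\infty\}$, with $\Phi_\Lambda\equiv0$ if $|\Lambda|\le1$ and $\Phi_{\Lambda+x}(\phi)=\Phi_\Lambda(\theta_x\phi)$ for $x\in\mathcal L$. Its Hamiltonian and interior Hamiltonian are $H_\Lambda=\sum_{\Gamma\cap\Lambda\ne\emptyset}\Phi_\Gamma$ and $H^0_\Lambda=\sum_{\emptyset\ne\Gamma\subset\Lambda}\Phi_\Gamma$, the sums being over finite sets $\Gamma$. An *admissible quasimetric* is an $\mathcal L$-invariant $q:\mathbb Z^d\times\mathbb Z^d\to\mathbb R$ with $q(x,x)=0$, $q(x,y)+q(y,x)>0$ for $x\ne y$, and $q(x,z)\le q(x,y)+q(y,z)$. A *local Lipschitz constraint* is a pair $(\mathbb A,q)$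 where $\mathbb A$ is an $\mathcal L$-invariant edge set making $\mathbb Z^d$ a connected graph of bounded degree, and $q$ is an admissible quasimetric such that $p\le q$ for every admissible quasimetric $p$ with $p(x,y)\le q(x,y)$ and $p(y,x)\le q(y,x)$ for all $\{x,y\}\in\mathbb A$. For small $\varepsilon>0$, $q_\varepsilon$ is the largest admissible quasimetric with $q_\varepsilon\le q-\varepsilon$ on the edges of $\mathbb A$ (in both orientations). $\mathcal S_{\mathcal L}$ is the set of periodic gradient potentials $\Psi$ such that: $\Psi_\Lambda\ge0$ for all $\Lambda$; for some $R$, $\Psi_\Lambda\equiv0$ whenever the $d_1$-diameter of $\Lambda$ exceeds $R$; there is a local Lipschitz constraint $(\mathbb A,q)$ such that $\Psi_\Lambda(\phi)=\infty$ if and only if $\Lambda=\{x,y\}$ for some $\{x,y\}\in\mathbb A$ with $\phi(y)-\phi(x)>q(x,y)$; and, if $E=\mathbb R$, for every sufficiently small $\varepsilon>0$ there is $C_\varepsilon<\infty$ with $H^\Psi_{\{x\}}(\phi)\le C_\varepsilon$ for all $x\in\mathbb Z^d$ and all $\phi\in\Omega$ satisfying $\phi(z)-\phi(y)\le q_\varepsilon(y,z)$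 and $\phi(y)-\phi(z)\le q_\varepsilon(z,y)$ for every edge $\{y,z\}\in\mathbb A$ containing $x$. $\mathcal W_{\mathcal L}$ is the set of periodic gradient potentials $\Xi$ with $\sup_{x,\phi}\sum_{\Lambda\ni x}|\Xi_\Lambda(\phi)|<\infty$ whose *lower exterior bound* $e^-(\Lambda)=\sup_{\phi}\sum_{\Delta}|\Xi_\Delta(\phi)|$, the sum being over finite $\Delta$ that intersect both $\Lambda$ and its complement, is *amenable*: $e^-$ is finite, $\mathcal L$-invariant, satisfies $e^-(\Lambda\cup\Delta)\le e^-(\Lambda)+e^-(\Delta)$ for disjoint $\Lambda,\Delta$, and $e^-(\Lambda_n)/|\Lambda_n|\to0$ for all sequences of finite sets with $|\Lambda_n|\to\infty$ and $|\partial\Lambda_n|/|\Lambda_n|\to0$, where $\partial\Lambda$ is the set of vertices outside $\Lambda$ adjacent to $\Lambda$ in the square lattice. **Free energy.** For finite nonempty $\Lambda$ and $x\in\Lambda$, $\lambda^{\Lambda-1}$ is the measure on $\mathcal F^\nabla_\Lambda$ under which $(\phi(y)-\phi(x))_{y\in\Lambda\setminus\{x\}}$ has law $\lambda^{\Lambda\setminus\{x\}}$;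 it does not depend on $x$. For a probability measure $\mu$ and a $\sigma$-finite measure $\nu$, the relative entropy is $\mathcal H(\mu|\nu)=\mu(\log\frac{d\mu}{d\nu})$ if $\mu\ll\nu$ (with $\infty-\infty=\infty$) and $\infty$ otherwise. The free energy $\mathcal H_\Lambda(\mu|\Phi)$ is the relative entropy of $\mu|_{\mathcal F^\nabla_\Lambda}$ with respect to $e^{-H^{0}_\Lambda}\lambda^{\Lambda-1}$. **Theorem 4.1 (specific free energy).** Let $\Phi\in\mathcal S_{\mathcal L}+\mathcal W_{\mathcal L}$. Then for each $\mu\in\mathcal P_{\mathcal L}(\Omega,\mathcal F^\nabla)$ the limit $$\mathcal H(\mu|\Phi)=\lim_{n\to\infty}n^{-d}\,\mathcal H_{\Pi_n}(\mu|\Phi)\in\mathbb R\cup\{\infty\}$$ exists. The functional $\mathcal H(\cdot|\Phi)$ on $\mathcal P_{\mathcal L}(\Omega,\mathcal F^\nabla)$ is affine, that is, $\mathcal H((1-t)\mu+t\nu|\Phi)=(1-t)\mathcal H(\mu|\Phi)+t\mathcal H(\nu|\Phi)$ for $0\le t\le1$ (with $0\cdot\infty=0$); it is bounded below; and it is lower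 semicontinuous with respect to both the topology of local convergence and the topology of weak local convergence. For each $C\in\mathbb R$ the lower level set $$M_C=\{\mu\in\mathcal P_{\mathcal L}(\Omega,\mathcal F^\nabla):\mathcal H(\mu|\Phi)\le C\}$$ is a (possibly empty) compact Polish space with respect to each of the two topologies, and the two topologies coincide on $M_C$. -/

import Mathlib

open Set Filter Topology MeasureTheory
open scoped ENNReal Pointwise

noncomputable section

namespace GradientModel

/-! ## Height functions -/

/-- The two possible choices of the height space `E`: the integers or the real line. -/
inductive HeightKind : Type
  | int
  | real

/-- The height space `E`. -/
def HeightKind.E : HeightKind → Type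
  | .int => ℤ
  | .real => ℝ

instance HeightKind.instAddCommGroup : (k : HeightKind) → AddCommGroup k.E
  | .int => inferInstanceAs (AddCommGroup ℤ)
  | .real => inferInstanceAs (AddCommGroup ℝ)

/-- The usual uniform structure of `ℤ` (the discrete one) or of `ℝ`. -/
instance HeightKind.instUniformSpace : (k : HeightKind) → UniformSpace k.E
  | .int => inferInstanceAs (UniformSpace ℤ)
  | .real => inferInstanceAs (UniformSpace ℝ)

/-- The Borel `σ`-algebra of `ℤ` (all subsets) or of `ℝ`. -/
instance HeightKind.instMeasurableSpace : (k : HeightKind) → MeasurableSpace k.E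
  | .int => inferInstanceAs (MeasurableSpace ℤ)
  | .real => inferInstanceAs (MeasurableSpace ℝ)

/-- The reference measure `λ`: counting measure on `ℤ`, Lebesgue measure on `ℝ`. -/
def HeightKind.refMeasure : (k : HeightKind) → Measure k.E
  | .int => (Measure.count : Measure ℤ)
  | .real => (volume : Measure ℝ)

/-- The inclusion of `E` into `ℝ`. -/
def HeightKind.toReal : (k : HeightKind) → k.E → ℝ
  | .int => fun n : ℤ => (n : ℝ)
  | .real => fun a : ℝ => a

instance HeightKind.instMeasurableSub₂ : (k : HeightKind) → MeasurableSub₂ k.E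
  | .int => inferInstanceAs (MeasurableSub₂ ℤ)
  | .real => inferInstanceAs (MeasurableSub₂ ℝ)

instance HeightKind.instSigmaFinite : (k : HeightKind) → SigmaFinite k.refMeasure
  | .int => inferInstanceAs (SigmaFinite (Measure.count : Measure ℤ))
  | .real => inferInstanceAs (SigmaFinite (volume : Measure ℝ))

/-- The vertices of the lattice `ℤ^d`. -/
abbrev Site (d : ℕ) : Type := Fin d → ℤ

/-- The set `Ω` of height functions `ℤ^d → E`. -/
def HeightFn (d : ℕ) (k : HeightKind) : Type := Site d → k.E

variable {d : ℕ} {k : HeightKind}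

/-- The `σ`-algebra on `Ω` generated by the height differences `φ y - φ x` with `x, y ∈ Λ`. -/
@[reducible] def gradAlgOn (d : ℕ) (k : HeightKind) (Λ : Set (Site d)) : MeasurableSpace (HeightFn d k) :=
  ⨆ x ∈ Λ, ⨆ y ∈ Λ,
    MeasurableSpace.comap (fun φ : HeightFn d k => φ y - φ x) k.instMeasurableSpace

/-- Throughout, `Ω` carries the gradient `σ`-algebra, generated by all height differences. -/
instance HeightFn.instMeasurableSpace : MeasurableSpace (HeightFn d k) :=
  gradAlgOn d k univ

theorem gradAlgOn_mono {Λ Δ : Set (Site d)} (h : Λ ⊆ Δ) : gradAlgOn d k Λ ≤ gradAlgOn d k Δ :=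
  iSup₂_le fun x hx => iSup₂_le fun y hy =>
    le_trans (le_iSup₂_of_le y (h hy) le_rfl)
      (le_iSup₂ (f := fun x (_ : x ∈ Δ) => ⨆ y ∈ Δ,
        MeasurableSpace.comap (fun φ : HeightFn d k => φ y - φ x) k.instMeasurableSpace) x (h hx))

theorem gradAlgOn_le (Λ : Set (Site d)) :
    gradAlgOn d k Λ ≤ (HeightFn.instMeasurableSpace : MeasurableSpace (HeightFn d k)) :=
  gradAlgOn_mono (subset_univ Λ)

/-- The shifted height function `y ↦ φ (y + x)`. -/
def shift (x : Site d) (φ : HeightFn d k) : HeightFn d k := fun y => φ (y + x)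

/-- The gradient measures that are invariant under all shifts by elements of `L`. -/
def invariantMeasures (k : HeightKind) (L : AddSubgroup (Site d)) :
    Set (ProbabilityMeasure (HeightFn d k)) :=
  {μ | ∀ x ∈ L, MeasurePreserving (shift x)
    (μ : Measure (HeightFn d k)) (μ : Measure (HeightFn d k))}

/-! ## The two topologies -/

/-- Bounded cylinder functions which can be integrated against gradient measures: bounded
functions that are measurable with respect to the height differences inside some finite set. -/
def IsBoundedCylinder (f : HeightFn d k → ℝ) : Prop :=
  (∃ Λ : Finset (Site d), Measurable[gradAlgOn d k (Λ : Set (Site d))] f) ∧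
    ∃ B : ℝ, ∀ φ, |f φ| ≤ B

/-- Continuity with respect to the topology of uniform convergence on `Ω`. -/
def IsUniformlyTopContinuous (f : HeightFn d k → ℝ) : Prop :=
  Continuous fun φ : UniformFun (Site d) k.E => f (UniformFun.toFun φ)

/-- The topology of local convergence. -/
@[reducible] def localTopology (d : ℕ) (k : HeightKind) :
    TopologicalSpace (ProbabilityMeasure (HeightFn d k)) :=
  ⨅ f ∈ {f : HeightFn d k → ℝ | IsBoundedCylinder f},
    TopologicalSpace.induced
      (fun μ : ProbabilityMeasure (HeightFn d k) => ∫ φ, f φ ∂(μ : Measure (HeightFn d k)))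
      inferInstance

/-- The topology of weak local convergence. -/
@[reducible] def weakLocalTopology (d : ℕ) (k : HeightKind) :
    TopologicalSpace (ProbabilityMeasure (HeightFn d k)) :=
  ⨅ f ∈ {f : HeightFn d k → ℝ | IsBoundedCylinder f ∧ IsUniformlyTopContinuous f},
    TopologicalSpace.induced
      (fun μ : ProbabilityMeasure (HeightFn d k) => ∫ φ, f φ ∂(μ : Measure (HeightFn d k)))
      inferInstance

/-! ## Subsets of the lattice -/

/-- The graph distance of the square lattice. -/
def latticeDist (x y : Site d) : ℕ := ∑ i, (x i - y i).natAbs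

/-- The box `[0, n)^d`. -/
def box (d n : ℕ) : Finset (Site d) := Fintype.piFinset fun _ => Finset.Ico 0 (n : ℤ)

/-- The vertices outside `Λ` that are adjacent to `Λ` in the square lattice. -/
def outerBoundary (Λ : Finset (Site d)) : Set (Site d) :=
  {y | y ∉ Λ ∧ ∃ x ∈ Λ, latticeDist x y = 1}

/-- Van Hove sequences of finite sets. -/
def IsVanHove (Λ : ℕ → Finset (Site d)) : Prop :=
  Tendsto (fun n => (Λ n).card) atTop atTop ∧
    Tendsto (fun n => ((outerBoundary (Λ n)).ncard : ℝ) / ((Λ n).card : ℝ)) atTop (𝓝 0)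

/-! ## Potentials -/

/-- Gradient potentials, with values in `ℝ ∪ {∞}` (as extended reals different from `-∞`). -/
@[ext]
structure GradientPotential (d : ℕ) (k : HeightKind) where
  /-- The potential function of a finite set. -/
  toFun : Finset (Site d) → HeightFn d k → EReal
  measurable_toFun : ∀ Λ : Finset (Site d), Measurable[gradAlgOn d k (Λ : Set (Site d))] (toFun Λ)
  ne_bot : ∀ Λ φ, toFun Λ φ ≠ ⊥
  eq_zero_of_card_le_one : ∀ Λ : Finset (Site d), Λ.card ≤ 1 → ∀ φ, toFun Λ φ = 0

namespace GradientPotential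

instance : CoeFun (GradientPotential d k)
    fun _ => Finset (Site d) → HeightFn d k → EReal := ⟨toFun⟩

instance : Add (GradientPotential d k) where
  add Ψ Ξ :=
    { toFun := fun Λ φ => Ψ Λ φ + Ξ Λ φ
      measurable_toFun := fun Λ => (Ψ.measurable_toFun Λ).add (Ξ.measurable_toFun Λ)
      ne_bot := fun Λ φ h => by
        rcases EReal.add_eq_bot_iff.1 h with h | h
        exacts [Ψ.ne_bot Λ φ h, Ξ.ne_bot Λ φ h]
      eq_zero_of_card_le_one := fun Λ h φ => by
        rw [Ψ.eq_zero_of_card_le_one Λ h, Ξ.eq_zero_of_card_le_one Λ h, add_zero] }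

/-- Invariance of the potential under the shifts by elements of `L`. -/
def IsPeriodic (L : AddSubgroup (Site d)) (Φ : GradientPotential d k) : Prop :=
  ∀ l ∈ L, ∀ (Λ : Finset (Site d)) (φ : HeightFn d k), Φ (Λ.image (· + l)) φ = Φ Λ (shift l φ)

/-- The Hamiltonian `H_{Λ,Δ}`: the sum over the finite sets inside `Δ` that intersect `Λ`. -/
def hamiltonianIn (Φ : GradientPotential d k) (Λ : Finset (Site d)) (Δ : Set (Site d))
    (φ : HeightFn d k) : EReal :=
  ∑' Γ : {Γ : Finset (Site d) // (Γ : Set (Site d)) ⊆ Δ ∧ (Γ ∩ Λ).Nonempty}, Φ Γ.1 φ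

/-- The Hamiltonian `H_Λ`. -/
def hamiltonian (Φ : GradientPotential d k) (Λ : Finset (Site d)) (φ : HeightFn d k) : EReal :=
  Φ.hamiltonianIn Λ univ φ

/-- The interior Hamiltonian `H_Λ^0`. -/
def interiorHamiltonian (Φ : GradientPotential d k) (Λ : Finset (Site d)) (φ : HeightFn d k) :
    EReal :=
  Φ.hamiltonianIn Λ (Λ : Set (Site d)) φ

/-- The interior Hamiltonian is a finite sum. -/
theorem interiorHamiltonian_eq_sum (Φ : GradientPotential d k) (Λ : Finset (Site d))
    (φ : HeightFn d k) : Φ.interiorHamiltonian Λ φ = ∑ Γ ∈ Λ.powerset, Φ Γ φ := by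
  classical
  have h1 : Φ.interiorHamiltonian Λ φ = ∑' Γ : Finset (Site d),
      ({Γ : Finset (Site d) | (Γ : Set (Site d)) ⊆ (Λ : Set (Site d)) ∧
        (Γ ∩ Λ).Nonempty}).indicator (fun Γ => Φ Γ φ) Γ :=
    tsum_subtype _ (fun Γ => Φ Γ φ)
  rw [h1, tsum_eq_sum (s := Λ.powerset)]
  · refine Finset.sum_congr rfl fun Γ hΓ => ?_
    have hs : Γ ⊆ Λ := Finset.mem_powerset.1 hΓ
    by_cases hne : Γ.Nonempty
    · refine indicator_of_mem ?_ _
      exact ⟨Finset.coe_subset.2 hs, by rwa [Finset.inter_eq_left.2 hs]⟩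
    · rw [Finset.not_nonempty_iff_eq_empty] at hne
      subst hne
      rw [indicator_of_notMem (by simp), Φ.eq_zero_of_card_le_one ∅ (by simp)]
  · intro Γ hΓ
    refine indicator_of_notMem (fun h => hΓ ?_) _
    exact Finset.mem_powerset.2 (Finset.coe_subset.1 h.1)

end GradientPotential

/-! ## Local Lipschitz constraints and strong interactions -/

/-- Admissible graphs: `L`-invariant, connected, of bounded degree. -/
structure IsAdmissibleGraph (L : AddSubgroup (Site d)) (A : SimpleGraph (Site d)) : Prop where
  invariant : ∀ l ∈ L, ∀ x y, A.Adj (x + l) (y + l) ↔ A.Adj x y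
  connected : A.Connected
  bounded_degree : ∃ D : ℕ, ∀ x, (A.neighborSet x).encard ≤ D

/-- Admissible quasimetrics. -/
structure IsAdmissibleQuasimetric (L : AddSubgroup (Site d)) (q : Site d → Site d → ℝ) :
    Prop where
  self : ∀ x, q x x = 0
  pos : ∀ x y, x ≠ y → 0 < q x y + q y x
  triangle : ∀ x y z, q x z ≤ q x y + q y z
  invariant : ∀ l ∈ L, ∀ x y, q (x + l) (y + l) = q x y

/-- The admissible quasimetrics that are at most `q - ε` on the edges of `A`. -/
def quasimetricsBelow (L : AddSubgroup (Site d)) (A : SimpleGraph (Site d))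
    (q : Site d → Site d → ℝ) (ε : ℝ) : Set (Site d → Site d → ℝ) :=
  {p | IsAdmissibleQuasimetric L p ∧ ∀ x y, A.Adj x y → p x y ≤ q x y - ε}

/-- Local Lipschitz constraints: the quasimetric `q` is the largest one that is at most `q` on the
edges of the graph. -/
structure IsLocalLipschitzConstraint (L : AddSubgroup (Site d)) (A : SimpleGraph (Site d))
    (q : Site d → Site d → ℝ) : Prop where
  graph : IsAdmissibleGraph L A
  greatest : IsGreatest (quasimetricsBelow L A q 0) q

/-- The height function `φ` is `q`-Lipschitz at the vertex `z`. -/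
def IsLipschitzAt (A : SimpleGraph (Site d)) (q : Site d → Site d → ℝ) (z : Site d)
    (φ : HeightFn d k) : Prop :=
  ∀ x y, A.Adj x y → (x = z ∨ y = z) → k.toReal (φ y) - k.toReal (φ x) ≤ q x y

namespace GradientPotential

/-- The potential is infinite exactly at the edges where the Lipschitz constraint is violated. -/
def IsLipschitzWith (Ψ : GradientPotential d k) (A : SimpleGraph (Site d))
    (q : Site d → Site d → ℝ) : Prop :=
  ∀ (Λ : Finset (Site d)) (φ : HeightFn d k), Ψ Λ φ = ⊤ ↔
    ∃ x y, A.Adj x y ∧ Λ = {x, y} ∧ q x y < k.toReal (φ y) - k.toReal (φ x)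

/-- The potential functions of sets of large diameter vanish. -/
def HasFiniteRange (Ψ : GradientPotential d k) : Prop :=
  ∃ R : ℕ, ∀ Λ : Finset (Site d), (∃ x ∈ Λ, ∃ y ∈ Λ, R < latticeDist x y) → ∀ φ, Ψ Λ φ = 0

/-- Local boundedness: for small `ε > 0`, the Hamiltonian of a single vertex is uniformly bounded
on the height functions that are `q_ε`-Lipschitz at that vertex, where `q_ε` is the largest
admissible quasimetric that is at most `q - ε` on the edges. -/
def IsLocallyBounded (L : AddSubgroup (Site d)) (Ψ : GradientPotential d k)
    (A : SimpleGraph (Site d)) (q : Site d → Site d → ℝ) : Prop :=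
  ∀ᶠ ε : ℝ in 𝓝[>] 0, ∃ qε, IsGreatest (quasimetricsBelow L A q ε) qε ∧
    ∃ C : ℝ, ∀ (x : Site d) (φ : HeightFn d k), IsLipschitzAt A qε x φ →
      Ψ.hamiltonian {x} φ ≤ (C : EReal)

end GradientPotential

/-- The class of strong interactions. -/
def strongInteractions (k : HeightKind) (L : AddSubgroup (Site d)) :
    Set (GradientPotential d k) :=
  {Ψ | Ψ.IsPeriodic L ∧ (∀ Λ φ, 0 ≤ Ψ Λ φ) ∧ Ψ.HasFiniteRange ∧
    ∃ A q, IsLocalLipschitzConstraint L A q ∧ Ψ.IsLipschitzWith A q ∧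
      (k = .real → Ψ.IsLocallyBounded L A q)}

/-! ## Weak interactions -/

/-- Amenable functions on the finite subsets of the lattice. -/
structure IsAmenable (L : AddSubgroup (Site d)) (f : Finset (Site d) → ℝ≥0∞) : Prop where
  finite : ∀ Λ, f Λ ≠ ⊤
  invariant : ∀ l ∈ L, ∀ Λ : Finset (Site d), f (Λ.image (· + l)) = f Λ
  subadditive : ∀ Λ Δ : Finset (Site d), Disjoint Λ Δ → f (Λ ∪ Δ) ≤ f Λ + f Δ
  vanHove : ∀ Λ : ℕ → Finset (Site d), IsVanHove Λ →
    Tendsto (fun n => f (Λ n) / ((Λ n).card : ℝ≥0∞)) atTop (𝓝 0)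

namespace GradientPotential

/-- The norm of a potential, as an extended nonnegative real. -/
def totalNorm (Ξ : GradientPotential d k) : ℝ≥0∞ :=
  ⨆ (x : Site d) (φ : HeightFn d k), ∑' Λ : {Λ : Finset (Site d) // x ∈ Λ}, (Ξ Λ.1 φ).abs

/-- The lower exterior bound `e⁻` of a potential. -/
def lowerExteriorBound (Ξ : GradientPotential d k) (Λ : Finset (Site d)) : ℝ≥0∞ :=
  ⨆ φ : HeightFn d k,
    ∑' Δ : {Δ : Finset (Site d) // (∃ x ∈ Δ, x ∈ Λ) ∧ ∃ y ∈ Δ, y ∉ Λ}, (Ξ Δ.1 φ).abs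

end GradientPotential

/-- The class of weak interactions. -/
def weakInteractions (k : HeightKind) (L : AddSubgroup (Site d)) :
    Set (GradientPotential d k) :=
  {Ξ | Ξ.IsPeriodic L ∧ Ξ.totalNorm ≠ ⊤ ∧ IsAmenable L Ξ.lowerExteriorBound}

/-! ## Free energy -/

/-- The integral of a real function as an extended real number, with `∞ - ∞ = ∞`. -/
def extIntegral {X : Type*} [MeasurableSpace X] (μ : Measure X) (g : X → ℝ) : EReal :=
  open Classical in
  if ∫⁻ x, ENNReal.ofReal (g x) ∂μ = ⊤ then ⊤
  else ((∫⁻ x, ENNReal.ofReal (g x) ∂μ : ℝ≥0∞) : EReal)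
    - ((∫⁻ x, ENNReal.ofReal (-g x) ∂μ : ℝ≥0∞) : EReal)

/-- The relative entropy of a probability measure with respect to a `σ`-finite measure:
`μ(log dμ/dν)` if `μ ≪ ν`, and `∞` otherwise. -/
def relEntropy {X : Type*} [MeasurableSpace X] (μ ν : Measure X) : EReal :=
  open Classical in
  if μ ≪ ν then extIntegral μ fun x => Real.log (μ.rnDeriv ν x).toReal else ⊤

/-- The height function that is zero at `x` and outside `Λ`, with prescribed values on the other
vertices of `Λ`. -/
def extendByZero (Λ : Finset (Site d)) (x : Site d) (ψ : {y // y ∈ Λ.erase x} → k.E) :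
    HeightFn d k :=
  fun y => if h : y ∈ Λ.erase x then ψ ⟨y, h⟩ else 0

theorem measurable_extendByZero (Λ : Finset (Site d)) (x : Site d) :
    Measurable[MeasurableSpace.pi, gradAlgOn d k (Λ : Set (Site d))]
      (extendByZero (k := k) Λ x) := by
  have hc : ∀ y, Measurable fun ψ : {y // y ∈ Λ.erase x} → k.E =>
      extendByZero Λ x ψ y := by
    intro y
    by_cases h : y ∈ Λ.erase x
    · simpa [extendByZero, h] using measurable_pi_apply (X := fun _ => k.E)
        (⟨y, h⟩ : {y // y ∈ Λ.erase x})
    · simp only [extendByZero, h, dif_neg, not_false_eq_true]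
      exact measurable_const
  rw [measurable_iff_comap_le, gradAlgOn, MeasurableSpace.comap_iSup]
  refine iSup_le fun u => ?_
  rw [MeasurableSpace.comap_iSup]
  refine iSup_le fun _ => ?_
  rw [MeasurableSpace.comap_iSup]
  refine iSup_le fun v => ?_
  rw [MeasurableSpace.comap_iSup]
  refine iSup_le fun _ => ?_
  rw [MeasurableSpace.comap_comp, ← measurable_iff_comap_le]
  exact (hc v).sub (hc u)

/-- The gradient reference measure for the reference vertex `x ∈ Λ`: the measure on the `σ`-algebra
of the height differences in `Λ` under which the differences `φ y - φ x`, `y ∈ Λ \ {x}`, have the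
product law of the reference measure `λ`. -/
def gradRefMeasureAt (k : HeightKind) (Λ : Finset (Site d)) (x : Site d) :
    @Measure (HeightFn d k) (gradAlgOn d k (Λ : Set (Site d))) :=
  @Measure.map _ _ MeasurableSpace.pi (gradAlgOn d k (Λ : Set (Site d))) (extendByZero Λ x)
    (Measure.pi fun _ => k.refMeasure)

/-- The defining property of the gradient reference measure. -/
theorem measurePreserving_gradRefMeasureAt (Λ : Finset (Site d)) {x : Site d} (hx : x ∈ Λ) :
    @MeasurePreserving _ _ (gradAlgOn d k (Λ : Set (Site d))) MeasurableSpace.pi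
      (fun (φ : HeightFn d k) (y : {y // y ∈ Λ.erase x}) => φ y - φ x)
      (gradRefMeasureAt k Λ x) (Measure.pi fun _ => k.refMeasure) := by
  have hm : @Measurable _ _ (gradAlgOn d k (Λ : Set (Site d))) MeasurableSpace.pi
      (fun (φ : HeightFn d k) (y : {y // y ∈ Λ.erase x}) => φ y - φ x) := by
    refine @measurable_pi_lambda _ _ _ (gradAlgOn d k (Λ : Set (Site d))) _ _ fun y => ?_
    refine measurable_iff_comap_le.2 ?_
    exact le_iSup₂_of_le x hx (le_iSup₂_of_le (y : Site d) (Finset.mem_of_mem_erase y.2) le_rfl)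
  refine @MeasurePreserving.mk _ _ (gradAlgOn d k (Λ : Set (Site d))) MeasurableSpace.pi _ _ _
    hm ?_
  rw [gradRefMeasureAt, @Measure.map_map _ _ _ MeasurableSpace.pi
    (gradAlgOn d k (Λ : Set (Site d))) MeasurableSpace.pi _ _ _ hm
    (measurable_extendByZero Λ x)]
  convert Measure.map_id
  funext ψ y
  simp [extendByZero]

/-- The gradient reference measure `λ^{Λ-1}` of a nonempty finite set. By translation invariance of
`λ` it does not depend on the chosen reference vertex. -/
def gradRefMeasure (k : HeightKind) (Λ : Finset (Site d)) :
    @Measure (HeightFn d k) (gradAlgOn d k (Λ : Set (Site d))) :=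
  open Classical in
  if h : Λ.Nonempty then gradRefMeasureAt k Λ h.choose else 0

/-- The free energy of `μ` in `Λ`: the relative entropy of the restriction of `μ` to the height
differences in `Λ` with respect to the measure `exp (- H_Λ^0) λ^{Λ-1}`. -/
def freeEnergy (Φ : GradientPotential d k) (Λ : Finset (Site d)) (μ : Measure (HeightFn d k)) :
    EReal :=
  @relEntropy (HeightFn d k) (gradAlgOn d k (Λ : Set (Site d)))
    (μ.trim (gradAlgOn_le (Λ : Set (Site d))))
    (@Measure.withDensity (HeightFn d k) (gradAlgOn d k (Λ : Set (Site d))) (gradRefMeasure k Λ)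
      fun φ => EReal.exp (-Φ.interiorHamiltonian Λ φ))

/-- The free energy in the box `[0, n)^d`, divided by the volume of the box. -/
def normalizedFreeEnergy (Φ : GradientPotential d k) (μ : Measure (HeightFn d k)) (n : ℕ) :
    EReal :=
  ((((n : ℝ) ^ d)⁻¹ : ℝ) : EReal) * freeEnergy Φ (box d n) μ

/-- The specific free energy, as the limit of the normalized free energies (meaningful where the
limit exists). -/
def specificFreeEnergy (Φ : GradientPotential d k) (μ : Measure (HeightFn d k)) : EReal :=
  limUnder atTop (normalizedFreeEnergy Φ μ)

/-- The lower level set of the specific free energy on the `L`-invariant gradient measures. -/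
def lowerLevelSet (L : AddSubgroup (Site d)) (Φ : GradientPotential d k) (C : ℝ) :
    Set (ProbabilityMeasure (HeightFn d k)) :=
  {μ | μ ∈ invariantMeasures k L ∧
    specificFreeEnergy Φ (μ : Measure (HeightFn d k)) ≤ (C : EReal)}

/-- The topology induced by `τ` on a subset. -/
@[reducible] def subspaceTopology {X : Type*} (τ : TopologicalSpace X) (M : Set X) : TopologicalSpace M :=
  TopologicalSpace.induced Subtype.val τ

end GradientModel

end

open GradientModel

open Set Filter Topology MeasureTheory
open scoped ENNReal Pointwise
noncomputable section
namespace GradientModel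
variable {d : ℕ} {k : HeightKind}

/-! Everything rests on the Donsker–Varadhan description: the free energy in `Λ` is at most `a`
exactly when `exp (μ f - a) ≤ ∫ exp f` for every bounded `f` measurable in `Λ`, the integral being
taken against the Boltzmann weight. The reference measure is infinite. However, a measure of finite
specific free energy is carried by functions obeying the Lipschitz constraint, so the weight may be
cut down to functions with nearest-neighbour increments at most `K`, where its mass is finite. The
two directions are `entropyBound_of_relEntropy_le` and `relEntropy_le_of_entropyBound`;
`freeEnergy_le_iff` packages them as `FreeEnergyBound`.

Subadditivity of the exponential integrals comes from cutting a box into blocks. Interactions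
crossing between blocks cost at most the lower exterior bounds, because the strong part is
nonnegative. Every block but a root is tied to a vertex of smaller rank by an increment at most `K`,
so its free height contributes only the mass of a ball (`refIntegral_le_blocks`). Testing with sums
of functions on the blocks yields `FreeEnergyBound.div_pow` (a large box controls the boxes tiling
it) and `FreeEnergyBound.of_le` (a box controls the boxes inside it). The error terms are of
boundary order, or proportional to the change in volume, and `IsAlmostSuperadditive.exists_tendsto`
deduces the limit by excluding upcrossings. If the constraint is violated with positive probability,
the free energy is eventually infinite and the limit is trivial. The test function zero gives the
lower bound.

Affinity: the variational bound is convex in the measure, and two failing test functions can be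
merged by a log-sum-exp at a cost of `log 2`, which disappears after division by the volume.

Lower semicontinuity: failure of a finite-volume bound is witnessed by one test function, which may
be taken continuous by density in L¹, so failure is an open condition; violation of the constraint
is also open. On a level set the entropy bound in one box gives uniform absolute continuity, so
every bounded cylinder function is uniformly approximated in mean by continuous ones, and the two
topologies agree there (`IsInteraction.subspaceTopology_eq`). For compactness, functions pinned at
the origin and obeying the constraint lie in one fixed product of compact sets; Prokhorov's theorem
applies to their laws, and the passage back to gradient measures is a continuous bijection from a
compact space onto a Hausdorff one. -/

/-! ## The variational description of relative entropy -/

section Entropy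

variable {X : Type*} [MeasurableSpace X]

/-- The Donsker–Varadhan bounds expressing that the relative entropy of `μ` with respect to the
finite measure `ν` is at most `a`. -/
def EntropyBound (μ ν : Measure X) (a : ℝ) : Prop :=
  ∀ f : X → ℝ, Measurable f → (∃ B, ∀ x, |f x| ≤ B) →
    ENNReal.ofReal (Real.exp (∫ x, f x ∂μ - a)) ≤ ∫⁻ x, ENNReal.ofReal (Real.exp (f x)) ∂ν

theorem integrable_of_abs_le {μ : Measure X} [IsFiniteMeasure μ] {f : X → ℝ} (hf : Measurable f)
    {B : ℝ} (hB : ∀ x, |f x| ≤ B) : Integrable f μ :=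
  Integrable.of_bound hf.aestronglyMeasurable B (ae_of_all _ hB)

theorem extIntegral_eq_integral {μ : Measure X} {g : X → ℝ} (hg : Integrable g μ) :
    extIntegral μ g = ((∫ x, g x ∂μ : ℝ) : EReal) := by
  have h1 : ∫⁻ x, ENNReal.ofReal (g x) ∂μ ≠ ⊤ := by
    refine ne_top_of_le_ne_top hg.2.ne (lintegral_mono fun x => ?_)
    exact Real.ofReal_le_enorm (g x)
  have h2 : ∫⁻ x, ENNReal.ofReal (-g x) ∂μ ≠ ⊤ := by
    refine ne_top_of_le_ne_top hg.2.ne (lintegral_mono fun x => ?_)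
    rw [← enorm_neg]
    exact Real.ofReal_le_enorm (-g x)
  rw [extIntegral, if_neg h1, integral_eq_lintegral_pos_part_sub_lintegral_neg_part hg,
    EReal.coe_sub, EReal.coe_ennreal_toReal h1, EReal.coe_ennreal_toReal h2]

theorem integrable_of_lintegral_ofReal {μ : Measure X} {g : X → ℝ} (hg : AEStronglyMeasurable g μ)
    (h1 : ∫⁻ x, ENNReal.ofReal (g x) ∂μ ≠ ⊤) (h2 : ∫⁻ x, ENNReal.ofReal (-g x) ∂μ ≠ ⊤) :
    Integrable g μ := by
  refine ⟨hg, ?_⟩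
  refine lt_of_le_of_lt (lintegral_mono (g := fun x => ENNReal.ofReal (g x) +
    ENNReal.ofReal (-g x)) fun x => ?_) ?_
  · rw [Real.enorm_eq_ofReal_abs]
    rcases le_total 0 (g x) with h | h
    · rw [abs_of_nonneg h]; exact le_self_add
    · rw [abs_of_nonpos h]; exact le_add_self
  · rw [lintegral_add_left' hg.aemeasurable.ennreal_ofReal]
    exact ENNReal.add_lt_top.2 ⟨h1.lt_top, h2.lt_top⟩

/-- Jensen's inequality from the tangent line at the mean `c`: `exp h ≥ exp c * (1 + (h - c))`, and
the right side integrates to `exp c`. -/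
theorem exp_integral_le_lintegral_exp {μ : Measure X} [IsProbabilityMeasure μ] {h : X → ℝ}
    (hh : Integrable h μ) :
    ENNReal.ofReal (Real.exp (∫ x, h x ∂μ)) ≤ ∫⁻ x, ENNReal.ofReal (Real.exp (h x)) ∂μ := by
  set c := ∫ x, h x ∂μ
  by_cases htop : ∫⁻ x, ENNReal.ofReal (Real.exp (h x)) ∂μ = ⊤
  · rw [htop]; exact le_top
  have hi : Integrable (fun x => Real.exp (h x)) μ := by
    refine ⟨Real.continuous_exp.comp_aestronglyMeasurable hh.1, ?_⟩
    refine lt_of_le_of_lt (lintegral_mono fun x => ?_) (lt_top_iff_ne_top.2 htop)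
    rw [Real.enorm_eq_ofReal (Real.exp_pos _).le]
  rw [← ofReal_integral_eq_lintegral_ofReal hi (ae_of_all _ fun x => (Real.exp_pos _).le)]
  refine ENNReal.ofReal_le_ofReal ?_
  have h1 : ∫ x, Real.exp c * (1 + (h x - c)) ∂μ = Real.exp c := by
    have h2 : ∫ x, (1 + (h x - c)) ∂μ = ∫ _, (1 : ℝ) ∂μ + ∫ x, (h x - c) ∂μ :=
      integral_add (integrable_const _) (hh.sub (integrable_const _))
    rw [integral_const_mul, h2, integral_sub hh (integrable_const _)]
    simp [c]
  rw [← h1]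
  refine integral_mono (((integrable_const _).add (hh.sub (integrable_const _))).const_mul _) hi
    fun x => ?_
  have h2 := Real.add_one_le_exp (h x - c)
  have h3 : Real.exp (h x) = Real.exp c * Real.exp (h x - c) := by
    rw [← Real.exp_add]; congr 1; ring
  simp only [h3]
  exact mul_le_mul_of_nonneg_left (by linarith) (Real.exp_pos c).le

/-- With `g` the log-density, Jensen is applied to `f - g` under `μ`. In `∫ exp (f - g) ∂μ` the
density cancels, leaving at most `∫ exp f` over `S` against `ν`. -/
theorem entropyBound_of_relEntropy_le {μ ν : Measure X} [IsProbabilityMeasure μ] [SigmaFinite ν]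
    {S : Set X} (hS : MeasurableSet S) (hμ : μ Sᶜ = 0) {a : ℝ} (h : relEntropy μ ν ≤ (a : EReal)) :
    EntropyBound μ (ν.restrict S) a := by
  rintro f hf ⟨B, hB⟩
  by_cases hac : μ ≪ ν
  swap
  · rw [relEntropy, if_neg hac] at h
    exact absurd h (by simp)
  rw [relEntropy, if_pos hac] at h
  set p := μ.rnDeriv ν with hp
  set g : X → ℝ := fun x => Real.log (p x).toReal with hg
  have hpm : Measurable p := Measure.measurable_rnDeriv μ ν
  have hgm : Measurable g := Real.measurable_log.comp hpm.ennreal_toReal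
  have hpos : ∫⁻ x, ENNReal.ofReal (g x) ∂μ ≠ ⊤ := by
    intro htop
    rw [extIntegral, if_pos htop] at h
    exact absurd h (by simp)
  have hFm : Measurable fun x => ENNReal.ofReal (Real.exp (f x - g x)) :=
    (Real.measurable_exp.comp (hf.sub hgm)).ennreal_ofReal
  have key : ∫⁻ x, ENNReal.ofReal (Real.exp (f x - g x)) ∂μ
      ≤ ∫⁻ x in S, ENNReal.ofReal (Real.exp (f x)) ∂ν := by
    have e1 : ∫⁻ x, ENNReal.ofReal (Real.exp (f x - g x)) ∂μ
        = ∫⁻ x, S.indicator (fun x => ENNReal.ofReal (Real.exp (f x - g x))) x ∂μ := by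
      refine lintegral_congr_ae ?_
      have : ∀ᵐ x ∂μ, x ∈ S := hμ
      filter_upwards [this] with x hx
      rw [indicator_of_mem hx]
    rw [e1, ← lintegral_rnDeriv_mul hac (hFm.indicator hS).aemeasurable,
      ← lintegral_indicator hS]
    refine lintegral_mono_ae ?_
    filter_upwards [Measure.rnDeriv_lt_top μ ν] with x hx
    by_cases hxS : x ∈ S
    · rw [indicator_of_mem hxS, indicator_of_mem hxS]
      by_cases hp0 : p x = 0
      · rw [← hp, hp0]; simp
      · have hpr : 0 < (p x).toReal := ENNReal.toReal_pos hp0 hx.ne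
        rw [← hp] at hx ⊢
        rw [← ENNReal.ofReal_toReal hx.ne, ← ENNReal.ofReal_mul hpr.le]
        refine ENNReal.ofReal_le_ofReal (le_of_eq ?_)
        rw [Real.exp_sub, hg]
        simp only [Real.exp_log hpr]
        field_simp
    · simp [hxS]
  by_cases htop : ∫⁻ x in S, ENNReal.ofReal (Real.exp (f x)) ∂ν = ⊤
  · rw [htop]; exact le_top
  -- The negative part of `g` is controlled by the exponential integral just bounded: `-g ≤ exp (f -
  -- g) + B`.
  have hneg : ∫⁻ x, ENNReal.ofReal (-g x) ∂μ ≠ ⊤ := by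
    refine ne_top_of_le_ne_top ?_ (lintegral_mono (g := fun x =>
      ENNReal.ofReal (Real.exp (f x - g x)) + ENNReal.ofReal B) fun x => ?_)
    · rw [lintegral_add_left hFm]
      refine ENNReal.add_ne_top.2 ⟨ne_top_of_le_ne_top htop key, ?_⟩
      simp
    · have hB0 : 0 ≤ B := (abs_nonneg _).trans (hB x)
      simp only
      rw [← ENNReal.ofReal_add (Real.exp_pos _).le hB0]
      refine ENNReal.ofReal_le_ofReal ?_
      have := Real.add_one_le_exp (f x - g x)
      have := neg_abs_le (f x)
      have := hB x
      linarith
  have hgi : Integrable g μ := integrable_of_lintegral_ofReal hgm.aestronglyMeasurable hpos hneg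
  rw [extIntegral_eq_integral hgi, EReal.coe_le_coe_iff] at h
  have hfi : Integrable f μ := integrable_of_abs_le hf hB
  refine le_trans ?_ ((exp_integral_le_lintegral_exp (hfi.sub hgi)).trans key)
  refine ENNReal.ofReal_le_ofReal (Real.exp_le_exp.2 ?_)
  have : ∫ x, (f - g) x ∂μ = ∫ x, f x ∂μ - ∫ x, g x ∂μ := integral_sub hfi hgi
  rw [this]
  linarith

/-- A quantitative form of absolute continuity. -/
theorem EntropyBound.measure_le {μ ν : Measure X} [IsProbabilityMeasure μ] [IsFiniteMeasure ν]
    {a : ℝ} (h : EntropyBound μ ν a) {A : Set X} (hA : MeasurableSet A) {t : ℝ} (ht : 0 < t) :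
    Real.exp (t * μ.real A - a) ≤ ν.real univ + Real.exp t * ν.real A := by
  -- The test function is `t` times the indicator of `A`.
  have h1 := h (A.indicator fun _ => t) (measurable_const.indicator hA) ⟨t, fun x => by
    by_cases hx : x ∈ A <;> simp [hx, abs_of_pos ht, ht.le]⟩
  rw [integral_indicator_const _ hA, smul_eq_mul, mul_comm] at h1
  have h2 : ∫⁻ x, ENNReal.ofReal (Real.exp (A.indicator (fun _ => t) x)) ∂ν
      ≤ ENNReal.ofReal (ν.real univ + Real.exp t * ν.real A) := by
    have : ∫⁻ x, ENNReal.ofReal (Real.exp (A.indicator (fun _ => t) x)) ∂ν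
        ≤ ∫⁻ x, (1 + A.indicator (fun _ => ENNReal.ofReal (Real.exp t)) x) ∂ν := by
      refine lintegral_mono fun x => ?_
      by_cases hx : x ∈ A <;> simp [hx]
    refine this.trans (le_of_eq ?_)
    rw [lintegral_add_left measurable_const, lintegral_indicator_const hA, lintegral_const,
      ENNReal.ofReal_add measureReal_nonneg (by positivity),
      ENNReal.ofReal_mul (Real.exp_pos t).le, ofReal_measureReal, ofReal_measureReal, one_mul]
  exact (ENNReal.ofReal_le_ofReal_iff (by positivity)).1 (h1.trans h2)

/-- On a `ν`-null set charged by `μ`, the left side of `EntropyBound.measure_le` would grow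
exponentially in `t` while the right side stays constant. -/
theorem EntropyBound.absolutelyContinuous {μ ν : Measure X} [IsProbabilityMeasure μ]
    [IsFiniteMeasure ν] {a : ℝ} (h : EntropyBound μ ν a) : μ ≪ ν := by
  refine Measure.AbsolutelyContinuous.mk fun A hA hν => ?_
  by_contra hne
  have hpos : 0 < μ.real A := ENNReal.toReal_pos hne (measure_ne_top _ _)
  have hlim : Tendsto (fun t : ℝ => Real.exp (t * μ.real A - a)) atTop atTop :=
    Real.tendsto_exp_atTop.comp
      (tendsto_atTop_add_const_right _ _ (tendsto_id.atTop_mul_const hpos))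
  obtain ⟨t, ht, ht0⟩ := ((hlim.eventually_gt_atTop (ν.real univ)).and
    (eventually_gt_atTop 0)).exists
  have h1 := h.measure_le hA ht0
  have h2 : ν.real A = 0 := by simp [Measure.real, hν]
  rw [h2, mul_zero, add_zero] at h1
  exact absurd (h1.trans_lt ht) (lt_irrefl _)

/-- The optimal test function is the log-density, which need not be bounded. Truncating it at `±n`
gives `∫ exp (f n) ≤ 1 + exp (-n) * ν S`, hence `∫ f n ∂μ ≤ a + log (1 + exp (-n) * ν S)`, and `n →
∞` finishes. Finiteness of `ν S` tames the negative part of the log-density. -/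
theorem relEntropy_le_of_entropyBound {μ ν : Measure X} [IsProbabilityMeasure μ] [SigmaFinite ν]
    {S : Set X} (hS : MeasurableSet S) (hμ : μ Sᶜ = 0) (hν : ν S ≠ ⊤) {a : ℝ}
    (h : EntropyBound μ (ν.restrict S) a) : relEntropy μ ν ≤ (a : EReal) := by
  have : IsFiniteMeasure (ν.restrict S) := ⟨by simpa using hν.lt_top⟩
  have hac : μ ≪ ν := h.absolutelyContinuous.trans Measure.restrict_le_self.absolutelyContinuous
  rw [relEntropy, if_pos hac]
  set p := μ.rnDeriv ν with hp
  set g : X → ℝ := fun x => Real.log (p x).toReal with hg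
  have hpm : Measurable p := Measure.measurable_rnDeriv μ ν
  have hgm : Measurable g := Real.measurable_log.comp hpm.ennreal_toReal
  have hpfin : ∀ᵐ x ∂μ, p x < ⊤ := hac.ae_le (Measure.rnDeriv_lt_top μ ν)
  have hppos : ∀ᵐ x ∂μ, 0 < p x := Measure.rnDeriv_pos hac
  -- Here `-g ≤ exp (-g)`, and the integral of `exp (-g)` over `S` against `μ` is at most `ν S`
  -- because `p * exp (-g)` is `1` or `0`.
  have hneg : ∫⁻ x, ENNReal.ofReal (-g x) ∂μ ≠ ⊤ := by
    refine ne_top_of_le_ne_top hν ?_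
    have hFm : Measurable fun x => ENNReal.ofReal (Real.exp (-g x)) :=
      (Real.measurable_exp.comp hgm.neg).ennreal_ofReal
    calc ∫⁻ x, ENNReal.ofReal (-g x) ∂μ
        ≤ ∫⁻ x, S.indicator (fun x => ENNReal.ofReal (Real.exp (-g x))) x ∂μ := by
          refine lintegral_mono_ae ?_
          have : ∀ᵐ x ∂μ, x ∈ S := hμ
          filter_upwards [this] with x hx
          rw [indicator_of_mem hx]
          refine ENNReal.ofReal_le_ofReal ?_
          have := Real.add_one_le_exp (-g x)
          linarith
      _ = ∫⁻ x, p x * S.indicator (fun x => ENNReal.ofReal (Real.exp (-g x))) x ∂ν :=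
          (lintegral_rnDeriv_mul hac (hFm.indicator hS).aemeasurable).symm
      _ ≤ ∫⁻ x, S.indicator 1 x ∂ν := by
          refine lintegral_mono_ae ?_
          filter_upwards [Measure.rnDeriv_lt_top μ ν] with x hx
          by_cases hxS : x ∈ S
          · rw [indicator_of_mem hxS, indicator_of_mem hxS]
            by_cases hp0 : p x = 0
            · rw [hp0]; simp
            · have hpr : 0 < (p x).toReal := ENNReal.toReal_pos hp0 hx.ne
              rw [← hp] at hx
              rw [← ENNReal.ofReal_toReal hx.ne, ← ENNReal.ofReal_mul hpr.le, Real.exp_neg, hg]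
              simp only [Real.exp_log hpr]
              rw [mul_inv_cancel₀ hpr.ne']
              simp
          · simp [hxS]
      _ = ν S := by rw [lintegral_indicator_one hS]
  have hnegi : Integrable (fun x => max (-g x) 0) μ := by
    refine integrable_of_lintegral_ofReal (hgm.neg.max measurable_const).aestronglyMeasurable
      ?_ ?_
    · simpa [ENNReal.ofReal_max] using hneg
    · have : ∀ x, ENNReal.ofReal (-max (-g x) 0) = 0 := fun x =>
        ENNReal.ofReal_of_nonpos (by simp)
      simp [this]
  -- The truncation is done inside the logarithm, so that `|f n| ≤ n` holds everywhere, including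
  -- where the density vanishes.
  let f : ℕ → X → ℝ := fun n x =>
    Real.log (max (Real.exp (-n)) (min (p x).toReal (Real.exp n)))
  have hfm : ∀ n, Measurable (f n) := fun n =>
    Real.measurable_log.comp (measurable_const.max (hpm.ennreal_toReal.min measurable_const))
  have hfpos : ∀ (n : ℕ) x, 0 < max (Real.exp (-n)) (min (p x).toReal (Real.exp n)) :=
    fun n x => lt_max_of_lt_left (Real.exp_pos _)
  have hfB : ∀ (n : ℕ) x, |f n x| ≤ n := by
    intro n x
    rw [abs_le]
    constructor
    · rw [Real.le_log_iff_exp_le (hfpos n x)]; exact le_max_left _ _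
    · rw [Real.log_le_iff_le_exp (hfpos n x)]
      refine max_le (Real.exp_le_exp.2 ?_) (min_le_right _ _)
      have : (0 : ℝ) ≤ n := Nat.cast_nonneg n
      linarith
  have hfi : ∀ n, Integrable (f n) μ := fun n => integrable_of_abs_le (hfm n) (hfB n)
  have hfg : ∀ᵐ x ∂μ, ∀ n : ℕ, f n x = max (-(n : ℝ)) (min (g x) n) := by
    filter_upwards [hpfin, hppos] with x h1 h2 n
    have hpr : 0 < (p x).toReal := ENNReal.toReal_pos h2.ne' h1.ne
    refine Real.exp_injective ?_
    rw [Real.exp_log (hfpos n x), Real.exp_monotone.map_max, Real.exp_monotone.map_min, hg]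
    simp only [Real.exp_log hpr]
  have hfint : ∀ n : ℕ, ∫ x, f n x ∂μ ≤ a + Real.log (1 + Real.exp (-n) * (ν S).toReal) := by
    intro n
    have hD : 0 < 1 + Real.exp (-n) * (ν S).toReal := by positivity
    have h1 := h (f n) (hfm n) ⟨n, hfB n⟩
    have h2 : ∫⁻ x in S, ENNReal.ofReal (Real.exp (f n x)) ∂ν
        ≤ ENNReal.ofReal (1 + Real.exp (-n) * (ν S).toReal) := by
      calc ∫⁻ x in S, ENNReal.ofReal (Real.exp (f n x)) ∂ν
          ≤ ∫⁻ x in S, (p x + ENNReal.ofReal (Real.exp (-n))) ∂ν := by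
            refine lintegral_mono_ae (ae_restrict_of_ae ?_)
            filter_upwards [Measure.rnDeriv_lt_top μ ν] with x hx
            rw [← hp] at hx
            rw [Real.exp_log (hfpos n x), ← ENNReal.ofReal_toReal hx.ne,
              ← ENNReal.ofReal_add ENNReal.toReal_nonneg (Real.exp_pos _).le]
            refine ENNReal.ofReal_le_ofReal (max_le ?_ ?_)
            · simp
            · rw [ENNReal.toReal_ofReal ENNReal.toReal_nonneg]
              exact (min_le_left _ _).trans (le_add_of_nonneg_right (Real.exp_pos _).le)
        _ ≤ 1 + ENNReal.ofReal (Real.exp (-n)) * ν S := by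
            rw [lintegral_add_left hpm, setLIntegral_const]
            gcongr
            exact (setLIntegral_le_lintegral _ _).trans
              ((Measure.lintegral_rnDeriv_le).trans (by simp))
        _ = _ := by
            rw [ENNReal.ofReal_add zero_le_one (by positivity), ENNReal.ofReal_one,
              ENNReal.ofReal_mul (Real.exp_pos _).le, ENNReal.ofReal_toReal hν]
    have h3 := (ENNReal.ofReal_le_ofReal_iff hD.le).1 (h1.trans h2)
    rw [← Real.le_log_iff_exp_le hD] at h3
    linarith
  -- Monotone convergence along `min g n`, whose positive part is at most `f n` plus the negative
  -- part of `g`; the integrals of these are bounded in `n`.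
  have hpos : ∫⁻ x, ENNReal.ofReal (g x) ∂μ ≠ ⊤ := by
    set C := a + Real.log (1 + (ν S).toReal) + ∫ x, max (-g x) 0 ∂μ
    have hn : ∀ n : ℕ, ∫⁻ x, ENNReal.ofReal (min (g x) n) ∂μ ≤ ENNReal.ofReal C := by
      intro n
      calc ∫⁻ x, ENNReal.ofReal (min (g x) n) ∂μ
          ≤ ∫⁻ x, ENNReal.ofReal (f n x + max (-g x) 0) ∂μ := by
            refine lintegral_mono_ae ?_
            filter_upwards [hfg] with x hx
            refine ENNReal.ofReal_le_ofReal ?_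
            rw [hx]
            exact (le_max_right _ _).trans (le_add_of_nonneg_right (le_max_right _ _))
        _ = ENNReal.ofReal (∫ x, (f n x + max (-g x) 0) ∂μ) := by
            refine (ofReal_integral_eq_lintegral_ofReal ((hfi n).add hnegi) ?_).symm
            filter_upwards [hfg] with x hx
            simp only [Pi.zero_apply, Pi.add_apply]
            rw [hx]
            have hn0 : (0 : ℝ) ≤ n := Nat.cast_nonneg n
            rcases le_total (g x) 0 with h0 | h0
            · have h1 : g x ≤ min (g x) n := le_min le_rfl (h0.trans hn0)
              have h2 := h1.trans (le_max_right (-n : ℝ) _)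
              have h3 := le_max_left (-g x) 0
              linarith
            · have h1 : 0 ≤ min (g x) n := le_min h0 hn0
              have h2 := h1.trans (le_max_right (-n : ℝ) _)
              have h3 := le_max_right (-g x) 0
              linarith
        _ ≤ ENNReal.ofReal C := by
            refine ENNReal.ofReal_le_ofReal ?_
            rw [integral_add (hfi n) hnegi]
            have h1 : Real.log (1 + Real.exp (-n) * (ν S).toReal)
                ≤ Real.log (1 + (ν S).toReal) := by
              refine Real.log_le_log (by positivity) ?_
              have : Real.exp (-n) ≤ 1 := Real.exp_le_one_iff.2 (by simp)
              have := mul_le_of_le_one_left (ENNReal.toReal_nonneg (a := ν S)) this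
              linarith
            have := hfint n
            linarith
    have hlim : Tendsto (fun n : ℕ => ∫⁻ x, ENNReal.ofReal (min (g x) n) ∂μ) atTop
        (𝓝 (∫⁻ x, ENNReal.ofReal (g x) ∂μ)) := by
      refine lintegral_tendsto_of_tendsto_of_monotone
        (fun n => (hgm.min measurable_const).ennreal_ofReal.aemeasurable) ?_ ?_
      · refine ae_of_all _ fun x m n hmn => ENNReal.ofReal_le_ofReal ?_
        exact min_le_min_left _ (Nat.cast_le.2 hmn)
      · refine ae_of_all _ fun x => tendsto_const_nhds.congr' ?_
        filter_upwards [eventually_ge_atTop ⌈g x⌉₊] with n hn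
        rw [min_eq_left ((Nat.le_ceil _).trans (Nat.cast_le.2 hn))]
    exact ne_top_of_le_ne_top ENNReal.ofReal_ne_top (le_of_tendsto' hlim hn)
  have hgi : Integrable g μ := integrable_of_lintegral_ofReal hgm.aestronglyMeasurable hpos hneg
  rw [extIntegral_eq_integral hgi, EReal.coe_le_coe_iff]
  have hlim : Tendsto (fun n => ∫ x, f n x ∂μ) atTop (𝓝 (∫ x, g x ∂μ)) := by
    refine tendsto_integral_of_dominated_convergence (fun x => |g x|)
      (fun n => (hfm n).aestronglyMeasurable) hgi.abs ?_ ?_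
    · intro n
      filter_upwards [hfg] with x hx
      rw [hx, Real.norm_eq_abs, abs_le]
      have hn0 : (0 : ℝ) ≤ n := Nat.cast_nonneg n
      constructor
      · refine le_max_of_le_right (le_min (neg_abs_le _) ?_)
        have := abs_nonneg (g x)
        linarith
      · refine max_le ?_ ((min_le_left _ _).trans (le_abs_self _))
        have := abs_nonneg (g x)
        linarith
    · filter_upwards [hfg] with x hx
      refine tendsto_const_nhds.congr' ?_
      filter_upwards [eventually_ge_atTop ⌈|g x|⌉₊] with n hn
      have h1 : |g x| ≤ n := (Nat.le_ceil _).trans (Nat.cast_le.2 hn)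
      rw [abs_le] at h1
      rw [hx, min_eq_left h1.2, max_eq_right h1.1]
  have hlim2 : Tendsto (fun n : ℕ => a + Real.log (1 + Real.exp (-n) * (ν S).toReal)) atTop
      (𝓝 (a + Real.log (1 + 0 * (ν S).toReal))) := by
    refine tendsto_const_nhds.add ?_
    refine Tendsto.log ?_ (by simp)
    refine tendsto_const_nhds.add (Tendsto.mul_const _ ?_)
    exact Real.tendsto_exp_neg_atTop_nhds_zero.comp tendsto_natCast_atTop_atTop
  have := le_of_tendsto_of_tendsto' hlim hlim2 hfint
  simpa using this

end Entropy

/-! ## Height spaces -/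

instance HeightKind.instBorelSpace : (k : HeightKind) → BorelSpace k.E
  | .int => inferInstanceAs (BorelSpace ℤ)
  | .real => inferInstanceAs (BorelSpace ℝ)

instance HeightKind.instSecondCountableTopology : (k : HeightKind) → SecondCountableTopology k.E
  | .int => inferInstanceAs (SecondCountableTopology ℤ)
  | .real => inferInstanceAs (SecondCountableTopology ℝ)

instance HeightKind.instMetrizableSpace : (k : HeightKind) → TopologicalSpace.MetrizableSpace k.E
  | .int => inferInstanceAs (TopologicalSpace.MetrizableSpace ℤ)
  | .real => inferInstanceAs (TopologicalSpace.MetrizableSpace ℝ)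

instance HeightKind.instIsTopologicalAddGroup : (k : HeightKind) → IsTopologicalAddGroup k.E
  | .int => inferInstanceAs (IsTopologicalAddGroup ℤ)
  | .real => inferInstanceAs (IsTopologicalAddGroup ℝ)

instance HeightKind.instMeasurableAdd₂ : (k : HeightKind) → MeasurableAdd₂ k.E
  | .int => inferInstanceAs (MeasurableAdd₂ ℤ)
  | .real => inferInstanceAs (MeasurableAdd₂ ℝ)

instance HeightKind.instMeasurableNeg : (k : HeightKind) → MeasurableNeg k.E
  | .int => inferInstanceAs (MeasurableNeg ℤ)
  | .real => inferInstanceAs (MeasurableNeg ℝ)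

instance HeightKind.instIsAddLeftInvariant :
    (k : HeightKind) → k.refMeasure.IsAddLeftInvariant
  | .int => inferInstanceAs (Measure.count : Measure ℤ).IsAddLeftInvariant
  | .real => inferInstanceAs (volume : Measure ℝ).IsAddLeftInvariant

instance HeightKind.instIsNegInvariant : (k : HeightKind) → k.refMeasure.IsNegInvariant
  | .int => inferInstanceAs (Measure.count : Measure ℤ).IsNegInvariant
  | .real => inferInstanceAs (volume : Measure ℝ).IsNegInvariant

theorem HeightKind.continuous_toReal : (k : HeightKind) → Continuous k.toReal
  | .int => show Continuous (fun n : ℤ => (n : ℝ)) from continuous_of_discreteTopology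
  | .real => continuous_id

theorem HeightKind.toReal_sub : (k : HeightKind) → (a b : k.E) →
    k.toReal (a - b) = k.toReal a - k.toReal b
  | .int, a, b => Int.cast_sub (R := ℝ) a b
  | .real, _, _ => rfl

theorem HeightKind.isCompact_abs_toReal_le :
    (k : HeightKind) → (K : ℝ) → IsCompact {a : k.E | |k.toReal a| ≤ K}
  | .int, K => by
    change IsCompact {a : ℤ | |(a : ℝ)| ≤ K}
    refine Set.Finite.isCompact ((Set.finite_Icc (-⌈K⌉) ⌈K⌉).subset fun a ha => ?_)
    have h := (ha : |(a : ℝ)| ≤ K).trans (Int.le_ceil K)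
    rw [abs_le] at h
    constructor
    · have : ((-⌈K⌉ : ℤ) : ℝ) ≤ a := by push_cast; linarith [h.1]
      exact_mod_cast this
    · exact_mod_cast h.2
  | .real, K => by
    change IsCompact {a : ℝ | |a| ≤ K}
    have : {a : ℝ | |a| ≤ K} = Set.Icc (-K) K := by ext; simp [abs_le]
    rw [this]; exact isCompact_Icc

theorem HeightKind.refMeasure_lt_top_of_isCompact :
    (k : HeightKind) → {s : Set k.E} → IsCompact s → k.refMeasure s < ⊤
  | .int, s, h => by
    have : (s : Set ℤ).Finite := IsCompact.finite_of_discrete (X := ℤ) h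
    exact Measure.count_apply_lt_top.2 this
  | .real, s, h => IsCompact.measure_lt_top (α := ℝ) (μ := volume) h

theorem HeightKind.measurable_toReal (k : HeightKind) : Measurable k.toReal :=
  k.continuous_toReal.measurable

/-- The reference measure of the ball of radius `K` in the height space. -/
def ballMass (k : HeightKind) (K : ℝ) : ℝ≥0∞ := k.refMeasure {a | |k.toReal a| ≤ K}

theorem ballMass_ne_top (K : ℝ) : ballMass k K ≠ ⊤ :=
  (k.refMeasure_lt_top_of_isCompact (k.isCompact_abs_toReal_le K)).ne

/-! ## Functions of the height differences -/

theorem gradAlgOn_eq_comap (Λ : Set (Site d)) : gradAlgOn d k Λ =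
    MeasurableSpace.comap (fun (φ : HeightFn d k) (p : Λ × Λ) => φ p.2 - φ p.1)
      MeasurableSpace.pi := by
  rw [MeasurableSpace.pi, MeasurableSpace.comap_iSup, iSup_prod, gradAlgOn, iSup_subtype']
  refine iSup_congr fun x => ?_
  rw [iSup_subtype']
  refine iSup_congr fun y => ?_
  rw [MeasurableSpace.comap_comp]
  rfl

theorem gradAlgOn_le_pi (Λ : Set (Site d)) :
    gradAlgOn d k Λ ≤ (MeasurableSpace.pi : MeasurableSpace (Site d → k.E)) := by
  refine iSup₂_le fun x _ => iSup₂_le fun y _ => ?_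
  have : Measurable fun φ : Site d → k.E => φ y - φ x :=
    (measurable_pi_apply y).sub (measurable_pi_apply x)
  exact measurable_iff_comap_le.1 this

theorem measurable_sub_gradAlgOn {Λ : Set (Site d)} {x y : Site d} (hx : x ∈ Λ) (hy : y ∈ Λ) :
    Measurable[gradAlgOn d k Λ] fun φ : HeightFn d k => φ y - φ x :=
  measurable_iff_comap_le.2 (le_iSup₂_of_le x hx (le_iSup₂_of_le y hy le_rfl))

/-- The `σ`-algebra is a pullback under the map to height differences, so a level set of `f` is a
preimage under that map and cannot separate functions with equal differences. -/
theorem eq_of_measurable_gradAlgOn {Y : Type*} [MeasurableSpace Y] [MeasurableSingletonClass Y]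
    {Λ : Set (Site d)} {f : HeightFn d k → Y} (hf : Measurable[gradAlgOn d k Λ] f)
    {φ ψ : HeightFn d k} (h : ∀ x ∈ Λ, ∀ y ∈ Λ, φ y - φ x = ψ y - ψ x) : f φ = f ψ := by
  have h1 : MeasurableSet[gradAlgOn d k Λ] (f ⁻¹' {f ψ}) := hf (measurableSet_singleton _)
  rw [gradAlgOn_eq_comap] at h1
  obtain ⟨B, -, hB⟩ := h1
  have h2 : ψ ∈ f ⁻¹' {f ψ} := rfl
  have h3 : φ ∈ f ⁻¹' {f ψ} := by
    rw [← hB] at h2 ⊢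
    simp only [mem_preimage] at h2 ⊢
    convert h2 using 1
    funext p
    exact h _ p.1.2 _ p.2.2
  exact h3

/-! ## The reference measures as iterated integrals -/

/-- The iterated integral over the heights in `s`. -/
def heightIntegral (s : Finset (Site d)) (f : (Site d → k.E) → ℝ≥0∞) (φ : Site d → k.E) : ℝ≥0∞ :=
  lmarginal (fun _ => k.refMeasure) s f φ

theorem heightIntegral_mul_left {s : Finset (Site d)} {f g : (Site d → k.E) → ℝ≥0∞}
    (hf : Measurable f) (hg : DependsOn g (s : Set (Site d))ᶜ) (φ : Site d → k.E) :
    heightIntegral s (fun φ => g φ * f φ) φ = g φ * heightIntegral s f φ := by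
  simp only [heightIntegral, lmarginal]
  refine Eq.trans (lintegral_congr fun y => ?_)
    (lintegral_const_mul (g φ) (hf.comp measurable_updateFinset))
  congr 1
  refine hg fun i hi => ?_
  simp only [Set.mem_compl_iff, Finset.mem_coe] at hi
  simp [Function.updateFinset, hi]

theorem dependsOn_heightIntegral {s : Finset (Site d)} {A : Set (Site d)}
    {f : (Site d → k.E) → ℝ≥0∞} (hf : DependsOn f A) :
    DependsOn (heightIntegral s f) (A \ s) := by
  intro φ ψ h
  simp only [heightIntegral, lmarginal]
  refine lintegral_congr fun y => hf fun i hi => ?_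
  by_cases his : i ∈ s
  · simp [Function.updateFinset, his]
  · simp only [Function.updateFinset, his, dif_neg, not_false_eq_true]
    exact h i ⟨hi, by simpa using his⟩

theorem heightIntegral_add_const {s : Finset (Site d)} {f : (Site d → k.E) → ℝ≥0∞}
    (hfc : ∀ (c : k.E) φ, f (fun y => c + φ y) = f φ) (c : k.E)
    (φ : Site d → k.E) :
    heightIntegral s f (fun y => c + φ y) = heightIntegral s f φ := by
  simp only [heightIntegral, lmarginal]
  rw [← lintegral_add_left_eq_self _ (fun _ : s => c)]
  refine lintegral_congr fun y => ?_
  rw [← hfc c (Function.updateFinset φ s y)]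
  congr 1
  funext i
  by_cases his : i ∈ s <;> simp [Function.updateFinset, his]

theorem heightIntegral_mono {s : Finset (Site d)} {f g : (Site d → k.E) → ℝ≥0∞}
    (hfg : ∀ φ, f φ ≤ g φ) (φ : Site d → k.E) : heightIntegral s f φ ≤ heightIntegral s g φ :=
  lmarginal_mono (fun φ => hfg φ) φ

theorem heightIntegral_union {s t : Finset (Site d)} {f : (Site d → k.E) → ℝ≥0∞}
    (hf : Measurable f) (hst : Disjoint s t) (φ : Site d → k.E) :
    heightIntegral (s ∪ t) f φ = heightIntegral s (heightIntegral t f) φ :=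
  congrFun (lmarginal_union _ f hf hst) φ

theorem heightIntegral_erase {s : Finset (Site d)} {f : (Site d → k.E) → ℝ≥0∞}
    (hf : Measurable f) {x : Site d} (hx : x ∈ s) (φ : Site d → k.E) :
    heightIntegral s f φ
      = ∫⁻ a, heightIntegral (s.erase x) f (Function.update φ x a) ∂k.refMeasure :=
  lmarginal_erase f hf hx φ

section Gradient

variable {Λ : Finset (Site d)} {f : HeightFn d k → ℝ≥0∞}

theorem measurable_pi_of_gradAlgOn {Y : Type*} [MeasurableSpace Y] {Λ : Set (Site d)}
    {f : HeightFn d k → Y} (hf : Measurable[gradAlgOn d k Λ] f) :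
    Measurable (fun φ : Site d → k.E => f φ) :=
  fun _ hA => gradAlgOn_le_pi Λ _ (hf hA)

theorem dependsOn_of_gradAlgOn {Y : Type*} [MeasurableSpace Y] [MeasurableSingletonClass Y]
    {Λ : Set (Site d)} {f : HeightFn d k → Y} (hf : Measurable[gradAlgOn d k Λ] f) :
    DependsOn (fun φ : Site d → k.E => f φ) Λ :=
  fun φ ψ h => eq_of_measurable_gradAlgOn (φ := φ) (ψ := ψ) hf fun x hx y hy => by
    rw [h x hx, h y hy]

theorem const_add_of_gradAlgOn {Y : Type*} [MeasurableSpace Y] [MeasurableSingletonClass Y]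
    {Λ : Set (Site d)} {f : HeightFn d k → Y} (hf : Measurable[gradAlgOn d k Λ] f)
    (c : k.E) (φ : Site d → k.E) : f (fun y => c + φ y) = f φ :=
  eq_of_measurable_gradAlgOn (ψ := φ) hf fun x _ y _ => by
    show (c + φ y) - (c + φ x) = φ y - φ x
    abel

/-- The iterated integral of a function of the height differences does not depend on the
reference vertex or its height. -/
theorem heightIntegral_erase_eq (hf : Measurable[gradAlgOn d k (Λ : Set (Site d))] f)
    {x x' : Site d} (hx : x ∈ Λ) (hx' : x' ∈ Λ) (φ φ' : Site d → k.E) :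
    heightIntegral (Λ.erase x) f φ = heightIntegral (Λ.erase x') f φ' := by
  have hm := measurable_pi_of_gradAlgOn hf
  have hdep := dependsOn_of_gradAlgOn hf
  have hc := const_add_of_gradAlgOn hf
  by_cases hxx : x = x'
  · subst hxx
    -- With a common reference vertex only its height matters, and a global shift makes the two
    -- heights equal.
    rw [← heightIntegral_add_const hc (φ' x - φ x) φ]
    refine dependsOn_heightIntegral hdep fun y hy => ?_
    have : y = x := by
      by_contra hne
      exact hy.2 (by simpa [hne] using hy.1)
    subst this
    simp
  -- After all other vertices are integrated out, `h` depends only on the difference between the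
  -- heights at `x'` and `x`. The reflection `a ↦ φ x + φ' x' - a`, which preserves the reference
  -- measure, exchanges the roles of the two vertices.
  · set h := heightIntegral ((Λ.erase x).erase x') f with hh
    have hhdep : DependsOn h ({x, x'} : Set (Site d)) := by
      refine (dependsOn_heightIntegral hdep).mono ?_
      intro y hy
      by_contra hne
      simp only [mem_insert_iff, mem_singleton_iff, not_or] at hne
      exact hy.2 (by simpa [hne.1, hne.2] using hy.1)
    rw [heightIntegral_erase hm (x := x') (Finset.mem_erase.2 ⟨Ne.symm hxx, hx'⟩),
      heightIntegral_erase (s := Λ.erase x') hm (x := x) (Finset.mem_erase.2 ⟨hxx, hx⟩),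
      Finset.erase_right_comm (a := x') (b := x), ← hh,
      ← lintegral_sub_left_eq_self (μ := k.refMeasure)
        (fun a => h (Function.update φ' x a)) (φ x + φ' x')]
    refine lintegral_congr fun t => ?_
    refine (heightIntegral_add_const hc (φ' x' - t) (Function.update φ x' t)).symm.trans ?_
    refine hhdep fun y hy => ?_
    rcases hy with rfl | hy
    · simp [Function.update_of_ne hxx]; abel
    · rw [mem_singleton_iff] at hy
      subst hy
      simp [Function.update_of_ne (Ne.symm hxx)]

/-- The integral against the gradient reference measure. -/
def refIntegral (Λ : Finset (Site d)) (f : HeightFn d k → ℝ≥0∞) : ℝ≥0∞ :=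
  @lintegral _ (gradAlgOn d k (Λ : Set (Site d))) (gradRefMeasure k Λ) f

theorem refIntegral_eq_heightIntegral (hf : Measurable[gradAlgOn d k (Λ : Set (Site d))] f)
    {x : Site d} (hx : x ∈ Λ) (φ : Site d → k.E) :
    refIntegral Λ f = heightIntegral (Λ.erase x) f φ := by
  have hne : Λ.Nonempty := ⟨x, hx⟩
  rw [heightIntegral_erase_eq hf hx hne.choose_spec φ 0, refIntegral, gradRefMeasure,
    dif_pos hne, gradRefMeasureAt,
    @lintegral_map _ _ MeasurableSpace.pi (gradAlgOn d k (Λ : Set (Site d))) _ _ _ hf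
      (measurable_extendByZero _ _)]
  rfl

/-- With the height at `x` held fixed, integrating out the rest of `Λ` gives `refIntegral Λ f`,
whatever that height is. The remaining integral over the height at `x` sees only the indicator of a
translated ball. -/
theorem heightIntegral_mul_indicator (hf : Measurable[gradAlgOn d k (Λ : Set (Site d))] f)
    {x z : Site d} (hx : x ∈ Λ) (hz : z ∉ Λ) (K : ℝ) (φ : Site d → k.E) :
    heightIntegral Λ (fun φ => {φ | |k.toReal (φ x - φ z)| ≤ K}.indicator 1 φ * f φ) φ
      = ballMass k K * refIntegral Λ f := by
  have hm := measurable_pi_of_gradAlgOn hf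
  have hset : MeasurableSet {φ : Site d → k.E | |k.toReal (φ x - φ z)| ≤ K} :=
    measurableSet_le ((k.measurable_toReal.comp
      ((measurable_pi_apply x).sub (measurable_pi_apply z))).abs) measurable_const
  have hgm : Measurable fun φ : Site d → k.E =>
      {φ : Site d → k.E | |k.toReal (φ x - φ z)| ≤ K}.indicator
        (1 : (Site d → k.E) → ℝ≥0∞) φ :=
    measurable_one.indicator hset
  refine (heightIntegral_erase (f := fun φ : Site d → k.E => {φ : Site d → k.E |
    |k.toReal (φ x - φ z)| ≤ K}.indicator 1 φ * f φ) (hgm.mul hm) hx φ).trans ?_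
  have hxz : x ≠ z := fun h => hz (h ▸ hx)
  have hball : MeasurableSet {a : k.E | |k.toReal a| ≤ K} :=
    measurableSet_le k.measurable_toReal.abs measurable_const
  calc ∫⁻ a, heightIntegral (Λ.erase x) (fun φ => {φ : Site d → k.E |
          |k.toReal (φ x - φ z)| ≤ K}.indicator 1 φ * f φ) (Function.update φ x a) ∂k.refMeasure
      = ∫⁻ a, {a : k.E | |k.toReal a| ≤ K}.indicator 1 (-φ z + a) * refIntegral Λ f
          ∂k.refMeasure := by
        refine lintegral_congr fun a => ?_
        rw [heightIntegral_mul_left hm, refIntegral_eq_heightIntegral hf hx]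
        · congr 1
          simp only [indicator, mem_ofPred_eq, Function.update_self,
            Function.update_of_ne (Ne.symm hxz), neg_add_eq_sub]
          rfl
        · intro φ ψ h
          have h1 : φ x = ψ x := h x (by simp)
          have h2 : φ z = ψ z := h z (by simp [hz])
          simp [indicator, h1, h2]
    _ = _ := by
        refine (lintegral_mul_const (f := fun a => {a : k.E | |k.toReal a| ≤ K}.indicator
          (1 : k.E → ℝ≥0∞) (-φ z + a)) _ ((measurable_one.indicator hball).comp
          (measurable_const.add measurable_id))).trans ?_
        rw [lintegral_add_left_eq_self (μ := k.refMeasure)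
            (fun a => {a : k.E | |k.toReal a| ≤ K}.indicator 1 a),
          lintegral_indicator_one hball]
        rfl

end Gradient

/-! ## Translations -/

theorem measurable_shift_gradAlgOn (l : Site d) (Λ : Finset (Site d)) :
    Measurable[gradAlgOn d k (Λ.image (· + l) : Finset (Site d)), gradAlgOn d k (Λ : Set (Site d))]
      (shift (k := k) l) := by
  rw [gradAlgOn_eq_comap (Λ : Set (Site d)), measurable_iff_comap_le, MeasurableSpace.comap_comp,
    ← measurable_iff_comap_le]
  refine @measurable_pi_lambda _ _ _ (_) _ _ fun p => ?_
  have h : ∀ y : (Λ : Set (Site d)), (y : Site d) + l ∈ ((Λ.image (· + l) : Finset (Site d)) :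
      Set (Site d)) := fun y => by
    simp
  exact measurable_sub_gradAlgOn (h p.1) (h p.2)

theorem refIntegral_shift {Λ : Finset (Site d)} (hΛ : Λ.Nonempty) {f : HeightFn d k → ℝ≥0∞}
    (hf : Measurable[gradAlgOn d k (Λ : Set (Site d))] f) (l : Site d) :
    refIntegral (Λ.image (· + l)) (fun φ => f (shift l φ)) = refIntegral Λ f := by
  obtain ⟨x, hx⟩ := hΛ
  have hfl : Measurable[gradAlgOn d k (Λ.image (· + l) : Finset (Site d))]
      fun φ : HeightFn d k => f (shift l φ) := fun _ hA => measurable_shift_gradAlgOn l Λ (hf hA)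
  have he : Function.Injective fun y : Site d => y + l := add_left_injective l
  rw [refIntegral_eq_heightIntegral hf hx 0,
    refIntegral_eq_heightIntegral hfl (Finset.mem_image_of_mem _ hx) 0,
    ← Finset.image_erase he]
  exact lmarginal_image (X := fun _ => k.E) (μ := fun _ => k.refMeasure) he (Λ.erase x)
    (measurable_pi_of_gradAlgOn hf) 0

/-! ## Integrals over unions of blocks -/

/-- The indicator function of the height functions with an increment of at most `K` between `z`
and `x`. -/
def linkIndicator (K : ℝ) (x z : Site d) (φ : Site d → k.E) : ℝ≥0∞ :=
  {φ : Site d → k.E | |k.toReal (φ x - φ z)| ≤ K}.indicator 1 φ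

theorem measurable_linkIndicator (K : ℝ) (x z : Site d) :
    Measurable (linkIndicator (k := k) K x z) :=
  measurable_one.indicator (measurableSet_le ((k.measurable_toReal.comp
      ((measurable_pi_apply x).sub (measurable_pi_apply z))).abs) measurable_const)

theorem dependsOn_linkIndicator (K : ℝ) (x z : Site d) {A : Set (Site d)} (hx : x ∈ A)
    (hz : z ∈ A) : DependsOn (linkIndicator (k := k) K x z) A := by
  intro φ ψ h
  simp [linkIndicator, indicator, h x hx, h z hz]

/-- The blocks are integrated out in order of decreasing rank of their linking vertices `x i`. No
other remaining link reaches into the block currently removed, so that block contributes a constant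
factor. -/
theorem heightIntegral_blocks {ι : Type*} [DecidableEq ι] (rank : Site d → ℤ) (K : ℝ)
    (B : ι → Finset (Site d)) (x z : ι → Site d) (F : ι → HeightFn d k → ℝ≥0∞) (T : Finset ι)
    (hF : ∀ i ∈ T, Measurable[gradAlgOn d k (B i : Set (Site d))] (F i))
    (hB : (T : Set ι).PairwiseDisjoint B) (hx : ∀ i ∈ T, x i ∈ B i)
    (hmin : ∀ i ∈ T, ∀ y ∈ B i, rank (x i) ≤ rank y) (hz : ∀ i ∈ T, rank (z i) < rank (x i))
    (φ : Site d → k.E) :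
    heightIntegral (T.biUnion B)
        (fun φ => ∏ i ∈ T, (linkIndicator K (x i) (z i) φ * F i φ)) φ
      = ∏ i ∈ T, (ballMass k K * refIntegral (B i) (F i)) := by
  induction T using Finset.induction_on_max_value (fun i => rank (x i)) generalizing φ with
  | empty => simp [heightIntegral]
  | insert a s has hmax ih =>
    have hm : ∀ i ∈ insert a s, Measurable fun φ : Site d → k.E =>
        linkIndicator K (x i) (z i) φ * F i φ := fun i hi =>
      (measurable_linkIndicator K _ _).mul (measurable_pi_of_gradAlgOn (hF i hi))
    have hms : Measurable fun φ : Site d → k.E =>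
        ∏ i ∈ s, (linkIndicator K (x i) (z i) φ * F i φ) :=
      Finset.measurable_fun_prod _ fun i hi => hm i (Finset.mem_insert_of_mem hi)
    have hma := hm a (Finset.mem_insert_self a s)
    have hdisj : ∀ i ∈ s, Disjoint (B i) (B a) := fun i hi =>
      hB (by simp [hi]) (by simp) (fun h => has (h ▸ hi))
    have haz : z a ∉ B a := fun h =>
      absurd (hz a (Finset.mem_insert_self a s))
        (not_lt.2 (hmin a (Finset.mem_insert_self a s) _ h))
    rw [Finset.biUnion_insert, Finset.union_comm, Finset.prod_insert has]
    have e1 : (fun φ : Site d → k.E => ∏ i ∈ insert a s, (linkIndicator K (x i) (z i) φ * F i φ))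
        = fun φ => (∏ i ∈ s, (linkIndicator K (x i) (z i) φ * F i φ)) *
            (linkIndicator K (x a) (z a) φ * F a φ) := by
      funext φ
      rw [Finset.prod_insert has, mul_comm]
    have hdep : DependsOn (fun φ : Site d → k.E =>
        ∏ i ∈ s, (linkIndicator K (x i) (z i) φ * F i φ)) ((B a : Set (Site d))ᶜ) := by
      intro φ ψ h
      refine Finset.prod_congr rfl fun i hi => ?_
      have hi' := Finset.mem_insert_of_mem (b := a) hi
      have h1 : ∀ y ∈ B i, y ∉ B a := fun y hy => Finset.disjoint_left.1 (hdisj i hi) hy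
      congr 1
      · refine dependsOn_linkIndicator K (x i) (z i) ?_ ?_ h
        · simpa using h1 _ (hx i hi')
        -- If `z i` lay in `B a`, its rank would be at least that of `x a`, hence at least that of
        -- `x i`, contradicting that links point to smaller rank.
        · intro hza
          have h2 := hmin a (Finset.mem_insert_self a s) _ hza
          have h3 := hz i hi'
          have h4 := hmax i hi
          exact absurd (h2.trans_lt (h3.trans_le h4)) (lt_irrefl _)
      · exact dependsOn_of_gradAlgOn (hF i hi') fun y hy => h y (by simpa using h1 y hy)
    have e2 : heightIntegral (B a) (fun φ : Site d → k.E =>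
        (∏ i ∈ s, (linkIndicator K (x i) (z i) φ * F i φ)) *
            (linkIndicator K (x a) (z a) φ * F a φ))
        = fun φ => (ballMass k K * refIntegral (B a) (F a)) *
            ∏ i ∈ s, (linkIndicator K (x i) (z i) φ * F i φ) := by
      funext φ
      refine (heightIntegral_mul_left hma hdep φ).trans ?_
      rw [mul_comm]
      congr 1
      exact heightIntegral_mul_indicator (hF a (Finset.mem_insert_self a s))
        (hx a (Finset.mem_insert_self a s)) haz K φ
    rw [e1]
    refine (heightIntegral_union (hms.mul hma) ?_ φ).trans ?_
    · rw [Finset.disjoint_biUnion_left]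
      exact hdisj
    · refine (congrFun (congrArg (heightIntegral (s.biUnion B)) e2) φ).trans ?_
      refine (heightIntegral_mul_left hms (fun _ _ _ => rfl) φ).trans ?_
      congr 1
      exact ih (fun i hi => hF i (Finset.mem_insert_of_mem hi))
        (hB.subset (by simp)) (fun i hi => hx i (Finset.mem_insert_of_mem hi))
        (fun i hi => hmin i (Finset.mem_insert_of_mem hi))
        (fun i hi => hz i (Finset.mem_insert_of_mem hi)) φ

/-- The integral over the heights in a set that is decomposed into a root block and further
blocks, each of which is linked by a bounded increment to a vertex of smaller rank. -/
theorem refIntegral_le_blocks {ι : Type*} [DecidableEq ι] (rank : Site d → ℤ) (K : ℝ)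
    {Λ Λ₀ : Finset (Site d)} {x₀ : Site d} (hx₀ : x₀ ∈ Λ₀)
    (B : ι → Finset (Site d)) (x z : ι → Site d) (T : Finset ι)
    (hΛ : Λ = Λ₀ ∪ T.biUnion B) (hdisj : ∀ i ∈ T, Disjoint Λ₀ (B i))
    (hB : (T : Set ι).PairwiseDisjoint B) (hx : ∀ i ∈ T, x i ∈ B i)
    (hmin : ∀ i ∈ T, ∀ y ∈ B i, rank (x i) ≤ rank y) (hz : ∀ i ∈ T, rank (z i) < rank (x i))
    {h f₀ : HeightFn d k → ℝ≥0∞} (F : ι → HeightFn d k → ℝ≥0∞)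
    (hh : Measurable[gradAlgOn d k (Λ : Set (Site d))] h)
    (hf₀ : Measurable[gradAlgOn d k (Λ₀ : Set (Site d))] f₀)
    (hF : ∀ i ∈ T, Measurable[gradAlgOn d k (B i : Set (Site d))] (F i))
    (hle : ∀ φ, h φ ≤ f₀ φ * ∏ i ∈ T, (linkIndicator K (x i) (z i) φ * F i φ)) :
    refIntegral Λ h ≤ refIntegral Λ₀ f₀ * ∏ i ∈ T, (ballMass k K * refIntegral (B i) (F i)) := by
  have hx₀Λ : x₀ ∈ Λ := hΛ ▸ Finset.mem_union_left _ hx₀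
  have hdisj' : Disjoint Λ₀ (T.biUnion B) := by
    rw [Finset.disjoint_biUnion_right]; exact hdisj
  have hsplit : Λ.erase x₀ = Λ₀.erase x₀ ∪ T.biUnion B := by
    rw [hΛ, Finset.erase_union_distrib,
      Finset.erase_eq_of_notMem (Finset.disjoint_left.1 hdisj' hx₀)]
  have hm : Measurable fun φ : Site d → k.E =>
      ∏ i ∈ T, (linkIndicator K (x i) (z i) φ * F i φ) :=
    Finset.measurable_fun_prod _ fun i hi =>
      (measurable_linkIndicator K _ _).mul (measurable_pi_of_gradAlgOn (hF i hi))
  have hm₀ := measurable_pi_of_gradAlgOn hf₀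
  have hinner : heightIntegral (T.biUnion B) (fun φ : Site d → k.E =>
      f₀ φ * ∏ i ∈ T, (linkIndicator K (x i) (z i) φ * F i φ))
      = fun φ => (∏ i ∈ T, (ballMass k K * refIntegral (B i) (F i))) * f₀ φ := by
    funext φ
    refine (heightIntegral_mul_left hm ?_ φ).trans ?_
    · refine (dependsOn_of_gradAlgOn hf₀).mono fun y hy => ?_
      simpa using fun i hi => Finset.disjoint_left.1 (hdisj i hi) hy
    · rw [mul_comm]
      congr 1
      exact heightIntegral_blocks rank K B x z F T hF hB hx hmin hz φ
  -- The reference vertex is placed in the root block, which alone needs no link.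
  rw [refIntegral_eq_heightIntegral hh hx₀Λ 0, hsplit]
  refine (heightIntegral_mono hle _).trans (le_of_eq ?_)
  refine (heightIntegral_union (hm₀.mul hm)
    (hdisj'.mono_left (Finset.erase_subset _ _)) _).trans ?_
  refine (congrFun (congrArg (heightIntegral (Λ₀.erase x₀)) hinner) 0).trans ?_
  refine (heightIntegral_mul_left hm₀ (fun _ _ _ => rfl) _).trans ?_
  rw [refIntegral_eq_heightIntegral hf₀ hx₀ 0, mul_comm]

/-! ## Boltzmann weights -/

/-- The second conjunct travels through the induction because negation distributes over a sum only
when `∞ - ∞` is excluded. -/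
theorem EReal_exp_neg_sum {ι : Type*} (s : Finset ι) (f : ι → EReal) (hf : ∀ i, f i ≠ ⊥) :
    EReal.exp (-∑ i ∈ s, f i) = ∏ i ∈ s, EReal.exp (-f i) ∧ ∑ i ∈ s, f i ≠ ⊥ := by
  classical
  induction s using Finset.induction_on with
  | empty => simp
  | insert a s has ih =>
    rw [Finset.sum_insert has, Finset.prod_insert has]
    constructor
    · rw [EReal.neg_add (Or.inl (hf a)) (Or.inr ih.2), sub_eq_add_neg, EReal.exp_add, ih.1]
    · intro h
      rcases EReal.add_eq_bot_iff.1 h with h | h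
      exacts [hf a h, ih.2 h]

theorem EReal_neg_le_abs (x : EReal) : -x ≤ (x.abs : EReal) := by
  induction x with
  | bot => simp
  | top => simp
  | coe x =>
    rw [EReal.abs_def, EReal.coe_ennreal_ofReal, max_eq_left (abs_nonneg x)]
    exact_mod_cast neg_le_abs x

namespace GradientPotential

/-- The Boltzmann weight of the interior Hamiltonian. -/
def boltzmann (Φ : GradientPotential d k) (Λ : Finset (Site d)) (φ : HeightFn d k) : ℝ≥0∞ :=
  EReal.exp (-Φ.interiorHamiltonian Λ φ)

theorem boltzmann_eq_prod (Φ : GradientPotential d k) (Λ : Finset (Site d)) (φ : HeightFn d k) :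
    Φ.boltzmann Λ φ = ∏ Γ ∈ Λ.powerset, EReal.exp (-Φ Γ φ) := by
  rw [boltzmann, interiorHamiltonian_eq_sum,
    (EReal_exp_neg_sum _ (fun Γ => Φ Γ φ) fun Γ => Φ.ne_bot Γ φ).1]

theorem measurable_boltzmann (Φ : GradientPotential d k) (Λ : Finset (Site d)) :
    Measurable[gradAlgOn d k (Λ : Set (Site d))] (Φ.boltzmann Λ) := by
  have h : Φ.boltzmann Λ = fun φ => ∏ Γ ∈ Λ.powerset, EReal.exp (-Φ Γ φ) :=
    funext fun φ => boltzmann_eq_prod Φ Λ φ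
  rw [h]
  refine @Finset.measurable_fun_prod _ _ _ _ _ _ (gradAlgOn d k (Λ : Set (Site d))) _ _
    fun Γ hΓ => ?_
  have h1 : Measurable[gradAlgOn d k (Λ : Set (Site d))] (Φ Γ) := fun A hA =>
    gradAlgOn_mono (Finset.coe_subset.2 (Finset.mem_powerset.1 hΓ)) _ (Φ.measurable_toFun Γ hA)
  exact EReal.measurable_exp.comp (measurable_id.neg.comp h1)

theorem boltzmann_ne_top (Φ : GradientPotential d k) (Λ : Finset (Site d)) (φ : HeightFn d k) :
    Φ.boltzmann Λ φ ≠ ⊤ := by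
  rw [boltzmann_eq_prod]
  refine ENNReal.prod_ne_top fun Γ _ => ?_
  rw [Ne, EReal.exp_eq_top_iff, EReal.neg_eq_top_iff]
  exact Φ.ne_bot Γ φ

theorem boltzmann_singleton (Φ : GradientPotential d k) (x : Site d) (φ : HeightFn d k) :
    Φ.boltzmann {x} φ = 1 := by
  rw [boltzmann_eq_prod]
  refine Finset.prod_eq_one fun Γ hΓ => ?_
  rw [Φ.eq_zero_of_card_le_one Γ
    ((Finset.card_le_card (Finset.mem_powerset.1 hΓ)).trans (by simp))]
  simp

theorem boltzmann_shift {L : AddSubgroup (Site d)} {Φ : GradientPotential d k}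
    (hΦ : Φ.IsPeriodic L) {l : Site d} (hl : l ∈ L) (Λ : Finset (Site d)) (φ : HeightFn d k) :
    Φ.boltzmann (Λ.image (· + l)) φ = Φ.boltzmann Λ (shift l φ) := by
  have he : Function.Injective fun y : Site d => y + l := add_left_injective l
  rw [boltzmann_eq_prod, boltzmann_eq_prod, Finset.powerset_image,
    Finset.prod_image fun a _ b _ h => Finset.image_injective he h]
  exact Finset.prod_congr rfl fun Γ _ => by rw [hΦ l hl]

/-- A nonnegative strong part only lowers the weight. This is used for sets that straddle several
blocks, where only the weak part has to be paid for. -/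
theorem exp_neg_add_le (Ψ Ξ : GradientPotential d k) (hΨ : ∀ Λ φ, 0 ≤ Ψ Λ φ)
    (Γ : Finset (Site d)) (φ : HeightFn d k) :
    EReal.exp (-(Ψ + Ξ) Γ φ) ≤ EReal.exp ((Ξ Γ φ).abs : EReal) := by
  refine EReal.exp_monotone (le_trans ?_ (EReal_neg_le_abs _))
  rw [EReal.neg_le_neg_iff]
  exact le_add_of_nonneg_left (hΨ Γ φ)

theorem sum_abs_le_lowerExteriorBound (Ξ : GradientPotential d k) (Λ : Finset (Site d))
    (s : Finset (Finset (Site d))) (φ : HeightFn d k)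
    (hs : ∀ Γ ∈ s, (∃ x ∈ Γ, x ∈ Λ) ∧ ∃ y ∈ Γ, y ∉ Λ) :
    ∑ Γ ∈ s, (Ξ Γ φ).abs ≤ Ξ.lowerExteriorBound Λ := by
  refine le_trans ?_ (le_iSup (fun φ => ∑' Δ : {Δ : Finset (Site d) // (∃ x ∈ Δ, x ∈ Λ) ∧
    ∃ y ∈ Δ, y ∉ Λ}, (Ξ Δ.1 φ).abs) φ)
  refine le_trans ?_ (le_of_eq (tsum_subtype {Δ : Finset (Site d) | (∃ x ∈ Δ, x ∈ Λ) ∧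
    ∃ y ∈ Δ, y ∉ Λ} (fun Δ => (Ξ Δ φ).abs)).symm)
  refine le_trans (Finset.sum_le_sum fun Γ hΓ => ?_) (ENNReal.sum_le_tsum s)
  rw [indicator_of_mem (show Γ ∈ {Δ : Finset (Site d) | (∃ x ∈ Δ, x ∈ Λ) ∧ ∃ y ∈ Δ, y ∉ Λ} from
    hs Γ hΓ)]

/-- The Boltzmann weight of a union of disjoint blocks is controlled by the product of the
Boltzmann weights of the blocks. -/
theorem boltzmann_le_prod (Ψ Ξ : GradientPotential d k) (hΨ : ∀ Λ φ, 0 ≤ Ψ Λ φ) {ι : Type*}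
    (B : ι → Finset (Site d)) (T : Finset ι) (hB : (T : Set ι).PairwiseDisjoint B)
    (φ : HeightFn d k) :
    (Ψ + Ξ).boltzmann (T.biUnion B) φ
      ≤ EReal.exp ((∑ i ∈ T, Ξ.lowerExteriorBound (B i) : ℝ≥0∞) : EReal)
        * ∏ i ∈ T, (Ψ + Ξ).boltzmann (B i) φ := by
  classical
  set u : Finset (Site d) → ℝ≥0∞ := fun Γ => EReal.exp (-(Ψ + Ξ) Γ φ) with hu
  have hu0 : u ∅ = 1 := by
    rw [hu]
    simp only
    rw [(Ψ + Ξ).eq_zero_of_card_le_one ∅ (by simp)]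
    simp
  -- The sets contained in one block. The empty set is removed so that the families for different
  -- blocks are disjoint; its factor is `1` anyway.
  set Q : Finset (Finset (Site d)) := T.biUnion fun i => (B i).powerset.erase ∅ with hQ
  have hQsub : Q ⊆ (T.biUnion B).powerset := by
    intro Γ hΓ
    rw [hQ, Finset.mem_biUnion] at hΓ
    obtain ⟨i, hi, hΓ⟩ := hΓ
    exact Finset.mem_powerset.2 ((Finset.mem_powerset.1 (Finset.mem_of_mem_erase hΓ)).trans
      (Finset.subset_biUnion_of_mem B hi))
  have hQprod : ∏ Γ ∈ Q, u Γ = ∏ i ∈ T, (Ψ + Ξ).boltzmann (B i) φ := by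
    rw [hQ, Finset.prod_biUnion]
    · refine Finset.prod_congr rfl fun i _ => ?_
      rw [boltzmann_eq_prod, Finset.prod_erase _ hu0]
    · intro i hi j hj hij
      refine Finset.disjoint_left.2 fun Γ h1 h2 => ?_
      rw [Finset.mem_erase, Finset.mem_powerset] at h1 h2
      obtain ⟨y, hy⟩ := Finset.nonempty_iff_ne_empty.2 h1.1
      exact Finset.disjoint_left.1 (hB hi hj hij) (h1.2 hy) (h2.2 hy)
  rw [boltzmann_eq_prod, ← Finset.prod_sdiff hQsub, hQprod]
  refine mul_le_mul_left ?_ _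
  set R := (T.biUnion B).powerset \ Q with hR
  calc ∏ Γ ∈ R, u Γ ≤ ∏ Γ ∈ R, EReal.exp ((Ξ Γ φ).abs : EReal) :=
        Finset.prod_le_prod' fun Γ _ => exp_neg_add_le Ψ Ξ hΨ Γ φ
    _ = EReal.exp ((∑ Γ ∈ R, (Ξ Γ φ).abs : ℝ≥0∞) : EReal) := by
        induction R using Finset.induction_on with
        | empty => simp
        | insert a s has ih =>
          rw [Finset.prod_insert has, Finset.sum_insert has, EReal.coe_ennreal_add,
            EReal.exp_add, ih]
    _ ≤ _ := by
        refine EReal.exp_monotone (EReal.coe_ennreal_le_coe_ennreal_iff.2 ?_)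
        let c : ι → Finset (Site d) → Prop := fun i Γ =>
          (∃ x ∈ Γ, x ∈ B i) ∧ ∃ y ∈ Γ, y ∉ B i
        -- Every nonempty set left over meets some block without lying inside it, so it is counted
        -- in that block's exterior bound.
        calc ∑ Γ ∈ R, (Ξ Γ φ).abs ≤ ∑ Γ ∈ R, ∑ i ∈ T, if c i Γ then (Ξ Γ φ).abs else 0 := by
              refine Finset.sum_le_sum fun Γ hΓ => ?_
              rw [hR, Finset.mem_sdiff, Finset.mem_powerset] at hΓ
              rcases Γ.eq_empty_or_nonempty with rfl | ⟨y, hy⟩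
              · rw [Ξ.eq_zero_of_card_le_one ∅ (by simp)]
                simp
              · obtain ⟨i, hi, hyi⟩ := Finset.mem_biUnion.1 (hΓ.1 hy)
                have hc : c i Γ := by
                  refine ⟨⟨y, hy, hyi⟩, ?_⟩
                  by_contra hno
                  push Not at hno
                  refine hΓ.2 (Finset.mem_biUnion.2 ⟨i, hi, Finset.mem_erase.2 ⟨?_, ?_⟩⟩)
                  · exact Finset.nonempty_iff_ne_empty.1 ⟨y, hy⟩
                  · exact Finset.mem_powerset.2 hno
                refine le_trans ?_ (Finset.single_le_sum (fun _ _ => zero_le) hi)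
                rw [if_pos hc]
          _ = ∑ i ∈ T, ∑ Γ ∈ R.filter (c i), (Ξ Γ φ).abs := by
              rw [Finset.sum_comm]
              exact Finset.sum_congr rfl fun i _ => (Finset.sum_filter _ _).symm
          _ ≤ _ := Finset.sum_le_sum fun i _ => Ξ.sum_abs_le_lowerExteriorBound (B i) _ φ
              fun Γ hΓ => (Finset.mem_filter.1 hΓ).2

end GradientPotential

/-! ## Lipschitz height functions -/

/-- The height functions whose increments along the edges of the square lattice inside `Λ` are at
most `K`. -/
def lipSet (k : HeightKind) (K : ℝ) (Λ : Set (Site d)) : Set (HeightFn d k) :=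
  {φ | ∀ x ∈ Λ, ∀ y ∈ Λ, latticeDist x y = 1 → |k.toReal (φ y - φ x)| ≤ K}

theorem measurableSet_lipSet (K : ℝ) (Λ : Set (Site d)) :
    MeasurableSet[gradAlgOn d k Λ] (lipSet k K Λ) := by
  have : lipSet k K Λ = ⋂ x ∈ Λ, ⋂ y ∈ Λ, ⋂ (_ : latticeDist x y = 1),
      {φ | |k.toReal (φ y - φ x)| ≤ K} := by
    ext φ
    simp [lipSet]
  rw [this]
  refine @MeasurableSet.biInter _ _ (gradAlgOn d k Λ) _ _ (to_countable Λ) fun x hx => ?_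
  refine @MeasurableSet.biInter _ _ (gradAlgOn d k Λ) _ _ (to_countable Λ) fun y hy => ?_
  refine @MeasurableSet.iInter _ _ (gradAlgOn d k Λ) _ _ fun _ => ?_
  exact (k.measurable_toReal.abs.comp (measurable_sub_gradAlgOn hx hy)) measurableSet_Iic

theorem lipSet_anti (K : ℝ) {Λ Δ : Set (Site d)} (h : Λ ⊆ Δ) : lipSet k K Δ ⊆ lipSet k K Λ :=
  fun _ hφ x hx y hy => hφ x (h hx) y (h hy)

/-- The Boltzmann weight restricted to the Lipschitz functions. -/
def lipWeight (Φ : GradientPotential d k) (K : ℝ) (Λ : Finset (Site d)) (φ : HeightFn d k) :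
    ℝ≥0∞ :=
  (lipSet k K (Λ : Set (Site d))).indicator (Φ.boltzmann Λ) φ

theorem measurable_lipWeight (Φ : GradientPotential d k) (K : ℝ) (Λ : Finset (Site d)) :
    Measurable[gradAlgOn d k (Λ : Set (Site d))] (lipWeight Φ K Λ) :=
  (Φ.measurable_boltzmann Λ).indicator (measurableSet_lipSet K (Λ : Set (Site d)))

/-- Off the Lipschitz set the left side vanishes. On it every link is an edge of the square lattice
inside the union, so all link indicators equal `1` and can be inserted for free. -/
theorem lipWeight_le_prod (Ψ Ξ : GradientPotential d k) (hΨ : ∀ Λ φ, 0 ≤ Ψ Λ φ) (K : ℝ)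
    {ι : Type*} [DecidableEq ι] (B : ι → Finset (Site d)) (T : Finset ι)
    (hB : (T : Set ι).PairwiseDisjoint B) {i₀ : ι} (hi₀ : i₀ ∈ T) (x z : ι → Site d)
    (hx : ∀ i ∈ T.erase i₀, x i ∈ B i) (hz : ∀ i ∈ T.erase i₀, z i ∈ T.biUnion B)
    (hxz : ∀ i ∈ T.erase i₀, latticeDist (z i) (x i) = 1) (φ : HeightFn d k) :
    lipWeight (Ψ + Ξ) K (T.biUnion B) φ
      ≤ EReal.exp ((∑ i ∈ T, Ξ.lowerExteriorBound (B i) : ℝ≥0∞) : EReal)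
        * lipWeight (Ψ + Ξ) K (B i₀) φ
        * ∏ i ∈ T.erase i₀, (linkIndicator K (x i) (z i) φ * lipWeight (Ψ + Ξ) K (B i) φ) := by
  by_cases hφ : φ ∈ lipSet k K (T.biUnion B : Finset (Site d))
  swap
  · rw [lipWeight, indicator_of_notMem hφ]
    exact zero_le
  have hsub : ∀ i ∈ T, φ ∈ lipSet k K (B i : Set (Site d)) := fun i hi =>
    lipSet_anti K (Finset.coe_subset.2 (Finset.subset_biUnion_of_mem B hi)) hφ
  have hlink : ∀ i ∈ T.erase i₀, linkIndicator K (x i) (z i) φ = 1 := by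
    intro i hi
    refine indicator_of_mem ?_ _
    exact hφ (z i) (by exact_mod_cast hz i hi) (x i)
      (Finset.mem_coe.2 (Finset.mem_biUnion.2 ⟨i, Finset.mem_of_mem_erase hi, hx i hi⟩)) (hxz i hi)
  have hprod : ∏ i ∈ T.erase i₀, (linkIndicator K (x i) (z i) φ * lipWeight (Ψ + Ξ) K (B i) φ)
      = ∏ i ∈ T.erase i₀, (Ψ + Ξ).boltzmann (B i) φ := by
    refine Finset.prod_congr rfl fun i hi => ?_
    rw [hlink i hi, one_mul, lipWeight, indicator_of_mem (hsub i (Finset.mem_of_mem_erase hi))]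
  rw [hprod, lipWeight, indicator_of_mem hφ, lipWeight, indicator_of_mem (hsub i₀ hi₀), mul_assoc,
    Finset.mul_prod_erase T (fun i => (Ψ + Ξ).boltzmann (B i) φ) hi₀]
  exact GradientPotential.boltzmann_le_prod Ψ Ξ hΨ B T hB φ

/-! ## The variational description of the free energy -/

/-- The weighted measure may have infinite mass; cutting it down to a carrier `S` of `μ` makes it
finite without changing the entropy, which is what allows bounded test functions to characterise it.
-/
theorem relEntropy_withDensity_le_iff {X : Type*} [MeasurableSpace X] {μ ρ : Measure X}
    [IsProbabilityMeasure μ] [SigmaFinite ρ] {w : X → ℝ≥0∞} (hw : Measurable w)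
    (hwt : ∀ x, w x ≠ ⊤) {S : Set X} (hS : MeasurableSet S) (hμ : μ Sᶜ = 0)
    (hfin : ∫⁻ x, S.indicator w x ∂ρ ≠ ⊤) (a : ℝ) :
    relEntropy μ (ρ.withDensity w) ≤ (a : EReal) ↔
      ∀ f : X → ℝ, Measurable f → (∃ B, ∀ x, |f x| ≤ B) →
        ENNReal.ofReal (Real.exp (∫ x, f x ∂μ - a))
          ≤ ∫⁻ x, S.indicator w x * ENNReal.ofReal (Real.exp (f x)) ∂ρ := by
  have : SigmaFinite (ρ.withDensity w) := SigmaFinite.withDensity_of_ne_top' hwt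
  have hνS : (ρ.withDensity w) S ≠ ⊤ := by
    rwa [withDensity_apply _ hS, ← lintegral_indicator hS]
  have key : ∀ f : X → ℝ, Measurable f →
      ∫⁻ x, ENNReal.ofReal (Real.exp (f x)) ∂((ρ.withDensity w).restrict S)
        = ∫⁻ x, S.indicator w x * ENNReal.ofReal (Real.exp (f x)) ∂ρ := by
    intro f hf
    rw [restrict_withDensity hS, ← withDensity_indicator hS]
    exact lintegral_withDensity_eq_lintegral_mul _ (hw.indicator hS)
      (Real.measurable_exp.comp hf).ennreal_ofReal
  constructor
  · intro h f hf hB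
    rw [← key f hf]
    exact entropyBound_of_relEntropy_le hS hμ h f hf hB
  · intro h
    refine relEntropy_le_of_entropyBound hS hμ hνS fun f hf hB => ?_
    rw [key f hf]
    exact h f hf hB

instance sigmaFinite_gradRefMeasure (Λ : Finset (Site d)) :
    @SigmaFinite _ (gradAlgOn d k (Λ : Set (Site d))) (gradRefMeasure k Λ) := by
  by_cases h : Λ.Nonempty
  · rw [gradRefMeasure, dif_pos h]
    have hp := measurePreserving_gradRefMeasureAt (k := k) Λ h.choose_spec
    refine @SigmaFinite.of_map _ _ (gradAlgOn d k (Λ : Set (Site d))) MeasurableSpace.pi _ _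
      (@Measurable.aemeasurable _ _ (gradAlgOn d k (Λ : Set (Site d))) MeasurableSpace.pi _ _
        (@MeasurePreserving.measurable _ _ (gradAlgOn d k (Λ : Set (Site d))) MeasurableSpace.pi
          _ _ _ hp)) ?_
    rw [@MeasurePreserving.map_eq _ _ (gradAlgOn d k (Λ : Set (Site d))) MeasurableSpace.pi _ _ _
      hp]
    infer_instance
  · rw [gradRefMeasure, dif_neg h]
    infer_instance

/-- The variational bounds expressing that the free energy in `Λ` is at most `a`. -/
def FreeEnergyBound (Φ : GradientPotential d k) (K : ℝ) (Λ : Finset (Site d))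
    (μ : Measure (HeightFn d k)) (a : ℝ) : Prop :=
  ∀ f : HeightFn d k → ℝ, Measurable[gradAlgOn d k (Λ : Set (Site d))] f →
    (∃ B, ∀ φ, |f φ| ≤ B) →
    ENNReal.ofReal (Real.exp (∫ φ, f φ ∂μ - a))
      ≤ refIntegral Λ fun φ => lipWeight Φ K Λ φ * ENNReal.ofReal (Real.exp (f φ))

/-- The carrier is the set of functions that are `K`-Lipschitz inside `Λ`. -/
theorem freeEnergy_le_iff {Φ : GradientPotential d k} {K : ℝ} {Λ : Finset (Site d)}
    {μ : Measure (HeightFn d k)} [IsProbabilityMeasure μ]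
    (hμ : ∀ᵐ φ ∂μ, φ ∈ lipSet k K (univ : Set (Site d)))
    (hfin : refIntegral Λ (lipWeight Φ K Λ) ≠ ⊤) (a : ℝ) :
    freeEnergy Φ Λ μ ≤ (a : EReal) ↔ FreeEnergyBound Φ K Λ μ a := by
  have hm := gradAlgOn_le (k := k) (Λ : Set (Site d))
  have hS := measurableSet_lipSet (k := k) K (Λ : Set (Site d))
  have hμS : (μ.trim hm) (lipSet k K (Λ : Set (Site d)))ᶜ = 0 := by
    rw [trim_measurableSet_eq hm (MeasurableSet.compl hS)]
    filter_upwards [hμ] with φ hφ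
    exact lipSet_anti K (subset_univ _) hφ
  have : @IsProbabilityMeasure _ (gradAlgOn d k (Λ : Set (Site d))) (μ.trim hm) :=
    ⟨by rw [trim_measurableSet_eq hm MeasurableSet.univ]; exact measure_univ⟩
  have h := @relEntropy_withDensity_le_iff _ (gradAlgOn d k (Λ : Set (Site d))) (μ.trim hm)
    (gradRefMeasure k Λ) _ _ (Φ.boltzmann Λ) (Φ.measurable_boltzmann Λ) (Φ.boltzmann_ne_top Λ) _
    hS hμS hfin a
  refine h.trans (forall_congr' fun f => forall_congr' fun hf => ?_)
  rw [← integral_trim hm (Measurable.stronglyMeasurable hf)]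
  rfl

theorem refIntegral_mono {Λ : Finset (Site d)} {f g : HeightFn d k → ℝ≥0∞}
    (h : ∀ φ, f φ ≤ g φ) : refIntegral Λ f ≤ refIntegral Λ g :=
  @lintegral_mono _ (gradAlgOn d k (Λ : Set (Site d))) _ _ _ h

theorem refIntegral_const_mul {Λ : Finset (Site d)} (c : ℝ≥0∞) {f : HeightFn d k → ℝ≥0∞}
    (hf : Measurable[gradAlgOn d k (Λ : Set (Site d))] f) :
    refIntegral Λ (fun φ => c * f φ) = c * refIntegral Λ f :=
  @lintegral_const_mul _ (gradAlgOn d k (Λ : Set (Site d))) _ c f hf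

theorem refIntegral_singleton_le (Φ : GradientPotential d k) (K : ℝ) (x : Site d) :
    refIntegral {x} (lipWeight Φ K {x}) ≤ 1 := by
  rw [refIntegral_eq_heightIntegral (measurable_lipWeight Φ K {x}) (Finset.mem_singleton_self x) 0]
  rw [Finset.erase_singleton]
  refine (congrFun (lmarginal_empty (μ := fun _ : Site d => k.refMeasure)
    (lipWeight Φ K {x} : (Site d → k.E) → ℝ≥0∞)) 0).trans_le ?_
  refine (indicator_le_self' (f := Φ.boltzmann {x}) (fun _ _ => zero_le) _).trans ?_
  exact (Φ.boltzmann_singleton x _).le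

theorem FreeEnergyBound.mono {Φ : GradientPotential d k} {K : ℝ} {Λ : Finset (Site d)}
    {μ : Measure (HeightFn d k)} {a b : ℝ} (h : FreeEnergyBound Φ K Λ μ a) (hab : a ≤ b) :
    FreeEnergyBound Φ K Λ μ b := fun f hf hB =>
  (ENNReal.ofReal_le_ofReal (Real.exp_le_exp.2 (by linarith))).trans (h f hf hB)

/-- The variational bound in a union of blocks. -/
theorem FreeEnergyBound.le_prod_blocks {Ψ Ξ : GradientPotential d k} (hΨ : ∀ Λ φ, 0 ≤ Ψ Λ φ)
    {K : ℝ} {μ : Measure (HeightFn d k)} [IsProbabilityMeasure μ]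
    {ι : Type*} [DecidableEq ι] (rank : Site d → ℤ)
    (B : ι → Finset (Site d)) (T : Finset ι)
    (hB : (T : Set ι).PairwiseDisjoint B) {i₀ : ι} (hi₀ : i₀ ∈ T) (hne : (B i₀).Nonempty)
    (x z : ι → Site d)
    (hx : ∀ i ∈ T.erase i₀, x i ∈ B i) (hz : ∀ i ∈ T.erase i₀, z i ∈ T.biUnion B)
    (hxz : ∀ i ∈ T.erase i₀, latticeDist (z i) (x i) = 1)
    (hmin : ∀ i ∈ T.erase i₀, ∀ y ∈ B i, rank (x i) ≤ rank y)
    (hrank : ∀ i ∈ T.erase i₀, rank (z i) < rank (x i))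
    {A : ℝ} (hA : FreeEnergyBound (Ψ + Ξ) K (T.biUnion B) μ A)
    (f : ι → HeightFn d k → ℝ)
    (hf : ∀ i ∈ T, Measurable[gradAlgOn d k (B i : Set (Site d))] (f i))
    (hfB : ∀ i ∈ T, ∃ C, ∀ φ, |f i φ| ≤ C) :
    ENNReal.ofReal (Real.exp (∑ i ∈ T, ∫ φ, f i φ ∂μ - A))
      ≤ EReal.exp ((∑ i ∈ T, Ξ.lowerExteriorBound (B i) : ℝ≥0∞) : EReal)
        * refIntegral (B i₀) (fun φ => lipWeight (Ψ + Ξ) K (B i₀) φ *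
            ENNReal.ofReal (Real.exp (f i₀ φ)))
        * ∏ i ∈ T.erase i₀, (ballMass k K * refIntegral (B i)
            (fun φ => lipWeight (Ψ + Ξ) K (B i) φ * ENNReal.ofReal (Real.exp (f i φ)))) := by
  have hfΛ : ∀ i ∈ T, Measurable[gradAlgOn d k (T.biUnion B : Finset (Site d))] (f i) :=
    fun i hi _ hs => gradAlgOn_mono (Finset.coe_subset.2 (Finset.subset_biUnion_of_mem B hi)) _
      (hf i hi hs)
  choose! C hC using hfB
  have hsum : ∑ i ∈ T, ∫ φ, f i φ ∂μ = ∫ φ, ∑ i ∈ T, f i φ ∂μ := by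
    rw [integral_finsetSum]
    intro i hi
    refine integrable_of_abs_le (B := C i) ?_ (hC i hi)
    exact fun _ hs => gradAlgOn_le _ _ (hf i hi hs)
  have hme : ∀ {Λ : Finset (Site d)} {g : HeightFn d k → ℝ},
      Measurable[gradAlgOn d k (Λ : Set (Site d))] g →
      Measurable[gradAlgOn d k (Λ : Set (Site d))] fun φ =>
        lipWeight (Ψ + Ξ) K Λ φ * ENNReal.ofReal (Real.exp (g φ)) := fun {Λ g} hg =>
    (measurable_lipWeight _ K Λ).mul (ENNReal.measurable_ofReal.comp (Real.measurable_exp.comp hg))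
  have hsm : Measurable[gradAlgOn d k (T.biUnion B : Finset (Site d))]
      fun φ => ∑ i ∈ T, f i φ := Finset.measurable_fun_sum _ hfΛ
  rw [hsum]
  refine (hA _ hsm ⟨∑ i ∈ T, C i, fun φ => (Finset.abs_sum_le_sum_abs _ _).trans
    (Finset.sum_le_sum fun i hi => hC i hi φ)⟩).trans ?_
  -- The constant paid for crossing interactions is absorbed into the function on the root block.
  rw [← refIntegral_const_mul _ (hme (hf i₀ hi₀))]
  obtain ⟨x₀, hx₀⟩ := hne
  refine refIntegral_le_blocks rank K hx₀ B x z (T.erase i₀) ?_ ?_ (hB.subset (by simp)) hx hmin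
    hrank (fun i φ => lipWeight (Ψ + Ξ) K (B i) φ * ENNReal.ofReal (Real.exp (f i φ)))
    (hme hsm) ((hme (hf i₀ hi₀)).const_mul _) (fun i hi => hme (hf i (Finset.mem_of_mem_erase hi)))
    fun φ => ?_
  · rw [← Finset.biUnion_insert, Finset.insert_erase hi₀]
  · intro i hi
    exact hB hi₀ (Finset.mem_of_mem_erase hi) (Finset.ne_of_mem_erase hi).symm
  · have h1 := lipWeight_le_prod Ψ Ξ hΨ K B T hB hi₀ x z hx hz hxz φ
    have h2 : ENNReal.ofReal (Real.exp (∑ i ∈ T, f i φ))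
        = ENNReal.ofReal (Real.exp (f i₀ φ)) *
          ∏ i ∈ T.erase i₀, ENNReal.ofReal (Real.exp (f i φ)) := by
      rw [Finset.mul_prod_erase T (fun i => ENNReal.ofReal (Real.exp (f i φ))) hi₀, Real.exp_sum,
        ENNReal.ofReal_prod_of_nonneg fun i _ => (Real.exp_pos _).le]
    refine (mul_le_mul_left h1 _).trans (le_of_eq ?_)
    rw [h2]
    simp only [Finset.prod_mul_distrib]
    ring

/-! ## Boxes -/

theorem mem_box {n : ℕ} {x : Site d} : x ∈ box d n ↔ ∀ i, 0 ≤ x i ∧ x i < n := by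
  simp [box]

theorem card_box (n : ℕ) : (box d n).card = n ^ d := by
  simp [box]

theorem zero_mem_box {n : ℕ} (hn : 0 < n) : (0 : Site d) ∈ box d n := by
  simp [mem_box, hn]

theorem box_mono {m n : ℕ} (h : m ≤ n) : box d m ⊆ box d n := by
  intro x hx
  rw [mem_box] at hx ⊢
  exact fun i => ⟨(hx i).1, (hx i).2.trans_le (by exact_mod_cast h)⟩

/-- Lowering a positive coordinate by one stays in the box. The coordinate sum serves as the rank,
and these parents provide all the links between blocks. -/
theorem exists_parent {n : ℕ} {x : Site d} (hx : x ∈ box d n) (h0 : x ≠ 0) :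
    ∃ z ∈ box d n, latticeDist z x = 1 ∧ ∑ i, z i < ∑ i, x i := by
  classical
  obtain ⟨j, hj⟩ := Function.ne_iff.1 h0
  rw [mem_box] at hx
  have hj0 : 0 < x j := lt_of_le_of_ne (hx j).1 (Ne.symm hj)
  have hz : ∀ i, Function.update x j (x j - 1) i = x i - if i = j then 1 else 0 := by
    intro i
    by_cases h : i = j
    · subst h; simp
    · simp [h]
  refine ⟨Function.update x j (x j - 1), mem_box.2 fun i => ?_, ?_, ?_⟩
  · rw [hz]
    have := hx i
    by_cases h : i = j
    · subst h; simp; omega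
    · simp [h, this]
  · rw [latticeDist]
    simp only [hz]
    rw [Finset.sum_eq_single j]
    · simp
    · intro i _ hij
      simp [hij]
    · simp
  · simp only [hz, Finset.sum_sub_distrib]
    simp

/-- Coordinatewise Euclidean division by `m`: quotients index the cells, remainders the positions in
a cell. -/
theorem box_mul_eq_biUnion (r : ℕ) {m : ℕ} (hm : 0 < m) :
    box d (r * m) = (box d r).biUnion fun a => (box d m).image (· + (m : ℤ) • a) := by
  have hm' : (0 : ℤ) < m := by exact_mod_cast hm
  ext y
  simp only [Finset.mem_biUnion, Finset.mem_image, mem_box]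
  constructor
  · intro hy
    refine ⟨fun i => y i / m, fun i => ⟨Int.ediv_nonneg (hy i).1 hm'.le, ?_⟩,
      fun i => y i % m, fun i => ⟨Int.emod_nonneg _ hm'.ne', Int.emod_lt_of_pos _ hm'⟩, ?_⟩
    · refine Int.ediv_lt_of_lt_mul hm' ?_
      have := (hy i).2
      push_cast at this
      exact this
    · funext i
      simp only [Pi.add_apply, Pi.smul_apply, smul_eq_mul]
      exact Int.emod_add_mul_ediv _ _
  · rintro ⟨a, ha, u, hu, rfl⟩ i
    simp only [Pi.add_apply, Pi.smul_apply, smul_eq_mul]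
    obtain ⟨h1, h2⟩ := ha i
    obtain ⟨h3, h4⟩ := hu i
    refine ⟨by positivity, ?_⟩
    push_cast
    have : (m : ℤ) * (a i + 1) ≤ m * r := mul_le_mul_of_nonneg_left (by omega) hm'.le
    nlinarith

theorem pairwiseDisjoint_box_image {m : ℕ} (hm : 0 < m) (s : Set (Site d)) :
    s.PairwiseDisjoint fun a => (box d m).image (· + (m : ℤ) • a) := by
  have hm' : (0 : ℤ) < m := by exact_mod_cast hm
  intro a _ b _ hab
  refine Finset.disjoint_left.2 fun y ha hb => hab ?_
  simp only [Finset.mem_image, mem_box] at ha hb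
  obtain ⟨u, hu, rfl⟩ := ha
  obtain ⟨v, hv, hvu⟩ := hb
  funext i
  have h := congrFun hvu i
  simp only [Pi.add_apply, Pi.smul_apply, smul_eq_mul] at h
  have h1 : (u i + m * a i) / m = a i := by
    rw [Int.add_mul_ediv_left _ _ hm'.ne', Int.ediv_eq_zero_of_lt (hu i).1 (hu i).2, zero_add]
  have h2 : (v i + m * b i) / m = b i := by
    rw [Int.add_mul_ediv_left _ _ hm'.ne', Int.ediv_eq_zero_of_lt (hv i).1 (hv i).2, zero_add]
  rw [← h1, ← h2, h]

/-! ## Costs -/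

/-- The cost of linking a block. -/
def linkCost (k : HeightKind) (K : ℝ) : ℝ := Real.log (max 1 (ballMass k K).toReal)

theorem linkCost_nonneg (K : ℝ) : 0 ≤ linkCost k K := Real.log_nonneg (le_max_left _ _)

theorem ballMass_le_exp_linkCost (K : ℝ) :
    ballMass k K ≤ ENNReal.ofReal (Real.exp (linkCost k K)) := by
  rw [linkCost, Real.exp_log (lt_max_of_lt_left one_pos)]
  exact (ENNReal.ofReal_toReal (ballMass_ne_top K)).symm.le.trans
    (ENNReal.ofReal_le_ofReal (le_max_right _ _))

theorem EReal_exp_coe_ennreal {a : ℝ≥0∞} (ha : a ≠ ⊤) :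
    EReal.exp (a : EReal) = ENNReal.ofReal (Real.exp a.toReal) := by
  rw [← EReal.exp_coe, EReal.coe_ennreal_toReal ha]

theorem lowerExteriorBound_singleton_le (Ξ : GradientPotential d k) (x : Site d) :
    Ξ.lowerExteriorBound {x} ≤ Ξ.totalNorm := by
  refine iSup_le fun φ => ?_
  refine le_trans ?_ (le_iSup₂ (f := fun (x : Site d) (φ : HeightFn d k) =>
    ∑' Λ : {Λ : Finset (Site d) // x ∈ Λ}, (Ξ Λ.1 φ).abs) x φ)
  let g : {Δ : Finset (Site d) // (∃ y ∈ Δ, y ∈ ({x} : Finset (Site d))) ∧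
      ∃ y ∈ Δ, y ∉ ({x} : Finset (Site d))} → {Λ : Finset (Site d) // x ∈ Λ} := fun Δ =>
    ⟨Δ.1, by
      obtain ⟨y, hy, hyx⟩ := Δ.2.1
      rw [Finset.mem_singleton] at hyx
      exact hyx ▸ hy⟩
  have hg : Function.Injective g := fun a b h => Subtype.ext (congrArg (fun c => c.1) h)
  exact ENNReal.tsum_comp_le_tsum_of_injective hg fun Λ => (Ξ Λ.1 φ).abs

/-- The cost of adding a single vertex. -/
def siteCost (Ξ : GradientPotential d k) (K : ℝ) : ℝ := Ξ.totalNorm.toReal + linkCost k K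

/-- The cost of separating a box from its surroundings. -/
def boxCost (Ξ : GradientPotential d k) (K : ℝ) (n : ℕ) : ℝ :=
  (Ξ.lowerExteriorBound (box d n)).toReal + linkCost k K

/-- The box is cut into single vertices, each linked to its parent. A vertex costs at most the norm
of `Ξ` in energy and a ball of radius `K` in volume. -/
theorem refIntegral_lipWeight_box_le {Ψ Ξ : GradientPotential d k} (hΨ : ∀ Λ φ, 0 ≤ Ψ Λ φ)
    (hΞ : Ξ.totalNorm ≠ ⊤) (K : ℝ) {n : ℕ} (hn : 0 < n) :
    refIntegral (box d n) (lipWeight (Ψ + Ξ) K (box d n))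
      ≤ ENNReal.ofReal (Real.exp (siteCost Ξ K * (n : ℝ) ^ d)) := by
  classical
  have hpar : ∀ x ∈ (box d n).erase 0, ∃ z ∈ box d n, latticeDist z x = 1 ∧
      ∑ i, z i < ∑ i, x i := fun x hx =>
    exists_parent (Finset.mem_of_mem_erase hx) (Finset.ne_of_mem_erase hx)
  choose! z hz using hpar
  have hU : (box d n).biUnion (fun x : Site d => {x}) = box d n := by simp
  have hB : (box d n : Set (Site d)).PairwiseDisjoint fun x : Site d => ({x} : Finset (Site d)) :=
    fun a _ b _ hab => Finset.disjoint_singleton.2 hab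
  have h0 := zero_mem_box (d := d) hn
  have hle := lipWeight_le_prod Ψ Ξ hΨ K (fun x : Site d => ({x} : Finset (Site d))) (box d n) hB h0
    id z (fun i _ => Finset.mem_singleton_self i) (fun i hi => hU.symm ▸ (hz i hi).1)
    (fun i hi => (hz i hi).2.1)
  rw [hU] at hle
  have h1 := refIntegral_le_blocks (k := k) (fun x => ∑ i, x i) K (Λ := box d n) (Λ₀ := {0})
    (x₀ := 0) (Finset.mem_singleton_self 0)
    (fun x : Site d => ({x} : Finset (Site d))) id z ((box d n).erase 0)
    (by rw [← Finset.biUnion_insert, Finset.insert_erase h0, hU])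
    (fun i hi => hB h0 (Finset.mem_of_mem_erase hi) (Finset.ne_of_mem_erase hi).symm)
    (hB.subset (by simp)) (fun i _ => Finset.mem_singleton_self i)
    (fun i _ y hy => by rw [Finset.mem_singleton] at hy; simp [hy])
    (fun i hi => (hz i hi).2.2) (fun x => lipWeight (Ψ + Ξ) K {x})
    (measurable_lipWeight _ K (box d n)) ((measurable_lipWeight _ K {0}).const_mul _)
    (fun i _ => measurable_lipWeight _ K {i}) hle
  rw [refIntegral_const_mul _ (measurable_lipWeight _ K {0})] at h1
  refine h1.trans ?_
  have hT : ∑ i ∈ box d n, Ξ.lowerExteriorBound {i} ≤ (n ^ d : ℕ) * Ξ.totalNorm := by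
    refine (Finset.sum_le_card_nsmul _ _ _ fun i _ => lowerExteriorBound_singleton_le Ξ i).trans ?_
    rw [card_box, nsmul_eq_mul]
  calc _ ≤ EReal.exp (((n ^ d : ℕ) * Ξ.totalNorm : ℝ≥0∞) : EReal) * 1
        * ∏ i ∈ (box d n).erase 0, (ENNReal.ofReal (Real.exp (linkCost k K)) * 1) := by
        gcongr
        · exact EReal.coe_ennreal_le_coe_ennreal_iff.2 hT
        · exact refIntegral_singleton_le _ K 0
        · exact ballMass_le_exp_linkCost K
        · exact refIntegral_singleton_le _ K _
    _ = ENNReal.ofReal (Real.exp ((n : ℝ) ^ d * Ξ.totalNorm.toReal))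
        * ENNReal.ofReal (Real.exp (linkCost k K)) ^ ((box d n).erase 0).card := by
        rw [EReal_exp_coe_ennreal (ENNReal.mul_ne_top (ENNReal.natCast_ne_top _) hΞ)]
        simp
    -- The root has no link; since `linkCost` is nonnegative, its missing factor may be put back to
    -- reach the full volume.
    _ ≤ ENNReal.ofReal (Real.exp ((n : ℝ) ^ d * Ξ.totalNorm.toReal))
        * ENNReal.ofReal (Real.exp (linkCost k K)) ^ (n ^ d) := by
        gcongr
        · rw [ENNReal.one_le_ofReal]
          exact Real.one_le_exp (linkCost_nonneg K)
        · rw [← card_box]; exact Finset.card_le_card (Finset.erase_subset _ _)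
    _ = _ := by
        rw [← ENNReal.ofReal_pow (Real.exp_pos _).le, ← Real.exp_nat_mul,
          ← ENNReal.ofReal_mul (Real.exp_pos _).le, ← Real.exp_add, siteCost]
        congr 2
        push_cast
        ring

theorem FreeEnergyBound.neg_siteCost_le {Ψ Ξ : GradientPotential d k} (hΨ : ∀ Λ φ, 0 ≤ Ψ Λ φ)
    (hΞ : Ξ.totalNorm ≠ ⊤) {K : ℝ} {n : ℕ} (hn : 0 < n) {μ : Measure (HeightFn d k)} {A : ℝ}
    (hA : FreeEnergyBound (Ψ + Ξ) K (box d n) μ A) : -siteCost Ξ K * (n : ℝ) ^ d ≤ A := by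
  have h := hA (fun _ => 0) measurable_const ⟨0, by simp⟩
  simp only [integral_zero, zero_sub, Real.exp_zero, ENNReal.ofReal_one, mul_one] at h
  have h1 := (ENNReal.ofReal_le_ofReal_iff (Real.exp_pos _).le).1
    (h.trans (refIntegral_lipWeight_box_le hΨ hΞ K hn))
  rw [Real.exp_le_exp] at h1
  linarith

/-! ### Superadditivity and almost monotonicity of the free energy in boxes. -/

theorem integral_shift {L : AddSubgroup (Site d)} {μ : ProbabilityMeasure (HeightFn d k)}
    (hμ : μ ∈ invariantMeasures k L) {l : Site d} (hl : l ∈ L) {f : HeightFn d k → ℝ}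
    (hf : Measurable f) :
    ∫ φ, f (shift l φ) ∂(μ : Measure (HeightFn d k)) = ∫ φ, f φ ∂(μ : Measure (HeightFn d k)) := by
  have h := hμ l hl
  conv_rhs => rw [← h.map_eq]
  rw [integral_map h.measurable.aemeasurable hf.aestronglyMeasurable]

theorem lipWeight_shift {L : AddSubgroup (Site d)} {Φ : GradientPotential d k}
    (hΦ : Φ.IsPeriodic L) (K : ℝ) {l : Site d} (hl : l ∈ L) (Λ : Finset (Site d))
    (φ : HeightFn d k) :
    lipWeight Φ K (Λ.image (· + l)) φ = lipWeight Φ K Λ (shift l φ) := by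
  have h : φ ∈ lipSet k K (Λ.image (· + l) : Finset (Site d)) ↔
      shift l φ ∈ lipSet k K (Λ : Set (Site d)) := by
    constructor
    · intro h x hx y hy hxy
      exact h (x + l) (by simpa using hx) (y + l) (by simpa using hy) (by
        simpa [latticeDist] using hxy)
    · rintro h x hx y hy hxy
      obtain ⟨u, hu, rfl⟩ := Finset.mem_image.1 (Finset.mem_coe.1 hx)
      obtain ⟨v, hv, rfl⟩ := Finset.mem_image.1 (Finset.mem_coe.1 hy)
      exact h u hu v hv (by simpa [latticeDist] using hxy)
  by_cases hφ : φ ∈ lipSet k K (Λ.image (· + l) : Finset (Site d))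
  · rw [lipWeight, lipWeight, indicator_of_mem hφ, indicator_of_mem (h.1 hφ),
      GradientPotential.boltzmann_shift hΦ hl]
  · rw [lipWeight, lipWeight, indicator_of_notMem hφ, indicator_of_notMem (mt h.2 hφ)]

theorem isPeriodic_add {L : AddSubgroup (Site d)} {Ψ Ξ : GradientPotential d k}
    (hΨ : Ψ.IsPeriodic L) (hΞ : Ξ.IsPeriodic L) : (Ψ + Ξ).IsPeriodic L := by
  intro l hl Λ φ
  change Ψ _ φ + Ξ _ φ = Ψ _ _ + Ξ _ _
  rw [hΨ l hl, hΞ l hl]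

/-- Superadditivity of the free energy along multiples of a period. -/
theorem FreeEnergyBound.div_pow {L : AddSubgroup (Site d)} {Ψ Ξ : GradientPotential d k}
    (hΨ : ∀ Λ φ, 0 ≤ Ψ Λ φ) (hΨL : Ψ.IsPeriodic L) (hΞL : Ξ.IsPeriodic L)
    (hΞ : IsAmenable L Ξ.lowerExteriorBound) {K : ℝ}
    {μ : ProbabilityMeasure (HeightFn d k)} (hμ : μ ∈ invariantMeasures k L)
    {m r : ℕ} (hm : 0 < m) (hr : 0 < r) (hmL : ∀ a : Site d, (m : ℤ) • a ∈ L) {A : ℝ}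
    (hA : FreeEnergyBound (Ψ + Ξ) K (box d (r * m)) μ A) :
    FreeEnergyBound (Ψ + Ξ) K (box d m) μ (A / (r : ℝ) ^ d + boxCost Ξ K m) := by
  classical
  rintro f hf ⟨C, hC⟩
  have hxbox : ∀ a ∈ (box d r).erase 0, (m : ℤ) • a ∈ box d (r * m) := fun a ha => by
    rw [box_mul_eq_biUnion r hm]
    exact Finset.mem_biUnion.2 ⟨a, Finset.mem_of_mem_erase ha,
      Finset.mem_image.2 ⟨0, zero_mem_box hm, zero_add _⟩⟩
  have hx0 : ∀ a ∈ (box d r).erase 0, (m : ℤ) • a ≠ 0 := fun a ha =>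
    smul_ne_zero (by exact_mod_cast hm.ne') (Finset.ne_of_mem_erase ha)
  have hpar : ∀ a ∈ (box d r).erase 0, ∃ z ∈ box d (r * m), latticeDist z ((m : ℤ) • a) = 1 ∧
      ∑ i, z i < ∑ i, ((m : ℤ) • a) i := fun a ha => exists_parent (hxbox a ha) (hx0 a ha)
  choose! z hz using hpar
  have hfm : Measurable f := fun _ hs => gradAlgOn_le _ _ (hf hs)
  set B : Site d → Finset (Site d) := fun a => (box d m).image (· + (m : ℤ) • a) with hB
  have hne : (box d m).Nonempty := ⟨0, zero_mem_box hm⟩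
  have hfs : ∀ a, Measurable[gradAlgOn d k (B a : Set (Site d))]
      fun φ => f (shift ((m : ℤ) • a) φ) := fun a _ hs => measurable_shift_gradAlgOn _ _ (hf hs)
  have hbox := box_mul_eq_biUnion (d := d) r hm
  rw [hbox] at hA hz
  -- The test function is the sum of the translates of `f` to the `r ^ d` cells. The lower corner of
  -- a cell has the smallest rank in it and is linked to its parent, which lies in another cell.
  have key := FreeEnergyBound.le_prod_blocks hΨ (fun x => ∑ i, x i) B (box d r)
    (pairwiseDisjoint_box_image hm _) (zero_mem_box hr) (hne.image _) (fun a => (m : ℤ) • a) z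
    (fun a _ => Finset.mem_image.2 ⟨0, zero_mem_box hm, zero_add _⟩)
    (fun a ha => (hz a ha).1) (fun a ha => (hz a ha).2.1) ?_ (fun a ha => (hz a ha).2.2) hA
    (fun a φ => f (shift ((m : ℤ) • a) φ)) (fun a _ => hfs a) (fun a _ => ⟨C, fun φ => hC _⟩)
  swap
  · intro a _ y hy
    obtain ⟨u, hu, rfl⟩ := Finset.mem_image.1 hy
    refine Finset.sum_le_sum fun i _ => ?_
    have := (mem_box.1 hu i).1
    simp only [Pi.add_apply]
    omega
  set I := refIntegral (box d m) fun φ => lipWeight (Ψ + Ξ) K (box d m) φ *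
    ENNReal.ofReal (Real.exp (f φ)) with hI
  have hwm : Measurable[gradAlgOn d k (box d m : Set (Site d))] fun φ =>
      lipWeight (Ψ + Ξ) K (box d m) φ * ENNReal.ofReal (Real.exp (f φ)) :=
    (measurable_lipWeight _ K _).mul (ENNReal.measurable_ofReal.comp (Real.measurable_exp.comp hf))
  have hIa : ∀ a : Site d, refIntegral (B a) (fun φ => lipWeight (Ψ + Ξ) K (B a) φ *
      ENNReal.ofReal (Real.exp (f (shift ((m : ℤ) • a) φ)))) = I := by
    intro a
    rw [hI, ← refIntegral_shift hne hwm ((m : ℤ) • a)]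
    congr 1
    funext φ
    rw [hB]
    simp only
    rw [lipWeight_shift (isPeriodic_add hΨL hΞL) K (hmL a)]
  have hint : ∀ a : Site d, ∫ φ, f (shift ((m : ℤ) • a) φ) ∂(μ : Measure (HeightFn d k))
      = ∫ φ, f φ ∂(μ : Measure (HeightFn d k)) := fun a => integral_shift hμ (hmL a) hfm
  have hext : ∀ a : Site d, Ξ.lowerExteriorBound (B a) = Ξ.lowerExteriorBound (box d m) :=
    fun a => hΞ.invariant _ (hmL a) _
  simp only [hIa, hint, hext, Finset.sum_const, card_box, Finset.prod_const,
    Finset.card_erase_of_mem (zero_mem_box (d := d) hr), nsmul_eq_mul] at key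
  set R : ℕ := r ^ d with hR
  have hRpos : 0 < R := pow_pos hr d
  set c := ENNReal.ofReal (Real.exp (boxCost Ξ K m)) with hc
  set e := Ξ.lowerExteriorBound (box d m) with he
  have hetop : e ≠ ⊤ := hΞ.finite _
  have hlink : (1 : ℝ≥0∞) ≤ ENNReal.ofReal (Real.exp (linkCost k K)) := by
    rw [ENNReal.one_le_ofReal]
    exact Real.one_le_exp (linkCost_nonneg K)
  have hceq : c = ENNReal.ofReal (Real.exp e.toReal) * ENNReal.ofReal (Real.exp (linkCost k K)) := by
    rw [hc, boxCost, Real.exp_add, ENNReal.ofReal_mul (Real.exp_pos _).le]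
  -- Invariance makes all cells contribute the same integral and the same mean, so both sides are
  -- `R`-th powers and the bound in one cell follows by taking roots.
  have hpow : ENNReal.ofReal (Real.exp (∫ φ, f φ ∂(μ : Measure (HeightFn d k)) - A / R)) ^ R
      ≤ (c * I) ^ R := by
    calc _ = ENNReal.ofReal (Real.exp (R * ∫ φ, f φ ∂(μ : Measure (HeightFn d k)) - A)) := by
          rw [← ENNReal.ofReal_pow (Real.exp_pos _).le, ← Real.exp_nat_mul]
          congr 2
          have : (R : ℝ) ≠ 0 := by positivity
          field_simp
      _ ≤ EReal.exp ((R * e : ℝ≥0∞) : EReal) * I * (ballMass k K * I) ^ (R - 1) := key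
      _ = ENNReal.ofReal (Real.exp e.toReal) ^ R * I * (ballMass k K * I) ^ (R - 1) := by
          rw [EReal_exp_coe_ennreal (ENNReal.mul_ne_top (ENNReal.natCast_ne_top _) hetop),
            ← ENNReal.ofReal_pow (Real.exp_pos _).le, ← Real.exp_nat_mul]
          simp
      _ ≤ ENNReal.ofReal (Real.exp e.toReal) ^ R * (ENNReal.ofReal (Real.exp (linkCost k K)) * I)
          * (ENNReal.ofReal (Real.exp (linkCost k K)) * I) ^ (R - 1) := by
          gcongr
          · exact le_mul_of_one_le_left zero_le hlink
          · exact ballMass_le_exp_linkCost K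
      _ = _ := by
          rw [mul_assoc, mul_pow_sub_one hRpos.ne', hceq, ← mul_pow, mul_assoc]
  have hroot := (ENNReal.pow_le_pow_left_iff hRpos.ne').1 hpow
  have e1 : ∫ φ, f φ ∂(μ : Measure (HeightFn d k)) - A / (r : ℝ) ^ d
      = (∫ φ, f φ ∂(μ : Measure (HeightFn d k)) - (A / (r : ℝ) ^ d + boxCost Ξ K m))
        + boxCost Ξ K m := by ring
  rw [hR, Nat.cast_pow, e1, Real.exp_add, ENNReal.ofReal_mul (Real.exp_pos _).le, mul_comm c] at hroot
  refine (ENNReal.mul_le_mul_iff_left ?_ ?_).1 hroot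
  · rw [Ne, ENNReal.ofReal_eq_zero, not_le]; exact Real.exp_pos _
  · exact ENNReal.ofReal_ne_top

/-- Almost monotonicity of the free energy. -/
theorem FreeEnergyBound.of_le {Ψ Ξ : GradientPotential d k} (hΨ : ∀ Λ φ, 0 ≤ Ψ Λ φ)
    (hΞ : Ξ.totalNorm ≠ ⊤) {K : ℝ} {n n' : ℕ} (hn : 0 < n) (hnn : n ≤ n')
    (hfin : Ξ.lowerExteriorBound (box d n) ≠ ⊤)
    {μ : Measure (HeightFn d k)} [IsProbabilityMeasure μ] {A : ℝ}
    (hA : FreeEnergyBound (Ψ + Ξ) K (box d n') μ A) :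
    FreeEnergyBound (Ψ + Ξ) K (box d n) μ
      (A + boxCost Ξ K n + siteCost Ξ K * ((n' : ℝ) ^ d - (n : ℝ) ^ d)) := by
  classical
  rintro f hf ⟨C, hC⟩
  set S := box d n' \ box d n with hS
  have h0S : (0 : Site d) ∉ S := fun h => (Finset.mem_sdiff.1 h).2 (zero_mem_box hn)
  -- The smaller box is the root block, indexed by the origin and carrying `f`. The other vertices
  -- of the larger box are single blocks with test function zero.
  set B : Site d → Finset (Site d) := fun x => if x = 0 then box d n else {x} with hB
  set g : Site d → HeightFn d k → ℝ := fun x => if x = 0 then f else fun _ => 0 with hg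
  have hB0 : B 0 = box d n := if_pos rfl
  have hg0 : g 0 = f := if_pos rfl
  have hS0 : ∀ x ∈ S, x ≠ 0 := fun x hx h => h0S (h ▸ hx)
  have hBS : ∀ x ∈ S, B x = {x} := fun x hx => if_neg (hS0 x hx)
  have hgS : ∀ x ∈ S, g x = fun _ => 0 := fun x hx => if_neg (hS0 x hx)
  have hU : (insert 0 S).biUnion B = box d n' := by
    rw [Finset.biUnion_insert, hB0]
    have : S.biUnion B = S := by
      rw [Finset.biUnion_congr rfl hBS]
      simp
    rw [this, hS, Finset.union_sdiff_of_subset (box_mono hnn)]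
  have hpar : ∀ x ∈ S, ∃ z ∈ box d n', latticeDist z x = 1 ∧
      ∑ i, z i < ∑ i, x i := fun x hx =>
    exists_parent (Finset.mem_sdiff.1 hx).1 (hS0 x hx)
  choose! z hz using hpar
  have hT : (insert 0 S).erase 0 = S := Finset.erase_insert h0S
  have key := FreeEnergyBound.le_prod_blocks hΨ (μ := μ) (A := A) (K := K) (fun x => ∑ i, x i)
    B (insert 0 S) ?_ (Finset.mem_insert_self 0 S) (hB0 ▸ ⟨0, zero_mem_box hn⟩) id z ?_ ?_ ?_ ?_ ?_
    (hU.symm ▸ hA) g ?_ ?_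
  · rw [hT, Finset.sum_insert h0S, Finset.sum_insert h0S, hg0, hB0] at key
    have e1 : ∑ x ∈ S, ∫ φ, g x φ ∂μ = 0 := Finset.sum_eq_zero fun x hx => by rw [hgS x hx]; simp
    rw [e1, add_zero] at key
    set I := refIntegral (box d n) fun φ => lipWeight (Ψ + Ξ) K (box d n) φ *
      ENNReal.ofReal (Real.exp (f φ)) with hI
    set e := Ξ.lowerExteriorBound (box d n) with he
    have e2 : ∏ x ∈ S, (ballMass k K * refIntegral (B x) (fun φ => lipWeight (Ψ + Ξ) K (B x) φ *
        ENNReal.ofReal (Real.exp (g x φ))))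
        ≤ ∏ x ∈ S, ENNReal.ofReal (Real.exp (linkCost k K)) := by
      refine Finset.prod_le_prod' fun x hx => ?_
      rw [hBS x hx, hgS x hx]
      simp only [Real.exp_zero, ENNReal.ofReal_one, mul_one]
      exact (mul_le_mul' (ballMass_le_exp_linkCost K) (refIntegral_singleton_le _ K x)).trans
        (mul_one _).le
    have e3 : ∑ x ∈ S, Ξ.lowerExteriorBound (B x) ≤ S.card * Ξ.totalNorm := by
      refine (Finset.sum_le_card_nsmul _ _ _ fun x hx => ?_).trans (nsmul_eq_mul _ _).le
      rw [hBS x hx]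
      exact lowerExteriorBound_singleton_le Ξ x
    have hcard : (S.card : ℝ) = (n' : ℝ) ^ d - (n : ℝ) ^ d := by
      rw [hS, Finset.card_sdiff_of_subset (box_mono hnn), card_box, card_box,
        Nat.cast_sub (Nat.pow_le_pow_left hnn d)]
      push_cast
      ring
    set D := boxCost Ξ K n + siteCost Ξ K * ((n' : ℝ) ^ d - (n : ℝ) ^ d) with hD
    have e4 : ENNReal.ofReal (Real.exp (∫ φ, f φ ∂μ - A)) ≤ ENNReal.ofReal (Real.exp D) * I := by
      calc _ ≤ _ := key
        _ ≤ EReal.exp ((e + S.card * Ξ.totalNorm : ℝ≥0∞) : EReal) * I *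
            ∏ x ∈ S, ENNReal.ofReal (Real.exp (linkCost k K)) := by
          gcongr
          · exact EReal.coe_ennreal_le_coe_ennreal_iff.2 (add_le_add_right e3 _)
        -- One extra link factor, at least `1`, is inserted because `boxCost` includes a link
        -- although the root block has none.
        _ ≤ EReal.exp ((e + S.card * Ξ.totalNorm : ℝ≥0∞) : EReal) * I *
            (ENNReal.ofReal (Real.exp (linkCost k K)) ^ S.card *
              ENNReal.ofReal (Real.exp (linkCost k K))) := by
          rw [Finset.prod_const]
          gcongr
          refine le_mul_of_one_le_right zero_le ?_
          rw [ENNReal.one_le_ofReal]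
          exact Real.one_le_exp (linkCost_nonneg K)
        _ = _ := by
          have hne := ENNReal.mul_ne_top (ENNReal.natCast_ne_top S.card) hΞ
          rw [EReal_exp_coe_ennreal (ENNReal.add_ne_top.2 ⟨hfin, hne⟩),
            ENNReal.toReal_add hfin hne, mul_right_comm, ← ENNReal.ofReal_pow (Real.exp_pos _).le,
            ← Real.exp_nat_mul, ← ENNReal.ofReal_mul (Real.exp_pos _).le, ← Real.exp_add,
            ← ENNReal.ofReal_mul (Real.exp_pos _).le, ← Real.exp_add, hD, ← hcard, boxCost,
            siteCost, ← he]
          congr 3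
          simp
          ring
    have e5 : ∫ φ, f φ ∂μ - A = (∫ φ, f φ ∂μ - (A + boxCost Ξ K n +
        siteCost Ξ K * ((n' : ℝ) ^ d - (n : ℝ) ^ d))) + D := by rw [hD]; ring
    rw [e5, Real.exp_add, ENNReal.ofReal_mul (Real.exp_pos _).le, mul_comm _ I] at e4
    refine (ENNReal.mul_le_mul_iff_left ?_ ?_).1 e4
    · rw [Ne, ENNReal.ofReal_eq_zero, not_le]; exact Real.exp_pos _
    · exact ENNReal.ofReal_ne_top
  · intro x hx y hy hxy
    simp only [Finset.coe_insert, mem_insert_iff, Finset.mem_coe] at hx hy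
    rcases hx with rfl | hx <;> rcases hy with rfl | hy
    · exact absurd rfl hxy
    · simp only [Function.onFun]
      rw [hB0, hBS y hy, Finset.disjoint_singleton_right]
      exact (Finset.mem_sdiff.1 hy).2
    · simp only [Function.onFun]
      rw [hB0, hBS x hx, Finset.disjoint_singleton_left]
      exact (Finset.mem_sdiff.1 hx).2
    · simp only [Function.onFun]
      rw [hBS x hx, hBS y hy]
      exact Finset.disjoint_singleton.2 hxy
  · intro x hx
    rw [hT] at hx
    rw [hBS x hx]
    exact Finset.mem_singleton_self x
  · intro x hx
    rw [hT] at hx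
    rw [hU]
    exact (hz x hx).1
  · intro x hx
    rw [hT] at hx
    exact (hz x hx).2.1
  · intro x hx y hy
    rw [hT] at hx
    rw [hBS x hx, Finset.mem_singleton] at hy
    simp [hy]
  · intro x hx
    rw [hT] at hx
    exact (hz x hx).2.2
  · intro x hx
    rcases Finset.mem_insert.1 hx with rfl | hx
    · rw [hB0, hg0]; exact hf
    · rw [hgS x hx]; exact measurable_const
  · intro x hx
    rcases Finset.mem_insert.1 hx with rfl | hx
    · rw [hg0]; exact ⟨C, hC⟩
    · rw [hgS x hx]; exact ⟨0, by simp⟩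

/-! ## Asymptotics of the costs -/

theorem outerBoundary_box_subset (n : ℕ) :
    outerBoundary (box d n) ⊆ ((Fintype.piFinset fun _ : Fin d => Finset.Ico (-1 : ℤ) (n + 1)) \
      box d n : Finset (Site d)) := by
  rintro y ⟨hy, x, hx, hxy⟩
  rw [Finset.coe_sdiff]
  refine ⟨?_, hy⟩
  rw [Finset.mem_coe, Fintype.mem_piFinset]
  intro i
  rw [mem_box] at hx
  have h1 : (x i - y i).natAbs ≤ 1 := by
    rw [← hxy]
    exact Finset.single_le_sum (f := fun i => (x i - y i).natAbs) (fun _ _ => Nat.zero_le _)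
      (Finset.mem_univ i)
  have := hx i
  rw [Finset.mem_Ico]
  omega

theorem ncard_outerBoundary_box_le (n : ℕ) :
    ((outerBoundary (box d n)).ncard : ℝ) ≤ ((n : ℝ) + 2) ^ d - (n : ℝ) ^ d := by
  have hsub : box d n ⊆ Fintype.piFinset fun _ : Fin d => Finset.Ico (-1 : ℤ) (n + 1) := by
    intro x hx
    rw [mem_box] at hx
    rw [Fintype.mem_piFinset]
    intro i
    have := hx i
    rw [Finset.mem_Ico]
    omega
  have h := Set.ncard_le_ncard (outerBoundary_box_subset (d := d) n) (Finset.finite_toSet _)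
  rw [Set.ncard_coe_finset, Finset.card_sdiff_of_subset hsub, card_box] at h
  have hc : (Fintype.piFinset fun _ : Fin d => Finset.Ico (-1 : ℤ) (n + 1)).card
      = (n + 2) ^ d := by
    simp only [Fintype.card_piFinset, Int.card_Ico, Finset.prod_const, Finset.card_univ,
      Fintype.card_fin]
    congr 1
  rw [hc] at h
  have h2 : ((outerBoundary (box d n)).ncard : ℝ) ≤ (((n + 2) ^ d - n ^ d : ℕ) : ℝ) :=
    Nat.cast_le.2 h
  rw [Nat.cast_sub (Nat.pow_le_pow_left (by omega) d)] at h2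
  push_cast at h2
  exact h2

theorem tendsto_add_const_div_self (c : ℝ) :
    Tendsto (fun n : ℕ => ((n : ℝ) + c) / n) atTop (𝓝 1) := by
  have h : Tendsto (fun n : ℕ => 1 + c / (n : ℝ)) atTop (𝓝 (1 + 0)) :=
    tendsto_const_nhds.add (tendsto_const_div_atTop_nhds_zero_nat c)
  rw [add_zero] at h
  refine h.congr' ?_
  filter_upwards [eventually_gt_atTop 0] with n hn
  have : (n : ℝ) ≠ 0 := by positivity
  field_simp

theorem isVanHove_box (hd : 0 < d) : IsVanHove fun n => box d n := by
  constructor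
  · simp only [card_box]
    exact tendsto_pow_atTop hd.ne'
  · have h : Tendsto (fun n : ℕ => (((n : ℝ) + 2) / n) ^ d - 1) atTop (𝓝 0) := by
      have := ((tendsto_add_const_div_self 2).pow d).sub_const 1
      simpa using this
    refine squeeze_zero' (Eventually.of_forall fun n => by positivity) ?_ h
    filter_upwards [eventually_gt_atTop 0] with n hn
    rw [card_box, Nat.cast_pow, div_pow, div_sub_one (by positivity)]
    exact div_le_div_of_nonneg_right (ncard_outerBoundary_box_le n) (by positivity)

theorem tendsto_boxCost_div {L : AddSubgroup (Site d)} {Ξ : GradientPotential d k}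
    (hd : 0 < d) (hΞ : IsAmenable L Ξ.lowerExteriorBound) (K : ℝ) :
    Tendsto (fun n : ℕ => boxCost Ξ K n / (n : ℝ) ^ d) atTop (𝓝 0) := by
  have h1 := (ENNReal.tendsto_toReal ENNReal.zero_ne_top).comp (hΞ.vanHove _ (isVanHove_box hd))
  have h2 : Tendsto (fun n : ℕ => linkCost k K / (n : ℝ) ^ d) atTop (𝓝 0) :=
    tendsto_const_nhds.div_atTop
      ((tendsto_pow_atTop hd.ne').comp tendsto_natCast_atTop_atTop)
  have h3 := h1.add h2
  simp only [ENNReal.toReal_zero, add_zero] at h3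
  refine h3.congr fun n => ?_
  simp only [Function.comp_apply, card_box, ENNReal.toReal_div, boxCost, add_div]
  simp

/-- Multiplication by the index of `L` annihilates the quotient by `L`. -/
theorem exists_period (L : AddSubgroup (Site d)) (hL : L.FiniteIndex) :
    ∃ N : ℕ, 0 < N ∧ ∀ m, N ∣ m → ∀ a : Site d, (m : ℤ) • a ∈ L := by
  refine ⟨L.index, Nat.pos_of_ne_zero hL.index_ne_zero, ?_⟩
  rintro m ⟨c, rfl⟩ a
  rw [Nat.cast_mul, mul_comm, mul_smul]
  refine L.zsmul_mem ?_ _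
  rw [natCast_zsmul]
  exact L.nsmul_index_mem a

theorem tendsto_div_natDiv {m : ℕ} (hm : 0 < m) :
    Tendsto (fun n : ℕ => (n : ℝ) / (n / m : ℕ)) atTop (𝓝 m) := by
  have hr : Tendsto (fun n : ℕ => n / m) atTop atTop := Nat.tendsto_div_const_atTop hm.ne'
  have h1 : Tendsto (fun n : ℕ => (m : ℝ) * ((((n / m : ℕ) : ℝ) + 1) / (n / m : ℕ))) atTop
      (𝓝 (m * 1)) := tendsto_const_nhds.mul ((tendsto_add_const_div_self 1).comp hr)
  rw [mul_one] at h1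
  refine tendsto_of_tendsto_of_tendsto_of_le_of_le' tendsto_const_nhds h1 ?_ ?_
  · filter_upwards [hr.eventually_gt_atTop 0] with n hn
    rw [le_div_iff₀ (by positivity)]
    exact_mod_cast Nat.mul_div_le n m
  · filter_upwards [hr.eventually_gt_atTop 0] with n hn
    rw [← mul_div_assoc]
    refine div_le_div_of_nonneg_right ?_ (by positivity)
    exact_mod_cast (Nat.lt_mul_div_succ n hm).le

/-! ### The abstract argument for existence of the limit. -/

/-- Abstract form of the subadditivity argument for the existence of the limit: the predicate
`Bd n A` expresses that the free energy in a box of side length `n` is at most `A`. -/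
structure IsAlmostSuperadditive (d N : ℕ) (b : ℕ → ℝ) (c : ℝ) (Bd : ℕ → ℝ → Prop) : Prop where
  period_pos : 0 < N
  tendsto_cost : Tendsto (fun n => b n / (n : ℝ) ^ d) atTop (𝓝 0)
  mono : ∀ n A A', A ≤ A' → Bd n A → Bd n A'
  of_mul : ∀ m r, 0 < m → 0 < r → N ∣ m → ∀ A, Bd (r * m) A → Bd m (A / (r : ℝ) ^ d + b m)
  of_le : ∀ n n', 0 < n → n ≤ n' → ∀ A, Bd n' A →
    Bd n (A + b n + c * ((n' : ℝ) ^ d - (n : ℝ) ^ d))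

namespace IsAlmostSuperadditive

variable {N : ℕ} {b : ℕ → ℝ} {c : ℝ} {Bd : ℕ → ℝ → Prop}

/-- For a large `n` with the bound, pass to the greatest multiple `n / m * m` of `m` below `n`, then
to a single cell of side `m`. After division by `(n / m) ^ d` the losses of the first passage vanish
as `n → ∞`, leaving only `b m` and an arbitrarily small `ε`. -/
theorem of_frequently (h : IsAlmostSuperadditive d N b c Bd) {a : ℝ}
    (ha : ∃ᶠ n in atTop, Bd n (a * (n : ℝ) ^ d)) {m : ℕ} (hm : 0 < m) (hN : N ∣ m) {ε : ℝ}
    (hε : 0 < ε) : Bd m (a * (m : ℝ) ^ d + b m + ε) := by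
  have hr : Tendsto (fun n : ℕ => n / m) atTop atTop := Nat.tendsto_div_const_atTop hm.ne'
  have hrm : Tendsto (fun n : ℕ => n / m * m) atTop atTop := hr.atTop_mul_const' hm
  have h1 : Tendsto (fun n : ℕ => ((n : ℝ) / (n / m : ℕ)) ^ d) atTop (𝓝 ((m : ℝ) ^ d)) :=
    (tendsto_div_natDiv hm).pow d
  have h2 : Tendsto (fun n : ℕ => b (n / m * m) / ((n / m * m : ℕ) : ℝ) ^ d) atTop (𝓝 0) :=
    h.tendsto_cost.comp hrm
  have h3 : Tendsto (fun n : ℕ => a * ((n : ℝ) / (n / m : ℕ)) ^ d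
      + (b (n / m * m) / ((n / m * m : ℕ) : ℝ) ^ d) * (m : ℝ) ^ d
      + c * (((n : ℝ) / (n / m : ℕ)) ^ d - (m : ℝ) ^ d)) atTop (𝓝 (a * (m : ℝ) ^ d)) := by
    have := ((h1.const_mul a).add (h2.mul_const ((m : ℝ) ^ d))).add
      ((h1.sub_const ((m : ℝ) ^ d)).const_mul c)
    simpa using this
  have h4 := h3.eventually_lt_const (show a * (m : ℝ) ^ d < a * (m : ℝ) ^ d + ε by linarith)
  obtain ⟨n, hn, hnlt, hnr⟩ := (ha.and_eventually (h4.and (hr.eventually_gt_atTop 0))).exists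
  have hle : n / m * m ≤ n := Nat.div_mul_le_self n m
  have h5 := h.of_mul m (n / m) hm hnr hN _
    (h.of_le (n / m * m) n (Nat.mul_pos hnr hm) hle _ hn)
  refine h.mono _ _ _ ?_ h5
  have hr0 : ((n / m : ℕ) : ℝ) ^ d ≠ 0 := by positivity
  have hm0 : (m : ℝ) ^ d ≠ 0 := by positivity
  have e : (a * (n : ℝ) ^ d + b (n / m * m) + c * ((n : ℝ) ^ d - ((n / m * m : ℕ) : ℝ) ^ d))
      / ((n / m : ℕ) : ℝ) ^ d = a * ((n : ℝ) / (n / m : ℕ)) ^ d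
      + (b (n / m * m) / ((n / m * m : ℕ) : ℝ) ^ d) * (m : ℝ) ^ d
      + c * (((n : ℝ) / (n / m : ℕ)) ^ d - (m : ℝ) ^ d) := by
    rw [Nat.cast_mul, div_pow, mul_pow]
    field_simp
  rw [e]
  linarith

/-- The box of side `n` is placed in one whose side `M n` is a multiple of `N` at most `n + N`. As
`M n / n → 1`, all losses are of smaller order than `n ^ d` and fit in the gap between `a` and `a'`.
-/
theorem eventually_of_forall (h : IsAlmostSuperadditive d N b c Bd) {a a' : ℝ} (haa : a < a')
    (ha : ∀ m, 0 < m → N ∣ m → Bd m (a * (m : ℝ) ^ d + b m)) :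
    ∀ᶠ n : ℕ in atTop, Bd n (a' * (n : ℝ) ^ d) := by
  let M : ℕ → ℕ := fun n => N * (n / N + 1)
  have hM1 : ∀ n, n ≤ M n := fun n => (Nat.lt_mul_div_succ n h.period_pos).le
  have hM2 : ∀ n, M n ≤ n + N := fun n => by
    have := Nat.mul_div_le n N
    simp only [M, mul_add, mul_one]
    omega
  have hMt : Tendsto M atTop atTop := tendsto_atTop_mono hM1 tendsto_id
  have hq : Tendsto (fun n : ℕ => (M n : ℝ) / n) atTop (𝓝 1) := by
    refine tendsto_of_tendsto_of_tendsto_of_le_of_le' tendsto_const_nhds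
      (tendsto_add_const_div_self N) ?_ ?_
    · filter_upwards [eventually_gt_atTop 0] with n hn
      rw [le_div_iff₀ (by positivity), one_mul]
      exact_mod_cast hM1 n
    · filter_upwards with n
      refine div_le_div_of_nonneg_right ?_ (by positivity)
      exact_mod_cast hM2 n
  have hqd := hq.pow d
  rw [one_pow] at hqd
  have hlim : Tendsto (fun n : ℕ => a * ((M n : ℝ) / n) ^ d
      + b (M n) / (M n : ℝ) ^ d * ((M n : ℝ) / n) ^ d + b n / (n : ℝ) ^ d
      + c * (((M n : ℝ) / n) ^ d - 1)) atTop (𝓝 a) := by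
    have := (((hqd.const_mul a).add ((h.tendsto_cost.comp hMt).mul hqd)).add
      h.tendsto_cost).add ((hqd.sub_const 1).const_mul c)
    simpa using this
  filter_upwards [hlim.eventually_lt_const haa, eventually_gt_atTop 0] with n hn hn0
  have hMpos : 0 < M n := hn0.trans_le (hM1 n)
  refine h.mono _ _ _ ?_ (h.of_le n (M n) hn0 (hM1 n) _ (ha (M n) hMpos ⟨_, rfl⟩))
  have hn0' : (n : ℝ) ^ d ≠ 0 := by positivity
  have hM0' : (M n : ℝ) ^ d ≠ 0 := by positivity
  have e : a * (M n : ℝ) ^ d + b (M n) + b n + c * ((M n : ℝ) ^ d - (n : ℝ) ^ d)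
      = (a * ((M n : ℝ) / n) ^ d + b (M n) / (M n : ℝ) ^ d * ((M n : ℝ) / n) ^ d
        + b n / (n : ℝ) ^ d + c * (((M n : ℝ) / n) ^ d - 1)) * (n : ℝ) ^ d := by
    rw [div_pow]
    field_simp
  rw [e]
  exact mul_le_mul_of_nonneg_right hn.le (by positivity)

end IsAlmostSuperadditive

theorem inv_mul_le_coe_iff {r : ℝ} (hr : 0 < r) (x : EReal) (a : ℝ) :
    ((r⁻¹ : ℝ) : EReal) * x ≤ (a : EReal) ↔ x ≤ ((a * r : ℝ) : EReal) := by
  have hr' : 0 < r⁻¹ := inv_pos.2 hr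
  induction x with
  | bot => simp [EReal.coe_mul_bot_of_pos hr']
  | top =>
    rw [EReal.coe_mul_top_of_pos hr']
    exact iff_of_false (not_le.2 (EReal.coe_lt_top _)) (not_le.2 (EReal.coe_lt_top _))
  | coe x =>
    rw [← EReal.coe_mul, EReal.coe_le_coe_iff, EReal.coe_le_coe_iff, inv_mul_le_iff₀ hr,
      mul_comm r]

theorem dense_range_coe_EReal : Dense (range ((↑) : ℝ → EReal)) := by
  refine dense_of_exists_between fun a b hab => ?_
  obtain ⟨c, h1, h2⟩ := EReal.lt_iff_exists_real_btwn.1 hab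
  exact ⟨c, mem_range_self c, h1, h2⟩

/-- Being below `a` infinitely often forces the bound in all boxes of suitable side, and hence being
at most any larger level eventually. So no pair of levels is crossed infinitely often, and a
sequence in the compact order `EReal` without upcrossings converges. -/
theorem IsAlmostSuperadditive.exists_tendsto {N : ℕ} {b : ℕ → ℝ} {c : ℝ} {u : ℕ → EReal}
    (h : IsAlmostSuperadditive d N b c fun n A => u n ≤ (A : EReal)) :
    ∃ l : EReal, Tendsto (fun n : ℕ => ((((n : ℝ) ^ d)⁻¹ : ℝ) : EReal) * u n) atTop (𝓝 l) := by
  refine tendsto_of_no_upcrossings dense_range_coe_EReal ?_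
  rintro _ ⟨a, rfl⟩ _ ⟨a', rfl⟩ haa ⟨h1, h2⟩
  rw [EReal.coe_lt_coe_iff] at haa
  obtain ⟨a₁, h3, h4⟩ := exists_between haa
  have h5 : ∃ᶠ n : ℕ in atTop, u n ≤ ((a * (n : ℝ) ^ d : ℝ) : EReal) := by
    refine (h1.and_eventually (eventually_gt_atTop 0)).mono fun n hn => ?_
    have hn0 := hn.2
    exact (inv_mul_le_coe_iff (by positivity) _ _).1 hn.1.le
  have h6 := h.eventually_of_forall h4 fun m hm hN =>
    h.mono _ _ _ (by
      have : 0 < (a₁ - a) * (m : ℝ) ^ d := mul_pos (by linarith) (by positivity)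
      linarith : a * (m : ℝ) ^ d + b m + (a₁ - a) * (m : ℝ) ^ d ≤ _)
      (h.of_frequently h5 hm hN (mul_pos (by linarith) (by positivity)))
  obtain ⟨n, hn, hn', hn0⟩ := (h2.and_eventually (h6.and (eventually_gt_atTop 0))).exists
  exact absurd ((inv_mul_le_coe_iff (by positivity) _ _).2 hn') (not_le.2 hn)

/-! ## Lipschitz constraints -/

/-- The height functions that satisfy the constraint `q` along all edges of `A`. -/
def SatisfiesConstraint (A : SimpleGraph (Site d)) (q : Site d → Site d → ℝ)
    (φ : HeightFn d k) : Prop :=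
  ∀ x y, A.Adj x y → k.toReal (φ y) - k.toReal (φ x) ≤ q x y

/-- Summing the constraint along a fixed walk from `x` to `y` gives a bound that is the same for all
`φ`. -/
theorem exists_increment_bound {A : SimpleGraph (Site d)} (hA : A.Connected)
    (q : Site d → Site d → ℝ) (x y : Site d) :
    ∃ M : ℝ, ∀ φ : HeightFn d k, SatisfiesConstraint A q φ →
      k.toReal (φ y) - k.toReal (φ x) ≤ M := by
  obtain ⟨w⟩ := hA.preconnected x y
  induction w with
  | nil => exact ⟨0, fun φ _ => by simp⟩
  | @cons u v _ h _ ih =>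
    obtain ⟨M, hM⟩ := ih
    refine ⟨q u v + M, fun φ hφ => ?_⟩
    have h1 := hφ _ _ h
    have h2 := hM φ hφ
    linarith

theorem SatisfiesConstraint.shift {L : AddSubgroup (Site d)} {A : SimpleGraph (Site d)}
    {q : Site d → Site d → ℝ} (hA : ∀ l ∈ L, ∀ x y, A.Adj (x + l) (y + l) ↔ A.Adj x y)
    (hq : ∀ l ∈ L, ∀ x y, q (x + l) (y + l) = q x y) {l : Site d} (hl : l ∈ L)
    {φ : HeightFn d k} (hφ : SatisfiesConstraint A q φ) :
    SatisfiesConstraint A q (GradientModel.shift l φ) := by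
  intro x y hxy
  have := hφ (x + l) (y + l) ((hA l hl x y).2 hxy)
  rwa [hq l hl] at this

/-- Uniform bound on the increments along the edges of the square lattice. -/
theorem exists_lipSet_of_satisfiesConstraint {L : AddSubgroup (Site d)} (hL : L.FiniteIndex)
    {A : SimpleGraph (Site d)} {q : Site d → Site d → ℝ} (hA : IsAdmissibleGraph L A)
    (hq : IsAdmissibleQuasimetric L q) :
    ∃ K : ℝ, ∀ φ : HeightFn d k, SatisfiesConstraint A q φ → φ ∈ lipSet k K univ := by
  obtain ⟨N, hN, hNL⟩ := exists_period L hL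
  choose M hM using exists_increment_bound (k := k) hA.connected q
  -- Up to translation by `N` times the lattice there are finitely many nearest-neighbour pairs; `P`
  -- contains a representative `(u, e)` of each, and `K` dominates all their bounds by being the
  -- sum.
  let P : Finset (Site d × Site d) :=
    box d N ×ˢ Fintype.piFinset fun _ : Fin d => Finset.Icc (-1 : ℤ) 1
  let K : ℝ := ∑ p ∈ P, (|M p.1 (p.1 + p.2)| + |M (p.1 + p.2) p.1|)
  refine ⟨K, fun φ hφ x _ y _ hxy => ?_⟩
  set a : Site d := fun i => x i / N with ha
  set u : Site d := fun i => x i % N with hu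
  have hN' : (0 : ℤ) < N := by exact_mod_cast hN
  have hx : x = u + (N : ℤ) • a := by
    funext i
    simp only [Pi.add_apply, Pi.smul_apply, smul_eq_mul, hu, ha]
    exact (Int.emod_add_mul_ediv _ _).symm
  set e : Site d := y - x with he
  have hy : y = (u + e) + (N : ℤ) • a := by
    have : y = x + e := by rw [he]; abel
    rw [this, hx]; abel
  have hP : (u, e) ∈ P := by
    refine Finset.mem_product.2 ⟨mem_box.2 fun i =>
      ⟨Int.emod_nonneg _ hN'.ne', Int.emod_lt_of_pos _ hN'⟩, Fintype.mem_piFinset.2 fun i => ?_⟩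
    have h1 : (x i - y i).natAbs ≤ 1 := by
      rw [← hxy]
      exact Finset.single_le_sum (f := fun i => (x i - y i).natAbs) (fun _ _ => Nat.zero_le _)
        (Finset.mem_univ i)
    rw [Finset.mem_Icc, he]
    simp only [Pi.sub_apply]
    omega
  have hle : |M u (u + e)| + |M (u + e) u| ≤ K :=
    Finset.single_le_sum (f := fun p : Site d × Site d =>
      |M p.1 (p.1 + p.2)| + |M (p.1 + p.2) p.1|) (fun _ _ => by positivity) hP
  have hs := hφ.shift hA.invariant hq.invariant (hNL N dvd_rfl a)
  have h1 := hM u (u + e) _ hs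
  have h2 := hM (u + e) u _ hs
  have e1 : GradientModel.shift ((N : ℤ) • a) φ u = φ x := congrArg φ hx.symm
  have e2 : GradientModel.shift ((N : ℤ) • a) φ (u + e) = φ y := congrArg φ hy.symm
  rw [e1, e2] at h1 h2
  rw [k.toReal_sub, abs_le]
  have := le_abs_self (M u (u + e))
  have := le_abs_self (M (u + e) u)
  have := abs_nonneg (M u (u + e))
  have := abs_nonneg (M (u + e) u)
  constructor <;> linarith

/-! ## The specific free energy -/

/-- A decomposition of an interaction into a strong part `Ψ` with constraint `(A, q)` and a weak
part `Ξ`, with the bounds used in the study of the specific free energy. -/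
structure IsInteraction (L : AddSubgroup (Site d)) (Ψ Ξ : GradientPotential d k)
    (A : SimpleGraph (Site d)) (q : Site d → Site d → ℝ) (K : ℝ) (N : ℕ) : Prop where
  dim_pos : 0 < d
  period_pos : 0 < N
  period : ∀ m, N ∣ m → ∀ a : Site d, (m : ℤ) • a ∈ L
  nonneg : ∀ Λ φ, 0 ≤ Ψ Λ φ
  periodic_strong : Ψ.IsPeriodic L
  periodic_weak : Ξ.IsPeriodic L
  totalNorm_ne_top : Ξ.totalNorm ≠ ⊤
  amenable : IsAmenable L Ξ.lowerExteriorBound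
  lipschitz : ∀ φ : HeightFn d k, SatisfiesConstraint A q φ → φ ∈ lipSet k K univ
  graph_invariant : ∀ l ∈ L, ∀ x y, A.Adj (x + l) (y + l) ↔ A.Adj x y
  quasimetric_invariant : ∀ l ∈ L, ∀ x y, q (x + l) (y + l) = q x y
  eq_top : ∀ x y, A.Adj x y → ∀ φ : HeightFn d k,
    q x y < k.toReal (φ y) - k.toReal (φ x) → Ψ {x, y} φ = ⊤
  connected : A.Connected

theorem exists_isInteraction (hd : 0 < d) {L : AddSubgroup (Site d)} (hL : L.FiniteIndex)
    {Φ : GradientPotential d k} (hΦ : Φ ∈ strongInteractions k L + weakInteractions k L) :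
    ∃ Ψ Ξ A q K N, Φ = Ψ + Ξ ∧ IsInteraction L Ψ Ξ A q K N := by
  obtain ⟨Ψ, ⟨hΨL, hΨ0, -, A, q, hAq, hΨA, -⟩, Ξ, ⟨hΞL, hΞN, hΞA⟩, rfl⟩ := Set.mem_add.1 hΦ
  obtain ⟨N, hN, hNL⟩ := exists_period L hL
  obtain ⟨K, hK⟩ := exists_lipSet_of_satisfiesConstraint (k := k) hL hAq.graph hAq.greatest.1.1
  exact ⟨Ψ, Ξ, A, q, K, N, rfl, hd, hN, hNL, hΨ0, hΨL, hΞL, hΞN, hΞA, hK, hAq.graph.invariant,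
    hAq.greatest.1.1.invariant, fun x y hxy φ h => (hΨA _ _).2 ⟨x, y, hxy, rfl, h⟩,
    hAq.graph.connected⟩

theorem withDensity_apply_eq_zero_of_forall {X : Type*} [MeasurableSpace X] {ρ : Measure X}
    {w : X → ℝ≥0∞} {V : Set X} (hV : MeasurableSet V) (h : ∀ x ∈ V, w x = 0) :
    ρ.withDensity w V = 0 := by
  rw [withDensity_apply _ hV, setLIntegral_congr_fun hV h, lintegral_zero]

/-- The height functions that violate the constraint along the edge from `x` to `y`. -/
def violationSet (k : HeightKind) (q : Site d → Site d → ℝ) (x y : Site d) :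
    Set (HeightFn d k) :=
  {φ | q x y < k.toReal (φ y) - k.toReal (φ x)}

theorem measurableSet_violationSet (q : Site d → Site d → ℝ) {x y : Site d} {Λ : Set (Site d)}
    (hx : x ∈ Λ) (hy : y ∈ Λ) : MeasurableSet[gradAlgOn d k Λ] (violationSet k q x y) := by
  have : violationSet k q x y = {φ : HeightFn d k | q x y < k.toReal (φ y - φ x)} := by
    ext φ
    simp [violationSet, k.toReal_sub]
  rw [this]
  exact (k.measurable_toReal.comp (measurable_sub_gradAlgOn hx hy)) measurableSet_Ioi

/-- The gradient measures that are supported on height functions satisfying the constraint. -/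
def IsConstrained (A : SimpleGraph (Site d)) (q : Site d → Site d → ℝ)
    (μ : Measure (HeightFn d k)) : Prop :=
  ∀ x y, A.Adj x y → μ (violationSet k q x y) = 0

theorem IsConstrained.ae {A : SimpleGraph (Site d)} {q : Site d → Site d → ℝ}
    {μ : Measure (HeightFn d k)} (h : IsConstrained A q μ) :
    ∀ᵐ φ ∂μ, SatisfiesConstraint A q φ := by
  simp only [SatisfiesConstraint]
  rw [ae_all_iff]
  intro x
  rw [ae_all_iff]
  intro y
  by_cases hxy : A.Adj x y
  · have : ∀ᵐ φ ∂μ, φ ∉ violationSet k q x y := measure_eq_zero_iff_ae_notMem.1 (h x y hxy)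
    filter_upwards [this] with φ hφ _
    exact not_lt.1 hφ
  · exact ae_of_all _ fun φ h => absurd h hxy

namespace IsInteraction

variable {L : AddSubgroup (Site d)} {Ψ Ξ : GradientPotential d k}
  {A : SimpleGraph (Site d)} {q : Site d → Site d → ℝ} {K : ℝ} {N : ℕ}

theorem freeEnergy_box_le_iff (h : IsInteraction L Ψ Ξ A q K N) {μ : Measure (HeightFn d k)}
    [IsProbabilityMeasure μ] (hμ : IsConstrained A q μ) {n : ℕ} (hn : 0 < n) (a : ℝ) :
    freeEnergy (Ψ + Ξ) (box d n) μ ≤ (a : EReal) ↔ FreeEnergyBound (Ψ + Ξ) K (box d n) μ a :=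
  freeEnergy_le_iff (hμ.ae.mono fun φ hφ => h.lipschitz φ hφ)
    (ne_top_of_le_ne_top ENNReal.ofReal_ne_top
      (refIntegral_lipWeight_box_le h.nonneg h.totalNorm_ne_top K hn)) a

theorem isAlmostSuperadditive (h : IsInteraction L Ψ Ξ A q K N)
    {μ : ProbabilityMeasure (HeightFn d k)} (hμL : μ ∈ invariantMeasures k L)
    (hμ : IsConstrained A q (μ : Measure (HeightFn d k))) :
    IsAlmostSuperadditive d N (boxCost Ξ K) (siteCost Ξ K)
      fun n a => freeEnergy (Ψ + Ξ) (box d n) (μ : Measure (HeightFn d k)) ≤ (a : EReal) where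
  period_pos := h.period_pos
  tendsto_cost := tendsto_boxCost_div h.dim_pos h.amenable K
  mono _ _ _ haa ha := ha.trans (EReal.coe_le_coe_iff.2 haa)
  of_mul m r hm hr hN a ha := by
    rw [h.freeEnergy_box_le_iff hμ (Nat.mul_pos hr hm)] at ha
    rw [h.freeEnergy_box_le_iff hμ hm]
    exact ha.div_pow h.nonneg h.periodic_strong h.periodic_weak h.amenable hμL hm hr (h.period m hN)
  of_le n n' hn hnn a ha := by
    rw [h.freeEnergy_box_le_iff hμ (hn.trans_le hnn)] at ha
    rw [h.freeEnergy_box_le_iff hμ hn]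
    exact ha.of_le h.nonneg h.totalNorm_ne_top hn hnn (h.amenable.finite _)

/-- The boxes only fill the positive orthant, so cylinder data must first be moved there by a
period, which invariance allows. Translation by `N * R ≥ R` in every coordinate suffices. -/
theorem exists_translate (h : IsInteraction L Ψ Ξ A q K N) (Λ : Finset (Site d)) :
    ∃ l ∈ L, ∃ n₀, ∀ n ≥ n₀, Λ.image (· + l) ⊆ box d n := by
  obtain ⟨R, hR⟩ : ∃ R : ℕ, ∀ x ∈ Λ, ∀ i, (x i).natAbs ≤ R := by
    refine ⟨∑ x ∈ Λ, ∑ i, (x i).natAbs, fun x hx i => ?_⟩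
    exact (Finset.single_le_sum (f := fun i => (x i).natAbs) (fun _ _ => Nat.zero_le _)
      (Finset.mem_univ i)).trans (Finset.single_le_sum (f := fun x : Site d => ∑ i, (x i).natAbs)
        (fun _ _ => Nat.zero_le _) hx)
  refine ⟨((N * R : ℕ) : ℤ) • (fun _ => 1 : Site d), h.period _ (Dvd.intro _ rfl) _,
    N * R + R + 1, fun n hn y hy => ?_⟩
  obtain ⟨x, hx, rfl⟩ := Finset.mem_image.1 hy
  rw [mem_box]
  intro i
  have h1 := hR x hx i
  have h2 : R ≤ N * R := Nat.le_mul_of_pos_left R h.period_pos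
  simp only [Pi.add_apply, Pi.smul_apply, smul_eq_mul, mul_one]
  omega

/-- By invariance a translate of the violated edge inside the box is violated with positive
probability, but the Boltzmann weight vanishes there. Absolute continuity fails, so the entropy is
infinite. -/
theorem eventually_freeEnergy_eq_top (h : IsInteraction L Ψ Ξ A q K N)
    {μ : ProbabilityMeasure (HeightFn d k)} (hμL : μ ∈ invariantMeasures k L)
    (hμ : ¬IsConstrained A q (μ : Measure (HeightFn d k))) :
    ∀ᶠ n in atTop, freeEnergy (Ψ + Ξ) (box d n) (μ : Measure (HeightFn d k)) = ⊤ := by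
  rw [IsConstrained] at hμ
  push Not at hμ
  obtain ⟨x, y, hxy, hpos⟩ := hμ
  obtain ⟨l, hl, n₀, hn₀⟩ := h.exists_translate {x, y}
  filter_upwards [eventually_ge_atTop n₀] with n hn
  have hxn : x + l ∈ box d n := hn₀ n hn (Finset.mem_image_of_mem _ (by simp))
  have hyn : y + l ∈ box d n := hn₀ n hn (Finset.mem_image_of_mem _ (by simp))
  have hV : (μ : Measure (HeightFn d k)) (violationSet k q (x + l) (y + l)) ≠ 0 := by
    have hm : MeasurableSet (violationSet k q x y) :=
      measurableSet_violationSet q (mem_univ x) (mem_univ y)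
    have e : violationSet k q (x + l) (y + l) = shift l ⁻¹' violationSet k q x y := by
      ext φ
      simp [violationSet, shift, h.quasimetric_invariant l hl]
    rw [e, (hμL l hl).measure_preimage hm.nullMeasurableSet]
    exact hpos
  have hVm := measurableSet_violationSet (k := k) q (Finset.mem_coe.2 hxn) (Finset.mem_coe.2 hyn)
  refine @if_neg _ _ ?_ _ _ _
  intro hac
  refine hV ?_
  rw [← trim_measurableSet_eq (gradAlgOn_le (k := k) (box d n : Set (Site d))) hVm]
  refine hac ?_
  refine @withDensity_apply_eq_zero_of_forall _ (gradAlgOn d k (box d n : Set (Site d))) _ _ _ hVm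
    fun φ hφ => ?_
  have e1 := (Ψ + Ξ).boltzmann_eq_prod (box d n) φ
  rw [GradientPotential.boltzmann] at e1
  rw [e1]
  refine Finset.prod_eq_zero (i := {x + l, y + l}) ?_ ?_
  · rw [Finset.mem_powerset]
    intro w hw
    rw [Finset.mem_insert, Finset.mem_singleton] at hw
    rcases hw with rfl | rfl
    exacts [hxn, hyn]
  · have e2 : (Ψ + Ξ) {x + l, y + l} φ = Ψ {x + l, y + l} φ + Ξ {x + l, y + l} φ := rfl
    rw [e2, h.eq_top _ _ ((h.graph_invariant l hl x y).2 hxy) φ hφ,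
      EReal.top_add_of_ne_bot (Ξ.ne_bot _ _)]
    simp

theorem tendsto_top (h : IsInteraction L Ψ Ξ A q K N)
    {μ : ProbabilityMeasure (HeightFn d k)} (hμL : μ ∈ invariantMeasures k L)
    (hμ : ¬IsConstrained A q (μ : Measure (HeightFn d k))) :
    Tendsto (normalizedFreeEnergy (Ψ + Ξ) (μ : Measure (HeightFn d k))) atTop (𝓝 ⊤) := by
  refine tendsto_const_nhds.congr' ?_
  filter_upwards [h.eventually_freeEnergy_eq_top hμL hμ, eventually_gt_atTop 0] with n hn hn0
  rw [normalizedFreeEnergy, hn, EReal.coe_mul_top_of_pos (by positivity)]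

theorem tendsto_normalizedFreeEnergy (h : IsInteraction L Ψ Ξ A q K N)
    {μ : ProbabilityMeasure (HeightFn d k)} (hμL : μ ∈ invariantMeasures k L) :
    Tendsto (normalizedFreeEnergy (Ψ + Ξ) (μ : Measure (HeightFn d k))) atTop
      (𝓝 (specificFreeEnergy (Ψ + Ξ) (μ : Measure (HeightFn d k)))) := by
  by_cases hμ : IsConstrained A q (μ : Measure (HeightFn d k))
  · obtain ⟨l, hl⟩ := (h.isAlmostSuperadditive hμL hμ).exists_tendsto
    have : Tendsto (normalizedFreeEnergy (Ψ + Ξ) (μ : Measure (HeightFn d k))) atTop (𝓝 l) := hl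
    rwa [specificFreeEnergy, this.limUnder_eq]
  · have := h.tendsto_top hμL hμ
    rwa [specificFreeEnergy, this.limUnder_eq]

theorem specificFreeEnergy_eq_top (h : IsInteraction L Ψ Ξ A q K N)
    {μ : ProbabilityMeasure (HeightFn d k)} (hμL : μ ∈ invariantMeasures k L)
    (hμ : ¬IsConstrained A q (μ : Measure (HeightFn d k))) :
    specificFreeEnergy (Ψ + Ξ) (μ : Measure (HeightFn d k)) = ⊤ :=
  (h.tendsto_top hμL hμ).limUnder_eq

theorem neg_siteCost_le_specificFreeEnergy (h : IsInteraction L Ψ Ξ A q K N)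
    {μ : ProbabilityMeasure (HeightFn d k)} (hμL : μ ∈ invariantMeasures k L) :
    ((-siteCost Ξ K : ℝ) : EReal) ≤ specificFreeEnergy (Ψ + Ξ) (μ : Measure (HeightFn d k)) := by
  by_cases hμ : IsConstrained A q (μ : Measure (HeightFn d k))
  swap
  · rw [h.specificFreeEnergy_eq_top hμL hμ]; exact le_top
  refine ge_of_tendsto (h.tendsto_normalizedFreeEnergy hμL) ?_
  filter_upwards [eventually_gt_atTop 0] with n hn
  by_contra hlt
  obtain ⟨a, h1, h2⟩ := EReal.lt_iff_exists_real_btwn.1 (not_le.1 hlt)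
  rw [EReal.coe_lt_coe_iff] at h2
  have hn0 : (0 : ℝ) < (n : ℝ) ^ d := by positivity
  have h3 := (inv_mul_le_coe_iff hn0 _ _).1 h1.le
  rw [h.freeEnergy_box_le_iff hμ hn] at h3
  have h4 := h3.neg_siteCost_le h.nonneg h.totalNorm_ne_top hn
  have h5 := le_of_mul_le_mul_right h4 hn0
  linarith

/-- Bounds in finite boxes from a bound on the specific free energy. -/
theorem freeEnergyBound_of_specificFreeEnergy_lt (h : IsInteraction L Ψ Ξ A q K N)
    {μ : ProbabilityMeasure (HeightFn d k)} (hμL : μ ∈ invariantMeasures k L)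
    (hμ : IsConstrained A q (μ : Measure (HeightFn d k))) {a : ℝ}
    (ha : specificFreeEnergy (Ψ + Ξ) (μ : Measure (HeightFn d k)) < (a : EReal)) {m : ℕ}
    (hm : 0 < m) (hN : N ∣ m) {ε : ℝ} (hε : 0 < ε) :
    FreeEnergyBound (Ψ + Ξ) K (box d m) (μ : Measure (HeightFn d k))
      (a * (m : ℝ) ^ d + boxCost Ξ K m + ε) := by
  rw [← h.freeEnergy_box_le_iff hμ hm]
  refine (h.isAlmostSuperadditive hμL hμ).of_frequently (Eventually.frequently ?_) hm hN hε
  filter_upwards [(h.tendsto_normalizedFreeEnergy hμL).eventually_lt_const ha,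
    eventually_gt_atTop 0] with n hn hn0
  exact (inv_mul_le_coe_iff (by positivity) _ _).1 hn.le

/-- A bound on the specific free energy from bounds in finite boxes. -/
theorem specificFreeEnergy_le_of_freeEnergyBound (h : IsInteraction L Ψ Ξ A q K N)
    {μ : ProbabilityMeasure (HeightFn d k)} (hμL : μ ∈ invariantMeasures k L)
    (hμ : IsConstrained A q (μ : Measure (HeightFn d k))) {a a' : ℝ} (haa : a < a')
    (ha : ∀ m, 0 < m → N ∣ m → FreeEnergyBound (Ψ + Ξ) K (box d m) (μ : Measure (HeightFn d k))
      (a * (m : ℝ) ^ d + boxCost Ξ K m)) :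
    specificFreeEnergy (Ψ + Ξ) (μ : Measure (HeightFn d k)) ≤ (a' : EReal) := by
  refine le_of_tendsto (h.tendsto_normalizedFreeEnergy hμL) ?_
  filter_upwards [(h.isAlmostSuperadditive hμL hμ).eventually_of_forall haa fun m hm hN =>
    (h.freeEnergy_box_le_iff hμ hm _).2 (ha m hm hN), eventually_gt_atTop 0] with n hn hn0
  exact (inv_mul_le_coe_iff (by positivity) _ _).2 hn

end IsInteraction

/-! ## Affinity -/

theorem integral_add_const_le {X : Type*} [MeasurableSpace X] {μ : Measure X}
    [IsProbabilityMeasure μ] {f F : X → ℝ} (hf : Integrable f μ) (hF : Integrable F μ) {c : ℝ}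
    (h : ∀ x, f x + c ≤ F x) : ∫ x, f x ∂μ + c ≤ ∫ x, F x ∂μ := by
  have h1 : ∫ x, (f x + c) ∂μ = ∫ x, f x ∂μ + c := by
    rw [integral_add hf (integrable_const c)]
    simp
  rw [← h1]
  exact integral_mono (hf.add (integrable_const c)) hF h

/-- The convex combination of two gradient measures. -/
def mixture (μ ν : ProbabilityMeasure (HeightFn d k)) (t : ℝ) (h0 : 0 ≤ t) (h1 : t ≤ 1) :
    ProbabilityMeasure (HeightFn d k) :=
  ⟨ENNReal.ofReal (1 - t) • (μ : Measure (HeightFn d k))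
    + ENNReal.ofReal t • (ν : Measure (HeightFn d k)), ⟨by
      rw [Measure.add_apply, Measure.smul_apply, Measure.smul_apply, measure_univ, measure_univ,
        smul_eq_mul, smul_eq_mul, mul_one, mul_one,
        ← ENNReal.ofReal_add (sub_nonneg.2 h1) h0]
      simp⟩⟩

section Mixture

variable {μ ν : ProbabilityMeasure (HeightFn d k)} {t : ℝ} (h0 : 0 ≤ t) (h1 : t ≤ 1)

theorem mixture_mem_invariantMeasures {L : AddSubgroup (Site d)}
    (hμ : μ ∈ invariantMeasures k L) (hν : ν ∈ invariantMeasures k L) :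
    mixture μ ν t h0 h1 ∈ invariantMeasures k L := by
  intro l hl
  refine ⟨(hμ l hl).measurable, ?_⟩
  change Measure.map _ (ENNReal.ofReal (1 - t) • (μ : Measure (HeightFn d k))
    + ENNReal.ofReal t • (ν : Measure (HeightFn d k))) = _
  rw [Measure.map_add _ _ (hμ l hl).measurable, Measure.map_smul, Measure.map_smul,
    (hμ l hl).map_eq, (hν l hl).map_eq]
  rfl

theorem integral_mixture {f : HeightFn d k → ℝ} (hf : Measurable f) {C : ℝ}
    (hC : ∀ φ, |f φ| ≤ C) :
    ∫ φ, f φ ∂(mixture μ ν t h0 h1 : Measure (HeightFn d k))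
      = (1 - t) * ∫ φ, f φ ∂(μ : Measure (HeightFn d k))
        + t * ∫ φ, f φ ∂(ν : Measure (HeightFn d k)) := by
  change ∫ φ, f φ ∂(ENNReal.ofReal (1 - t) • (μ : Measure (HeightFn d k))
    + ENNReal.ofReal t • (ν : Measure (HeightFn d k))) = _
  rw [integral_add_measure, integral_smul_measure, integral_smul_measure,
    ENNReal.toReal_ofReal h0, ENNReal.toReal_ofReal (sub_nonneg.2 h1), smul_eq_mul, smul_eq_mul]
  · exact (integrable_of_abs_le hf hC).smul_measure ENNReal.ofReal_ne_top
  · exact (integrable_of_abs_le hf hC).smul_measure ENNReal.ofReal_ne_top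

/-- For a given `f` both hypotheses share the same right side, and the exponent for the mixture is a
convex combination of theirs, hence at most the larger. -/
theorem FreeEnergyBound.mixture_of {Φ : GradientPotential d k} {K : ℝ} {Λ : Finset (Site d)}
    {a b : ℝ} (ha : FreeEnergyBound Φ K Λ μ a) (hb : FreeEnergyBound Φ K Λ ν b) :
    FreeEnergyBound Φ K Λ (mixture μ ν t h0 h1 : Measure (HeightFn d k))
      ((1 - t) * a + t * b) := by
  rintro f hf ⟨C, hC⟩
  rw [integral_mixture h0 h1 (fun _ hs => gradAlgOn_le _ _ (hf hs)) hC]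
  have h2 := ha f hf ⟨C, hC⟩
  have h3 := hb f hf ⟨C, hC⟩
  set x := ∫ φ, f φ ∂(μ : Measure (HeightFn d k))
  set y := ∫ φ, f φ ∂(ν : Measure (HeightFn d k))
  rcases le_total (x - a) (y - b) with h | h
  · refine le_trans (ENNReal.ofReal_le_ofReal (Real.exp_le_exp.2 ?_)) h3
    nlinarith
  · refine le_trans (ENNReal.ofReal_le_ofReal (Real.exp_le_exp.2 ?_)) h2
    nlinarith

/-- If `f` and `g` witness the two failures, shift them so that their means are `a` and `b` while
their exponential integrals are at most `1`. The log-sum-exp `F` of the shifted functions dominates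
both and has exponential integral at most `2`; testing the mixture with `F` gives the claim. -/
theorem FreeEnergyBound.le_add_log_two {Φ : GradientPotential d k} {K : ℝ}
    {Λ : Finset (Site d)} {a b c : ℝ} (ha : ¬FreeEnergyBound Φ K Λ μ a)
    (hb : ¬FreeEnergyBound Φ K Λ ν b)
    (hc : FreeEnergyBound Φ K Λ (mixture μ ν t h0 h1 : Measure (HeightFn d k)) c) :
    (1 - t) * a + t * b ≤ c + Real.log 2 := by
  rw [FreeEnergyBound] at ha hb
  push Not at ha hb
  obtain ⟨f, hf, ⟨C, hC⟩, hfa⟩ := ha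
  obtain ⟨g, hg, ⟨D, hD⟩, hgb⟩ := hb
  set x := ∫ φ, f φ ∂(μ : Measure (HeightFn d k))
  set y := ∫ φ, g φ ∂(ν : Measure (HeightFn d k))
  let F : HeightFn d k → ℝ := fun φ =>
    Real.log (Real.exp (f φ + (a - x)) + Real.exp (g φ + (b - y)))
  have hpos : ∀ φ, 0 < Real.exp (f φ + (a - x)) + Real.exp (g φ + (b - y)) := fun φ => by
    positivity
  have hF : Measurable[gradAlgOn d k (Λ : Set (Site d))] F :=
    Real.measurable_log.comp ((Real.measurable_exp.comp (hf.add_const _)).add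
      (Real.measurable_exp.comp (hg.add_const _)))
  have hF1 : ∀ φ, f φ + (a - x) ≤ F φ := fun φ => by
    rw [Real.le_log_iff_exp_le (hpos φ)]
    exact le_add_of_nonneg_right (Real.exp_pos _).le
  have hF2 : ∀ φ, g φ + (b - y) ≤ F φ := fun φ => by
    rw [Real.le_log_iff_exp_le (hpos φ)]
    exact le_add_of_nonneg_left (Real.exp_pos _).le
  have hFB : ∀ φ, |F φ| ≤ (C + |a - x|) + (D + |b - y|) + Real.log 2 := fun φ => by
    have hf1 := abs_le.1 (hC φ)
    have hg1 := abs_le.1 (hD φ)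
    have h2 := abs_le.1 (le_refl |a - x|)
    have h3 := abs_le.1 (le_refl |b - y|)
    have hl : 0 < Real.log 2 := Real.log_pos one_lt_two
    have hCx : 0 ≤ C + |a - x| := by have := (abs_nonneg _).trans (hC φ); positivity
    have hDy : 0 ≤ D + |b - y| := by have := (abs_nonneg _).trans (hD φ); positivity
    rw [abs_le]
    constructor
    · have := hF1 φ
      linarith
    · rw [Real.log_le_iff_le_exp (hpos φ), Real.exp_add _ (Real.log 2), Real.exp_log two_pos]
      have e1 := Real.exp_le_exp.2 (show f φ + (a - x) ≤ C + |a - x| + (D + |b - y|) by linarith)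
      have e2 := Real.exp_le_exp.2 (show g φ + (b - y) ≤ C + |a - x| + (D + |b - y|) by linarith)
      linarith
  have hme : ∀ {g : HeightFn d k → ℝ}, Measurable[gradAlgOn d k (Λ : Set (Site d))] g →
      Measurable[gradAlgOn d k (Λ : Set (Site d))] fun φ =>
        lipWeight Φ K Λ φ * ENNReal.ofReal (Real.exp (g φ)) := fun hg =>
    (measurable_lipWeight _ K Λ).mul (ENNReal.measurable_ofReal.comp (Real.measurable_exp.comp hg))
  have hI : refIntegral Λ (fun φ => lipWeight Φ K Λ φ * ENNReal.ofReal (Real.exp (F φ))) ≤ 2 := by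
    have e : (fun φ => lipWeight Φ K Λ φ * ENNReal.ofReal (Real.exp (F φ)))
        = fun φ => ENNReal.ofReal (Real.exp (a - x)) *
            (lipWeight Φ K Λ φ * ENNReal.ofReal (Real.exp (f φ)))
          + ENNReal.ofReal (Real.exp (b - y)) *
            (lipWeight Φ K Λ φ * ENNReal.ofReal (Real.exp (g φ))) := by
      funext φ
      rw [Real.exp_log (hpos φ), ENNReal.ofReal_add (Real.exp_pos _).le (Real.exp_pos _).le,
        Real.exp_add, Real.exp_add, ENNReal.ofReal_mul (Real.exp_pos _).le,
        ENNReal.ofReal_mul (Real.exp_pos _).le]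
      ring
    have hinv : ∀ z : ℝ, ∀ J : ℝ≥0∞, J < ENNReal.ofReal (Real.exp z) →
        ENNReal.ofReal (Real.exp (-z)) * J ≤ 1 := by
      intro z J hJ
      refine (mul_le_mul_right hJ.le _).trans ?_
      rw [← ENNReal.ofReal_mul (Real.exp_pos _).le, ← Real.exp_add]
      simp
    calc _ = ENNReal.ofReal (Real.exp (a - x)) *
            refIntegral Λ (fun φ => lipWeight Φ K Λ φ * ENNReal.ofReal (Real.exp (f φ)))
          + ENNReal.ofReal (Real.exp (b - y)) *
            refIntegral Λ (fun φ => lipWeight Φ K Λ φ * ENNReal.ofReal (Real.exp (g φ))) := by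
          rw [e, ← refIntegral_const_mul _ (hme hf), ← refIntegral_const_mul _ (hme hg)]
          exact @lintegral_add_left _ (gradAlgOn d k (Λ : Set (Site d))) _ _
            ((hme hf).const_mul _) _
      _ ≤ 1 + 1 := by
          gcongr
          · rw [← neg_sub x a]; exact hinv _ _ hfa
          · rw [← neg_sub y b]; exact hinv _ _ hgb
      _ = 2 := one_add_one_eq_two
  have hmF : Measurable F := fun _ hs => gradAlgOn_le _ _ (hF hs)
  have h2 := (hc F hF ⟨_, hFB⟩).trans hI
  rw [integral_mixture h0 h1 hmF hFB] at h2
  have h3 : ENNReal.ofReal (Real.exp ((1 - t) * ∫ φ, F φ ∂(μ : Measure (HeightFn d k))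
      + t * ∫ φ, F φ ∂(ν : Measure (HeightFn d k)) - c)) ≤ ENNReal.ofReal 2 := by
    simpa using h2
  have h4 := (ENNReal.ofReal_le_ofReal_iff zero_le_two).1 h3
  rw [← Real.le_log_iff_exp_le two_pos] at h4
  have h5 : a ≤ ∫ φ, F φ ∂(μ : Measure (HeightFn d k)) := by
    have hfi : Integrable f (μ : Measure (HeightFn d k)) :=
      integrable_of_abs_le (fun _ hs => gradAlgOn_le _ _ (hf hs)) hC
    have := integral_add_const_le hfi (integrable_of_abs_le hmF hFB) hF1
    linarith
  have h6 : b ≤ ∫ φ, F φ ∂(ν : Measure (HeightFn d k)) := by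
    have hgi : Integrable g (ν : Measure (HeightFn d k)) :=
      integrable_of_abs_le (fun _ hs => gradAlgOn_le _ _ (hg hs)) hD
    have := integral_add_const_le hgi (integrable_of_abs_le hmF hFB) hF2
    linarith
  have h7 := mul_le_mul_of_nonneg_left h5 (sub_nonneg.2 h1)
  have h8 := mul_le_mul_of_nonneg_left h6 h0
  linarith

end Mixture

theorem EReal_mul_ne_bot {s : ℝ} (hs : 0 < s) {x : EReal} (hx : x ≠ ⊥) : (s : EReal) * x ≠ ⊥ := by
  induction x with
  | bot => exact absurd rfl hx
  | top => rw [EReal.coe_mul_top_of_pos hs]; simp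
  | coe x => rw [← EReal.coe_mul]; exact EReal.coe_ne_bot _

theorem exists_coe_lt_of_ne_bot {x : EReal} (hx : x ≠ ⊥) : ∃ a : ℝ, (a : EReal) < x := by
  obtain ⟨a, -, h⟩ := EReal.lt_iff_exists_real_btwn.1 (bot_lt_iff_ne_bot.2 hx)
  exact ⟨a, h⟩

/-- If one of the values is infinite, the other approximation is chosen arbitrarily and compensated;
if both are finite, the slack is shared equally. -/
theorem exists_lt_lt_of_lt_combination {s t : ℝ} (hs : 0 < s) (ht : 0 < t) {x y : EReal}
    (hx : x ≠ ⊥) (hy : y ≠ ⊥) {w : ℝ} (hw : (w : EReal) < s * x + t * y) :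
    ∃ a b : ℝ, (a : EReal) < x ∧ (b : EReal) < y ∧ w < s * a + t * b := by
  induction x with
  | bot => exact absurd rfl hx
  | top =>
    obtain ⟨b, hb⟩ := exists_coe_lt_of_ne_bot hy
    refine ⟨(w - t * b) / s + 1, b, EReal.coe_lt_top _, hb, ?_⟩
    have : s * ((w - t * b) / s + 1) = w - t * b + s := by field_simp
    linarith
  | coe x =>
    induction y with
    | bot => exact absurd rfl hy
    | top =>
      obtain ⟨a, ha⟩ := exists_coe_lt_of_ne_bot hx
      refine ⟨a, (w - s * a) / t + 1, ha, EReal.coe_lt_top _, ?_⟩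
      have : t * ((w - s * a) / t + 1) = w - s * a + t := by field_simp
      linarith
    | coe y =>
      rw [← EReal.coe_mul, ← EReal.coe_mul, ← EReal.coe_add, EReal.coe_lt_coe_iff] at hw
      have hst : 0 < 2 * (s + t) := by positivity
      set δ := (s * x + t * y - w) / (2 * (s + t)) with hδ
      have hδ0 : 0 < δ := div_pos (by linarith) hst
      refine ⟨x - δ, y - δ, EReal.coe_lt_coe_iff.2 (by linarith),
        EReal.coe_lt_coe_iff.2 (by linarith), ?_⟩
      have : δ * (2 * (s + t)) = s * x + t * y - w := div_mul_cancel₀ _ hst.ne'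
      nlinarith

namespace IsInteraction

variable {L : AddSubgroup (Site d)} {Ψ Ξ : GradientPotential d k}
  {A : SimpleGraph (Site d)} {q : Site d → Site d → ℝ} {K : ℝ} {N : ℕ}

theorem specificFreeEnergy_ne_bot (h : IsInteraction L Ψ Ξ A q K N)
    {μ : ProbabilityMeasure (HeightFn d k)} (hμ : μ ∈ invariantMeasures k L) :
    specificFreeEnergy (Ψ + Ξ) (μ : Measure (HeightFn d k)) ≠ ⊥ := fun hbot => by
  have := h.neg_siteCost_le_specificFreeEnergy hμ
  rw [hbot, le_bot_iff] at this
  exact EReal.coe_ne_bot _ this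

theorem isConstrained_mixture_iff {μ ν : ProbabilityMeasure (HeightFn d k)} {t : ℝ} (h0 : 0 < t)
    (h1 : t < 1) : IsConstrained A q (mixture μ ν t h0.le h1.le : Measure (HeightFn d k)) ↔
      IsConstrained A q (μ : Measure (HeightFn d k)) ∧
        IsConstrained A q (ν : Measure (HeightFn d k)) := by
  have key : ∀ V, (mixture μ ν t h0.le h1.le : Measure (HeightFn d k)) V = 0 ↔
      (μ : Measure (HeightFn d k)) V = 0 ∧ (ν : Measure (HeightFn d k)) V = 0 := by
    intro V
    change (ENNReal.ofReal (1 - t) • (μ : Measure (HeightFn d k))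
      + ENNReal.ofReal t • (ν : Measure (HeightFn d k))) V = 0 ↔ _
    simp [ENNReal.ofReal_eq_zero, not_le.2 h0, not_le.2 h1]
  simp only [IsConstrained, key]
  exact ⟨fun h => ⟨fun x y hxy => (h x y hxy).1, fun x y hxy => (h x y hxy).2⟩,
    fun h x y hxy => ⟨h.1 x y hxy, h.2 x y hxy⟩⟩

theorem normalizedFreeEnergy_le_iff (h : IsInteraction L Ψ Ξ A q K N)
    {μ : Measure (HeightFn d k)} [IsProbabilityMeasure μ] (hμ : IsConstrained A q μ) {n : ℕ}
    (hn : 0 < n) (a : ℝ) : normalizedFreeEnergy (Ψ + Ξ) μ n ≤ (a : EReal) ↔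
      FreeEnergyBound (Ψ + Ξ) K (box d n) μ (a * (n : ℝ) ^ d) := by
  rw [normalizedFreeEnergy, inv_mul_le_coe_iff (by positivity), h.freeEnergy_box_le_iff hμ hn]

/-- Convexity in each box passes to the limit and gives one inequality. The reverse holds in each
box up to `log 2`, which is negligible against the volume. When a component violates the constraint,
so does the mixture, and both sides are infinite. -/
theorem specificFreeEnergy_mixture (h : IsInteraction L Ψ Ξ A q K N)
    {μ ν : ProbabilityMeasure (HeightFn d k)} (hμL : μ ∈ invariantMeasures k L)
    (hνL : ν ∈ invariantMeasures k L) {t : ℝ} (h0 : 0 < t) (h1 : t < 1) :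
    specificFreeEnergy (Ψ + Ξ) (mixture μ ν t h0.le h1.le : Measure (HeightFn d k))
      = ((1 - t : ℝ) : EReal) * specificFreeEnergy (Ψ + Ξ) (μ : Measure (HeightFn d k))
        + (t : EReal) * specificFreeEnergy (Ψ + Ξ) (ν : Measure (HeightFn d k)) := by
  have hρL := mixture_mem_invariantMeasures h0.le h1.le hμL hνL
  have h1' : 0 < 1 - t := by linarith
  have hμb := h.specificFreeEnergy_ne_bot hμL
  have hνb := h.specificFreeEnergy_ne_bot hνL
  by_cases hμ : IsConstrained A q (μ : Measure (HeightFn d k))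
  swap
  · rw [h.specificFreeEnergy_eq_top hρL fun hc => hμ ((isConstrained_mixture_iff h0 h1).1 hc).1,
      h.specificFreeEnergy_eq_top hμL hμ, EReal.coe_mul_top_of_pos h1',
      EReal.top_add_of_ne_bot (EReal_mul_ne_bot h0 hνb)]
  by_cases hν : IsConstrained A q (ν : Measure (HeightFn d k))
  swap
  · rw [h.specificFreeEnergy_eq_top hρL fun hc => hν ((isConstrained_mixture_iff h0 h1).1 hc).2,
      h.specificFreeEnergy_eq_top hνL hν, EReal.coe_mul_top_of_pos h0,
      EReal.add_top_of_ne_bot (EReal_mul_ne_bot h1' hμb)]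
  have hρ := (isConstrained_mixture_iff (A := A) (q := q) h0 h1).2 ⟨hμ, hν⟩
  have hμt := h.tendsto_normalizedFreeEnergy hμL
  have hνt := h.tendsto_normalizedFreeEnergy hνL
  have hρt := h.tendsto_normalizedFreeEnergy hρL
  refine le_antisymm ?_ ?_
  · generalize specificFreeEnergy (Ψ + Ξ) (μ : Measure (HeightFn d k)) = x at hμb hμt ⊢
    generalize specificFreeEnergy (Ψ + Ξ) (ν : Measure (HeightFn d k)) = y at hνb hνt ⊢
    induction x with
    | bot => exact absurd rfl hμb
    | top =>
      rw [EReal.coe_mul_top_of_pos h1', EReal.top_add_of_ne_bot (EReal_mul_ne_bot h0 hνb)]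
      exact le_top
    | coe x =>
      induction y with
      | bot => exact absurd rfl hνb
      | top =>
        rw [EReal.coe_mul_top_of_pos h0, EReal.add_top_of_ne_bot (EReal_mul_ne_bot h1' hμb)]
        exact le_top
      | coe y =>
        rw [← EReal.coe_mul, ← EReal.coe_mul, ← EReal.coe_add]
        refine EReal.le_of_forall_lt_iff_le.1 fun w hw => le_of_tendsto hρt ?_
        rw [EReal.coe_lt_coe_iff] at hw
        set δ := w - ((1 - t) * x + t * y)
        filter_upwards [hμt.eventually_lt_const
            (show (x : EReal) < ((x + δ : ℝ) : EReal) from EReal.coe_lt_coe_iff.2 (by linarith)),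
          hνt.eventually_lt_const
            (show (y : EReal) < ((y + δ : ℝ) : EReal) from EReal.coe_lt_coe_iff.2 (by linarith)),
          eventually_gt_atTop 0] with n hn1 hn2 hn0
        have e1 := (h.normalizedFreeEnergy_le_iff hμ hn0 _).1 hn1.le
        have e2 := (h.normalizedFreeEnergy_le_iff hν hn0 _).1 hn2.le
        refine (h.normalizedFreeEnergy_le_iff hρ hn0 _).2 ?_
        convert e1.mixture_of h0.le h1.le e2 using 1
        simp only [δ]
        ring
  · by_contra hlt
    obtain ⟨w, hw1, hw2⟩ := EReal.lt_iff_exists_real_btwn.1 (not_le.1 hlt)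
    obtain ⟨a, b, ha, hb, hab⟩ := exists_lt_lt_of_lt_combination h1' h0 hμb hνb hw2
    have hlarge : ∀ᶠ n : ℕ in atTop,
        Real.log 2 < ((1 - t) * a + t * b - w) * (n : ℝ) ^ d :=
      (Tendsto.const_mul_atTop (by linarith) ((tendsto_pow_atTop h.dim_pos.ne').comp
        tendsto_natCast_atTop_atTop)).eventually_gt_atTop _
    obtain ⟨n, hn1, hn2, hn3, hn4, hn0⟩ := ((hμt.eventually_const_lt ha).and
      ((hνt.eventually_const_lt hb).and ((hρt.eventually_lt_const hw1).and
        (hlarge.and (eventually_gt_atTop 0))))).exists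
    have e1 := mt (h.normalizedFreeEnergy_le_iff hμ hn0 _).2 (not_le.2 hn1)
    have e2 := mt (h.normalizedFreeEnergy_le_iff hν hn0 _).2 (not_le.2 hn2)
    have e3 := (h.normalizedFreeEnergy_le_iff hρ hn0 _).1 hn3.le
    have e4 := FreeEnergyBound.le_add_log_two h0.le h1.le e1 e2 e3
    linarith

end IsInteraction

/-! ## Continuous cylinder functions -/

theorem isUniformlyTopContinuous_of_continuous {f : HeightFn d k → ℝ}
    (hf : Continuous fun ψ : Site d → k.E => f ψ) : IsUniformlyTopContinuous f :=
  hf.comp (UniformFun.uniformContinuous_toFun (α := Site d) (β := k.E)).continuous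

/-- Setting heights to zero outside `Λ` does not change `f`, and this map is continuous from the
product topology to the uniform one because only finitely many coordinates remain. -/
theorem IsUniformlyTopContinuous.continuous {f : HeightFn d k → ℝ} {Λ : Finset (Site d)}
    (hf : IsUniformlyTopContinuous f) (hm : Measurable[gradAlgOn d k (Λ : Set (Site d))] f) :
    Continuous fun ψ : Site d → k.E => f ψ := by
  classical
  let c : (Site d → k.E) → UniformFun (Site d) k.E := fun ψ =>
    UniformFun.ofFun fun y => if y ∈ Λ then ψ y else 0
  have hc : Continuous c := by
    rw [continuous_iff_continuousAt]
    intro ψ₀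
    refine (UniformFun.tendsto_iff_tendstoUniformly).2 ?_
    intro u hu
    have h1 : ∀ᶠ ψ in 𝓝 ψ₀, ∀ y ∈ Λ, (ψ₀ y, ψ y) ∈ u := by
      rw [Filter.eventually_all_finset]
      intro y _
      exact (continuous_apply y).continuousAt.eventually (mem_nhds_left (ψ₀ y) hu)
    filter_upwards [h1] with ψ hψ y
    by_cases hy : y ∈ Λ
    · simpa [c, hy] using hψ y hy
    · simpa [c, hy] using refl_mem_uniformity hu
  have := Continuous.comp hf hc
  refine this.congr fun ψ => ?_
  refine eq_of_measurable_gradAlgOn hm fun x hx y hy => ?_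
  have e : ∀ z ∈ Λ, UniformFun.toFun (c ψ) z = ψ z := fun z hz => if_pos hz
  rw [e x hx, e y hy]

theorem continuous_integral_weakLocalTopology {f : HeightFn d k → ℝ} (hf : IsBoundedCylinder f)
    (hc : IsUniformlyTopContinuous f) :
    Continuous[weakLocalTopology d k, _] fun μ : ProbabilityMeasure (HeightFn d k) =>
      ∫ φ, f φ ∂(μ : Measure (HeightFn d k)) :=
  continuous_iInf_dom (i := f) (continuous_iInf_dom (i := ⟨hf, hc⟩) continuous_induced_dom)

theorem localTopology_le_weakLocalTopology : localTopology d k ≤ weakLocalTopology d k :=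
  le_iInf₂ fun f hf => iInf₂_le f hf.1

theorem IsBoundedCylinder.measurable {f : HeightFn d k → ℝ} (hf : IsBoundedCylinder f) :
    Measurable f := by
  obtain ⟨⟨Λ, hΛ⟩, -⟩ := hf
  exact hΛ.mono (gradAlgOn_le _) le_rfl

/-! ## Approximation by continuous cylinder functions -/

/-- The height differences with the vertex `x`. -/
def increments (Λ : Finset (Site d)) (x : Site d) (φ : HeightFn d k)
    (y : {y // y ∈ Λ.erase x}) : k.E := φ y - φ x

theorem measurable_increments {Λ : Finset (Site d)} {x : Site d} (hx : x ∈ Λ) :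
    @Measurable _ _ (gradAlgOn d k (Λ : Set (Site d))) MeasurableSpace.pi
      (increments (k := k) Λ x) :=
  @measurable_pi_lambda _ _ _ (gradAlgOn d k (Λ : Set (Site d))) _ _ fun y =>
    measurable_sub_gradAlgOn (Finset.mem_coe.2 hx)
      (Finset.mem_coe.2 (Finset.mem_of_mem_erase y.2))

theorem continuous_increments (Λ : Finset (Site d)) (x : Site d) :
    Continuous fun ψ : Site d → k.E => increments (k := k) Λ x ψ :=
  continuous_pi fun y => (continuous_apply (y : Site d)).sub (continuous_apply x)

theorem extendByZero_increments {Λ : Finset (Site d)} {x : Site d} {f : HeightFn d k → ℝ}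
    (hf : Measurable[gradAlgOn d k (Λ : Set (Site d))] f) (φ : HeightFn d k) :
    f (extendByZero Λ x (increments Λ x φ)) = f φ := by
  refine eq_of_measurable_gradAlgOn hf fun y hy z hz => ?_
  have e : ∀ y ∈ Λ, extendByZero Λ x (increments Λ x φ) y = φ y - φ x := by
    intro y hy
    by_cases h : y = x
    · subst h; simp [extendByZero]
    · have : y ∈ Λ.erase x := Finset.mem_erase.2 ⟨h, hy⟩
      simp [extendByZero, this, increments]
  rw [e y hy, e z hz]
  abel

theorem increments_extendByZero (Λ : Finset (Site d)) (x : Site d)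
    (ψ : {y // y ∈ Λ.erase x} → k.E) : increments Λ x (extendByZero Λ x ψ) = ψ := by
  funext y
  have h := y.2
  simp [increments, extendByZero]

theorem refIntegral_eq_lintegral_pi {Λ : Finset (Site d)} {x : Site d} (hx : x ∈ Λ)
    {f : HeightFn d k → ℝ≥0∞} (hf : Measurable[gradAlgOn d k (Λ : Set (Site d))] f) :
    refIntegral Λ f = ∫⁻ ψ, f (extendByZero Λ x ψ)
      ∂(Measure.pi fun _ : {y // y ∈ Λ.erase x} => k.refMeasure) :=
  refIntegral_eq_heightIntegral hf hx 0

theorem measurable_abs_sub {X : Type*} [MeasurableSpace X] {f g : X → ℝ}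
    (hf : Measurable f) (hg : Measurable g) : Measurable fun x => |f x - g x| :=
  measurable_norm.comp (hf.sub hg)

theorem measurable_ofReal_abs_sub {X : Type*} [MeasurableSpace X] {f g : X → ℝ}
    (hf : Measurable f) (hg : Measurable g) : Measurable fun x => ENNReal.ofReal |f x - g x| :=
  (measurable_abs_sub hf hg).ennreal_ofReal

/-- Approximation of a bounded cylinder function by continuous ones, simultaneously for `μ` and for
the reference measure with a weight. -/
theorem exists_continuous_approximation {Λ : Finset (Site d)} {x : Site d} (hx : x ∈ Λ)
    (μ : Measure (HeightFn d k)) [IsProbabilityMeasure μ] {w : HeightFn d k → ℝ≥0∞}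
    (hw : Measurable[gradAlgOn d k (Λ : Set (Site d))] w) (hfin : refIntegral Λ w ≠ ⊤)
    {f : HeightFn d k → ℝ} (hf : Measurable[gradAlgOn d k (Λ : Set (Site d))] f) {B : ℝ}
    (hB : ∀ φ, |f φ| ≤ B) {δ : ℝ} (hδ : 0 < δ) :
    ∃ g : HeightFn d k → ℝ, Measurable[gradAlgOn d k (Λ : Set (Site d))] g ∧
      (∀ φ, |g φ| ≤ B) ∧ (Continuous fun ψ : Site d → k.E => g ψ) ∧
      ∫⁻ φ, ENNReal.ofReal |f φ - g φ| ∂μ ≤ ENNReal.ofReal δ ∧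
      refIntegral Λ (fun φ => w φ * ENNReal.ofReal |f φ - g φ|) ≤ ENNReal.ofReal δ := by
  have hincr : Measurable (increments (k := k) Λ x) :=
    (measurable_increments hx).mono (gradAlgOn_le _) le_rfl
  have hext := measurable_extendByZero (k := k) Λ x
  have hB0 : 0 ≤ B := (abs_nonneg _).trans (hB fun _ => 0)
  let F : ({y // y ∈ Λ.erase x} → k.E) → ℝ := fun ψ => f (extendByZero Λ x ψ)
  have hF : Measurable F := hf.comp hext
  let W : ({y // y ∈ Λ.erase x} → k.E) → ℝ≥0∞ := fun ψ => w (extendByZero Λ x ψ)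
  have hW : Measurable W := hw.comp hext
  -- Both measures are transported to the finite-dimensional space of increments. Density of bounded
  -- continuous functions in L¹ of the sum `ρ₁ + ρ₂` then gives one approximation good for both.
  let ρ₁ : Measure ({y // y ∈ Λ.erase x} → k.E) := Measure.map (increments Λ x) μ
  let ρ₂ : Measure ({y // y ∈ Λ.erase x} → k.E) :=
    (Measure.pi fun _ => k.refMeasure).withDensity W
  have : IsFiniteMeasure ρ₂ := by
    refine isFiniteMeasure_withDensity ?_
    rwa [refIntegral_eq_lintegral_pi hx hw] at hfin
  have : IsProbabilityMeasure ρ₁ := Measure.isProbabilityMeasure_map hincr.aemeasurable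
  have hFi : Integrable F (ρ₁ + ρ₂) := integrable_of_abs_le hF fun ψ => hB _
  obtain ⟨G, hG, -⟩ := hFi.exists_boundedContinuous_lintegral_sub_le
    (ε := δ.toNNReal) (by simpa using hδ)
  -- Clipping keeps the bound `B`, and it only brings the approximation closer to `F`, which already
  -- lies in `[-B, B]`.
  let G' : ({y // y ∈ Λ.erase x} → k.E) → ℝ := fun ψ => max (-B) (min B (G ψ))
  have hG' : Continuous G' := continuous_const.max (continuous_const.min G.continuous)
  have hFG : ∀ ψ, ENNReal.ofReal |F ψ - G' ψ| ≤ ‖F ψ - G ψ‖ₑ := by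
    intro ψ
    rw [← ofReal_norm, Real.norm_eq_abs]
    refine ENNReal.ofReal_le_ofReal ?_
    have h1 := abs_le.1 (hB (extendByZero Λ x ψ))
    have e : F ψ = max (-B) (min B (F ψ)) := by
      rw [min_eq_right h1.2, max_eq_right h1.1]
    rw [e]
    refine (abs_max_sub_max_le_max _ _ _ _).trans (max_le (by simp) ?_)
    refine (abs_min_sub_min_le_max _ _ _ _).trans ?_
    rw [← e]
    simp
  have hle : ∫⁻ ψ, ENNReal.ofReal |F ψ - G' ψ| ∂(ρ₁ + ρ₂) ≤ ENNReal.ofReal δ :=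
    (lintegral_mono hFG).trans hG
  have hd : Measurable fun ψ => ENNReal.ofReal |F ψ - G' ψ| :=
    (hF.sub hG'.measurable).abs.ennreal_ofReal
  rw [lintegral_add_measure] at hle
  have hgm : Measurable[gradAlgOn d k (Λ : Set (Site d))] fun φ => G' (increments Λ x φ) :=
    hG'.measurable.comp (measurable_increments hx)
  refine ⟨fun φ => G' (increments Λ x φ), hgm, fun φ => abs_le.2 ⟨le_max_left _ _, ?_⟩,
    hG'.comp (continuous_increments Λ x), ?_, ?_⟩
  · exact max_le (by linarith) (min_le_left _ _)
  · refine le_trans (le_of_eq ?_) ((self_le_add_right _ _).trans hle)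
    rw [lintegral_map hd hincr]
    refine lintegral_congr fun φ => ?_
    simp only [F, extendByZero_increments hf]
  · refine le_trans (le_of_eq ?_) ((self_le_add_left _ _).trans hle)
    have h1 : Measurable[gradAlgOn d k (Λ : Set (Site d))] fun φ =>
        ENNReal.ofReal |f φ - G' (increments Λ x φ)| := 
      @measurable_ofReal_abs_sub _ (gradAlgOn d k (Λ : Set (Site d))) _ _ hf hgm
    refine (refIntegral_eq_lintegral_pi hx (hw.mul h1)).trans ?_
    rw [lintegral_withDensity_eq_lintegral_mul _ hW hd]
    refine lintegral_congr fun ψ => ?_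
    simp only [Pi.mul_apply, F, W, increments_extendByZero]

/-! ## Lower semicontinuity -/

/-- From `exp v = exp u * exp (v - u) ≥ exp u * (1 - |v - u|)`. Only `u` needs a bound. -/
theorem exp_le_exp_add_mul_abs_sub {u v B : ℝ} (hu : |u| ≤ B) :
    Real.exp u ≤ Real.exp v + Real.exp B * |v - u| := by
  have h1 := Real.add_one_le_exp (v - u)
  have h2 : Real.exp v = Real.exp u * Real.exp (v - u) := by rw [← Real.exp_add]; congr 1; ring
  have h3 : Real.exp u ≤ Real.exp B := Real.exp_le_exp.2 ((le_abs_self u).trans hu)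
  have h4 := neg_abs_le (v - u)
  have h5 : Real.exp u * |v - u| ≤ Real.exp B * |v - u| :=
    mul_le_mul_of_nonneg_right h3 (abs_nonneg _)
  have h6 : Real.exp u * (1 - |v - u|) ≤ Real.exp v := by
    rw [h2]
    exact mul_le_mul_of_nonneg_left (by linarith) (Real.exp_pos _).le
  linarith

theorem refIntegral_exp_le {Λ : Finset (Site d)} {w : HeightFn d k → ℝ≥0∞}
    (hw : Measurable[gradAlgOn d k (Λ : Set (Site d))] w)
    {f g : HeightFn d k → ℝ} (hf : Measurable[gradAlgOn d k (Λ : Set (Site d))] f)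
    (hg : Measurable[gradAlgOn d k (Λ : Set (Site d))] g) {B : ℝ} (hB : ∀ φ, |g φ| ≤ B) :
    refIntegral Λ (fun φ => w φ * ENNReal.ofReal (Real.exp (g φ)))
      ≤ refIntegral Λ (fun φ => w φ * ENNReal.ofReal (Real.exp (f φ)))
        + ENNReal.ofReal (Real.exp B) * refIntegral Λ (fun φ => w φ * ENNReal.ofReal |f φ - g φ|) := by
  have hfg : Measurable[gradAlgOn d k (Λ : Set (Site d))] fun φ => ENNReal.ofReal |f φ - g φ| :=
    @measurable_ofReal_abs_sub _ (gradAlgOn d k (Λ : Set (Site d))) _ _ hf hg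
  have hef : Measurable[gradAlgOn d k (Λ : Set (Site d))] fun φ =>
    w φ * ENNReal.ofReal (Real.exp (f φ)) :=
    hw.mul (ENNReal.measurable_ofReal.comp (Real.measurable_exp.comp hf))
  refine le_trans ?_ (add_le_add_right (refIntegral_const_mul _ (hw.mul hfg)).le _)
  refine le_trans ?_ (@lintegral_add_left _ (gradAlgOn d k (Λ : Set (Site d)))
    (gradRefMeasure k Λ) _ hef _).le
  refine refIntegral_mono fun φ => ?_
  simp only [Pi.mul_apply]
  rw [mul_left_comm, ← mul_add, ← ENNReal.ofReal_mul (Real.exp_pos _).le,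
    ← ENNReal.ofReal_add (Real.exp_pos _).le (by positivity)]
  exact mul_le_mul_right (ENNReal.ofReal_le_ofReal (exp_le_exp_add_mul_abs_sub (hB φ))) _

theorem abs_integral_sub_le {X : Type*} [MeasurableSpace X] {μ : Measure X} [IsFiniteMeasure μ]
    {f g : X → ℝ} (hf : Measurable f) (hg : Measurable g) {B δ : ℝ} (hfB : ∀ x, |f x| ≤ B)
    (hgB : ∀ x, |g x| ≤ B) (hδ : 0 ≤ δ)
    (h : ∫⁻ x, ENNReal.ofReal |f x - g x| ∂μ ≤ ENNReal.ofReal δ) :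
    |∫ x, f x ∂μ - ∫ x, g x ∂μ| ≤ δ := by
  rw [← integral_sub (integrable_of_abs_le hf hfB) (integrable_of_abs_le hg hgB)]
  refine (abs_integral_le_integral_abs).trans ?_
  refine (integral_eq_lintegral_of_nonneg_ae (ae_of_all _ fun _ => abs_nonneg _)
    (measurable_norm.comp (hf.sub hg)).aestronglyMeasurable).trans_le ?_
  exact ENNReal.toReal_le_of_le_ofReal hδ h

/-- Failure is a strict inequality for some `f`, and it survives replacing `f` by a continuous `g`
close to it in L¹ for both `μ` and the weight. For fixed `g` only the mean under the measure varies,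
and that is weakly locally continuous. -/
theorem eventually_not_freeEnergyBound {Φ : GradientPotential d k} {K : ℝ} {Λ : Finset (Site d)}
    (hΛ : Λ.Nonempty) (hfin : refIntegral Λ (lipWeight Φ K Λ) ≠ ⊤)
    {μ : ProbabilityMeasure (HeightFn d k)} {a : ℝ}
    (h : ¬FreeEnergyBound Φ K Λ (μ : Measure (HeightFn d k)) a) :
    ∀ᶠ ν : ProbabilityMeasure (HeightFn d k) in @nhds _ (weakLocalTopology d k) μ,
      ¬FreeEnergyBound Φ K Λ (ν : Measure (HeightFn d k)) a := by
  rw [FreeEnergyBound] at h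
  push Not at h
  obtain ⟨f, hf, ⟨B, hB⟩, hlt⟩ := h
  obtain ⟨x, hx⟩ := hΛ
  set I := refIntegral Λ fun φ => lipWeight Φ K Λ φ * ENNReal.ofReal (Real.exp (f φ)) with hI
  set m := ∫ φ, f φ ∂(μ : Measure (HeightFn d k)) with hm
  have hcont : Tendsto (fun δ : ℝ => I + ENNReal.ofReal (Real.exp B) * ENNReal.ofReal δ)
      (𝓝[>] 0) (𝓝 (I + ENNReal.ofReal (Real.exp B) * ENNReal.ofReal 0)) := by
    refine (Tendsto.const_add I (ENNReal.Tendsto.const_mul ?_ (Or.inr ENNReal.ofReal_ne_top)))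
    exact (ENNReal.continuous_ofReal.tendsto 0).mono_left nhdsWithin_le_nhds
  have hcont' : Tendsto (fun δ : ℝ => ENNReal.ofReal (Real.exp (m - δ - a)))
      (𝓝[>] 0) (𝓝 (ENNReal.ofReal (Real.exp (m - 0 - a)))) := by
    refine (Continuous.tendsto ?_ 0).mono_left nhdsWithin_le_nhds
    exact ENNReal.continuous_ofReal.comp (by fun_prop)
  have hev := hcont.eventually_lt hcont' (by simpa using hlt)
  obtain ⟨δ, hδ, hδ0⟩ := (hev.and self_mem_nhdsWithin).exists
  have hδ0 : 0 < δ := hδ0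
  obtain ⟨g, hg, hgB, hgc, h1, h2⟩ := exists_continuous_approximation hx
    (μ : Measure (HeightFn d k)) (measurable_lipWeight Φ K Λ) hfin hf hB hδ0
  have h3 := abs_integral_sub_le (hf.mono (gradAlgOn_le _) le_rfl)
    (hg.mono (gradAlgOn_le _) le_rfl) hB hgB hδ0.le h1
  have h4 : refIntegral Λ (fun φ => lipWeight Φ K Λ φ * ENNReal.ofReal (Real.exp (g φ)))
      < ENNReal.ofReal (Real.exp (∫ φ, g φ ∂(μ : Measure (HeightFn d k)) - a)) := by
    refine ((refIntegral_exp_le (measurable_lipWeight Φ K Λ) hf hg hgB).trans ?_).trans_lt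
      (hδ.trans_le (ENNReal.ofReal_le_ofReal (Real.exp_le_exp.2 ?_)))
    · exact add_le_add_right (mul_le_mul_right h2 _) _
    · have := (abs_le.1 h3).2
      linarith
  have hgt := @Continuous.tendsto _ _ (weakLocalTopology d k) _ _
    (continuous_integral_weakLocalTopology (f := g) ⟨⟨Λ, hg⟩, B, hgB⟩
      (isUniformlyTopContinuous_of_continuous hgc)) μ
  have hgt' := (ENNReal.continuous_ofReal.tendsto _).comp
    ((Real.continuous_exp.tendsto _).comp (hgt.sub_const a))
  filter_upwards [hgt'.eventually_const_lt h4] with ν hν hbound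
  exact absurd (hbound g hg ⟨B, hgB⟩) (not_le.2 hν)

/-- A continuous cylinder function detecting violations of the constraint. -/
def violation (k : HeightKind) (q : Site d → Site d → ℝ) (x y : Site d) (φ : HeightFn d k) : ℝ :=
  min 1 (max 0 (k.toReal (φ y - φ x) - q x y))

theorem continuous_violation (q : Site d → Site d → ℝ) (x y : Site d) :
    Continuous fun ψ : Site d → k.E => violation k q x y ψ :=
  continuous_const.min (continuous_const.max
    ((k.continuous_toReal.comp ((continuous_apply y).sub (continuous_apply x))).sub
      continuous_const))

theorem violation_nonneg (q : Site d → Site d → ℝ) (x y : Site d) (φ : HeightFn d k) :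
    0 ≤ violation k q x y φ := le_min zero_le_one (le_max_left _ _)

theorem isBoundedCylinder_violation (q : Site d → Site d → ℝ) (x y : Site d) :
    IsBoundedCylinder (violation k q x y) := by
  refine ⟨⟨{x, y}, ?_⟩, 1, fun φ => abs_le.2
    ⟨by linarith [violation_nonneg q x y φ], min_le_left _ _⟩⟩
  exact (((measurable_const.min (measurable_const.max measurable_id)).comp
    (measurable_id.sub_const (q x y))).comp k.measurable_toReal).comp
      (measurable_sub_gradAlgOn (by simp) (by simp))

theorem integral_violation_eq_zero_iff (q : Site d → Site d → ℝ) (x y : Site d)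
    (μ : Measure (HeightFn d k)) [IsProbabilityMeasure μ] :
    ∫ φ, violation k q x y φ ∂μ = 0 ↔ μ (violationSet k q x y) = 0 := by
  obtain ⟨-, B, hB⟩ := isBoundedCylinder_violation (k := k) q x y
  rw [integral_eq_zero_iff_of_nonneg (fun φ => violation_nonneg q x y φ)
    (integrable_of_abs_le (isBoundedCylinder_violation q x y).measurable hB)]
  rw [Filter.EventuallyEq, ae_iff]
  refine iff_of_eq (congrArg (fun s => μ s = 0) ?_)
  ext φ
  simp only [violation, violationSet, Pi.zero_apply, Set.mem_ofPred_eq, k.toReal_sub]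
  rw [not_iff_comm, not_lt]
  constructor
  · intro h
    rw [max_eq_left (by linarith), min_eq_right zero_le_one]
  · intro h
    by_contra hlt
    push Not at hlt
    rw [max_eq_right (by linarith)] at h
    rcases min_choice 1 (k.toReal (φ y) - k.toReal (φ x) - q x y) with h' | h' <;> linarith

/-- An edge is violated with positive probability exactly when the integral of a continuous cylinder
function is nonzero, an open condition. -/
theorem eventually_not_isConstrained {A : SimpleGraph (Site d)} {q : Site d → Site d → ℝ}
    {μ : ProbabilityMeasure (HeightFn d k)} (h : ¬IsConstrained A q (μ : Measure (HeightFn d k))) :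
    ∀ᶠ ν in @nhds _ (weakLocalTopology d k) μ,
      ¬IsConstrained A q ((ν : ProbabilityMeasure (HeightFn d k)) : Measure (HeightFn d k)) := by
  rw [IsConstrained] at h
  push Not at h
  obtain ⟨x, y, hxy, hne⟩ := h
  rw [Ne, ← integral_violation_eq_zero_iff] at hne
  have hc := @Continuous.tendsto _ _ (weakLocalTopology d k) _ _
    (continuous_integral_weakLocalTopology (isBoundedCylinder_violation (k := k) q x y)
      (isUniformlyTopContinuous_of_continuous (continuous_violation q x y))) μ
  filter_upwards [hc.eventually_ne hne] with ν hν hcon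
  exact hν ((integral_violation_eq_zero_iff q x y _).2 (hcon x y hxy))

namespace IsInteraction

variable {L : AddSubgroup (Site d)} {Ψ Ξ : GradientPotential d k}
  {A : SimpleGraph (Site d)} {q : Site d → Site d → ℝ} {K : ℝ} {N : ℕ}

/-- A large specific free energy is detected by a failing bound in a single box, and this failure
persists nearby. The same finite-volume bound, with error independent of the measure, then keeps the
specific free energy of the neighbours large. -/
theorem lowerSemicontinuousOn_weakLocalTopology (h : IsInteraction L Ψ Ξ A q K N) :
    @LowerSemicontinuousOn (ProbabilityMeasure (HeightFn d k)) EReal (weakLocalTopology d k) _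
      (fun μ => specificFreeEnergy (Ψ + Ξ) (μ : Measure (HeightFn d k)))
      (invariantMeasures k L) := by
  intro μ hμL c hc
  by_cases hμ : IsConstrained A q (μ : Measure (HeightFn d k))
  swap
  · filter_upwards [(eventually_not_isConstrained hμ).filter_mono
      (@nhdsWithin_le_nhds _ (weakLocalTopology d k) _ _), @self_mem_nhdsWithin _ (weakLocalTopology d k) _ _]
      with ν hν hνL
    rw [h.specificFreeEnergy_eq_top hνL hν]
    exact hc.trans_le le_top
  obtain ⟨a₁, hca, ha₁⟩ := EReal.lt_iff_exists_real_btwn.1 hc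
  obtain ⟨a₂, haa, ha₂⟩ := EReal.lt_iff_exists_real_btwn.1 ha₁
  rw [EReal.coe_lt_coe_iff] at haa
  set b := (a₁ + a₂) / 2 with hb
  obtain ⟨m, hm, hN, hmb⟩ : ∃ m, 0 < m ∧ N ∣ m ∧
      ¬FreeEnergyBound (Ψ + Ξ) K (box d m) (μ : Measure (HeightFn d k))
        (b * (m : ℝ) ^ d + boxCost Ξ K m) := by
    by_contra hno
    push Not at hno
    exact absurd (h.specificFreeEnergy_le_of_freeEnergyBound hμL hμ (show b < a₂ by linarith)
      fun m hm hN => hno m hm hN) (not_le.2 ha₂)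
  have hfin := ne_top_of_le_ne_top ENNReal.ofReal_ne_top
    (refIntegral_lipWeight_box_le h.nonneg h.totalNorm_ne_top K hm)
  filter_upwards [(eventually_not_freeEnergyBound ⟨0, zero_mem_box hm⟩ hfin hmb).filter_mono
      (@nhdsWithin_le_nhds _ (weakLocalTopology d k) _ _),
      @self_mem_nhdsWithin _ (weakLocalTopology d k) _ _] with ν hν hνL
  refine hca.trans_le (not_lt.1 fun hlt => hν ?_)
  have hνc : IsConstrained A q (ν : Measure (HeightFn d k)) := by
    by_contra hno
    rw [h.specificFreeEnergy_eq_top hνL hno] at hlt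
    exact not_top_lt hlt
  have hm0 : (0 : ℝ) < (m : ℝ) ^ d := by positivity
  -- This `ε` makes the bound derived from level `a₁` match the one at level `b` exactly, where it
  -- was seen to fail.
  refine (h.freeEnergyBound_of_specificFreeEnergy_lt hνL hνc hlt hm hN
    (ε := (b - a₁) * (m : ℝ) ^ d) (mul_pos (by linarith) hm0)).mono (le_of_eq ?_)
  ring

theorem lowerSemicontinuousOn_localTopology (h : IsInteraction L Ψ Ξ A q K N) :
    @LowerSemicontinuousOn (ProbabilityMeasure (HeightFn d k)) EReal (localTopology d k) _
      (fun μ => specificFreeEnergy (Ψ + Ξ) (μ : Measure (HeightFn d k)))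
      (invariantMeasures k L) := by
  intro μ hμL c hc
  exact inf_le_inf_right _ (nhds_mono localTopology_le_weakLocalTopology)
    (h.lowerSemicontinuousOn_weakLocalTopology μ hμL c hc)

end IsInteraction

/-! ## Comparison of the two topologies on the lower level sets -/

/-- Uniform absolute continuity: comparing `exp u` with `1` through `refIntegral_exp_le` turns a
small weighted integral of `u` into a bound on its mean depending on `μ` only through `a`. -/
theorem FreeEnergyBound.integral_le {Φ : GradientPotential d k} {K : ℝ} {Λ : Finset (Site d)}
    {μ : Measure (HeightFn d k)} {a : ℝ} (h : FreeEnergyBound Φ K Λ μ a) {R : ℝ} (hR : 0 ≤ R)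
    (hw : refIntegral Λ (lipWeight Φ K Λ) ≤ ENNReal.ofReal R) {u : HeightFn d k → ℝ}
    (hu : Measurable[gradAlgOn d k (Λ : Set (Site d))] u) (hu0 : ∀ φ, 0 ≤ u φ) {B δ : ℝ}
    (hB : ∀ φ, u φ ≤ B) (hδ : 0 ≤ δ)
    (hδu : refIntegral Λ (fun φ => lipWeight Φ K Λ φ * ENNReal.ofReal (u φ)) ≤ ENNReal.ofReal δ) :
    Real.exp (∫ φ, u φ ∂μ - a) ≤ R + Real.exp B * δ := by
  have hB' : ∀ φ, |u φ| ≤ B := fun φ => by rw [abs_of_nonneg (hu0 φ)]; exact hB φ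
  have h1 := (h u hu ⟨B, hB'⟩).trans (refIntegral_exp_le (measurable_lipWeight Φ K Λ)
    (f := fun _ => 0) measurable_const hu hB')
  simp only [Real.exp_zero, ENNReal.ofReal_one, mul_one, zero_sub, abs_neg, abs_of_nonneg (hu0 _)]
    at h1
  have h2 := h1.trans (add_le_add hw (mul_le_mul_right hδu _))
  rw [← ENNReal.ofReal_mul (Real.exp_pos _).le, ← ENNReal.ofReal_add hR (by positivity)] at h2
  exact (ENNReal.ofReal_le_ofReal_iff (by positivity)).1 h2

namespace IsInteraction

variable {L : AddSubgroup (Site d)} {Ψ Ξ : GradientPotential d k}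
  {A : SimpleGraph (Site d)} {q : Site d → Site d → ℝ} {K : ℝ} {N : ℕ}

theorem isConstrained_of_mem_lowerLevelSet (h : IsInteraction L Ψ Ξ A q K N) {C : ℝ}
    {μ : ProbabilityMeasure (HeightFn d k)} (hμ : μ ∈ lowerLevelSet L (Ψ + Ξ) C) :
    IsConstrained A q (μ : Measure (HeightFn d k)) := by
  by_contra hno
  have := hμ.2
  rw [h.specificFreeEnergy_eq_top hμ.1 hno] at this
  exact absurd (EReal.coe_lt_top C) (not_lt.2 this)

/-- On a lower level set, the integral of a bounded cylinder function is a uniform limit of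
integrals of continuous cylinder functions. -/
theorem exists_uniform_approximation (h : IsInteraction L Ψ Ξ A q K N) (C : ℝ)
    {f : HeightFn d k → ℝ} (hf : IsBoundedCylinder f) {ε : ℝ} (hε : 0 < ε) :
    ∃ g : HeightFn d k → ℝ, IsBoundedCylinder g ∧ IsUniformlyTopContinuous g ∧
      ∀ μ ∈ lowerLevelSet L (Ψ + Ξ) C,
        |∫ φ, f φ ∂(μ : Measure (HeightFn d k)) - ∫ φ, g φ ∂(μ : Measure (HeightFn d k))| ≤ ε := by
  have hfm := hf.measurable
  obtain ⟨⟨Λ, hΛ⟩, B, hB⟩ := hf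
  obtain ⟨l, hl, n₀, hn₀⟩ := h.exists_translate Λ
  set m := N * (n₀ + 1) with hmdef
  have hm : 0 < m := Nat.mul_pos h.period_pos n₀.succ_pos
  have hmn : n₀ ≤ m := n₀.le_succ.trans (Nat.le_mul_of_pos_left _ h.period_pos)
  set F : HeightFn d k → ℝ := fun φ => f (shift l φ) with hFdef
  have hF : Measurable[gradAlgOn d k (box d m : Set (Site d))] F := fun s hs =>
    gradAlgOn_mono (Finset.coe_subset.2 (hn₀ m hmn)) _ (measurable_shift_gradAlgOn l Λ (hΛ hs))
  have hFB : ∀ φ, |F φ| ≤ B := fun φ => hB _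
  set R := Real.exp (siteCost Ξ K * (m : ℝ) ^ d) with hRdef
  have hRw := refIntegral_lipWeight_box_le h.nonneg h.totalNorm_ne_top K hm
  set a := (C + 1) * (m : ℝ) ^ d + boxCost Ξ K m + 1 with hadef
  -- The multiplier `t` is large enough that `t * ∫ |F - g| ≤ a + log (R + 1)` implies the desired
  -- `ε`; the `δ` below makes the remaining term in `FreeEnergyBound.integral_le` equal to `1`.
  set t := max 1 ((a + Real.log (R + 1)) / ε) with htdef
  have ht : 0 < t := zero_lt_one.trans_le (le_max_left _ _)
  set δ := (Real.exp (t * (B + B)) * t)⁻¹ with hδdef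
  have hδ : 0 < δ := by positivity
  obtain ⟨g, hg, hgB, hgc, -, hgw⟩ := exists_continuous_approximation (zero_mem_box hm)
    (Measure.dirac (show HeightFn d k from fun _ => 0)) (measurable_lipWeight (Ψ + Ξ) K (box d m))
    (ne_top_of_le_ne_top ENNReal.ofReal_ne_top hRw) hF hFB hδ
  refine ⟨g, ⟨⟨_, hg⟩, B, hgB⟩, isUniformlyTopContinuous_of_continuous hgc, fun μ hμ => ?_⟩
  have hb := h.freeEnergyBound_of_specificFreeEnergy_lt hμ.1
    (h.isConstrained_of_mem_lowerLevelSet hμ)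
    (hμ.2.trans_lt (EReal.coe_lt_coe_iff.2 (lt_add_one C))) hm (Dvd.intro _ rfl) one_pos
  have hgF : Measurable[gradAlgOn d k (box d m : Set (Site d))] fun φ => |F φ - g φ| :=
@measurable_abs_sub _ (gradAlgOn d k (box d m : Set (Site d))) _ _ hF hg
  have key := hb.integral_le (Real.exp_pos _).le hRw (u := fun φ => t * |F φ - g φ|)
    (hgF.const_mul t) (fun φ => by positivity) (B := t * (B + B)) (δ := t * δ)
    (fun φ => mul_le_mul_of_nonneg_left ((abs_sub _ _).trans (add_le_add (hFB φ) (hgB φ))) ht.le)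
    (by positivity) ?_
  · rw [integral_const_mul] at key
    have e1 : Real.exp (t * (B + B)) * (t * δ) = 1 := by
      rw [← mul_assoc, hδdef, mul_inv_cancel₀ (by positivity)]
    rw [e1] at key
    have e2 := (Real.le_log_iff_exp_le (by positivity)).2 key
    have hint : |∫ φ, F φ ∂(μ : Measure (HeightFn d k)) - ∫ φ, g φ ∂(μ : Measure (HeightFn d k))|
        ≤ ∫ φ, |F φ - g φ| ∂(μ : Measure (HeightFn d k)) := by
      rw [← integral_sub (integrable_of_abs_le (hF.mono (gradAlgOn_le _) le_rfl) hFB)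
        (integrable_of_abs_le (hg.mono (gradAlgOn_le _) le_rfl) hgB)]
      exact abs_integral_le_integral_abs
    rw [integral_shift hμ.1 hl hfm] at hint
    refine hint.trans ?_
    refine le_of_mul_le_mul_left ?_ ht
    have e3 : (a + Real.log (R + 1)) / ε ≤ t := le_max_right _ _
    rw [div_le_iff₀ hε] at e3
    linarith
  · have e : ∀ φ, lipWeight (Ψ + Ξ) K (box d m) φ * ENNReal.ofReal (t * |F φ - g φ|)
        = ENNReal.ofReal t *
          (lipWeight (Ψ + Ξ) K (box d m) φ * ENNReal.ofReal |F φ - g φ|) := by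
      intro φ
      rw [ENNReal.ofReal_mul ht.le, mul_left_comm]
    simp only [e]
    refine (refIntegral_const_mul _ ?_).trans_le ?_
    · exact (measurable_lipWeight (Ψ + Ξ) K (box d m)).mul (ENNReal.measurable_ofReal.comp hgF)
    · rw [ENNReal.ofReal_mul ht.le]
      exact mul_le_mul_right hgw _

/-- On the level set the integral of each bounded cylinder function is a uniform limit of weakly
locally continuous functions, hence itself continuous there. -/
theorem subspaceTopology_eq (h : IsInteraction L Ψ Ξ A q K N) (C : ℝ) :
    subspaceTopology (localTopology d k) (lowerLevelSet L (Ψ + Ξ) C)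
      = subspaceTopology (weakLocalTopology d k) (lowerLevelSet L (Ψ + Ξ) C) := by
  refine le_antisymm (induced_mono (localTopology_le_weakLocalTopology (d := d) (k := k))) ?_
  let _ : TopologicalSpace (lowerLevelSet L (Ψ + Ξ) C) :=
    subspaceTopology (weakLocalTopology d k) (lowerLevelSet L (Ψ + Ξ) C)
  refine continuous_iff_le_induced.1 (continuous_iInf_rng.2 fun f => continuous_iInf_rng.2
    fun hf => continuous_induced_rng.2 ?_)
  refine continuous_of_uniform_approx_of_continuous fun u hu => ?_
  obtain ⟨ε, hε, hεu⟩ := Metric.mem_uniformity_dist.1 hu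
  obtain ⟨g, hg, hgc, hfg⟩ := h.exists_uniform_approximation C hf (half_pos hε)
  refine ⟨fun μ => ∫ φ, g φ ∂(μ.1 : Measure (HeightFn d k)),
    @Continuous.comp _ _ _ _ (weakLocalTopology d k) _ _ _
      (continuous_integral_weakLocalTopology hg hgc) continuous_induced_dom, fun μ => hεu ?_⟩
  rw [Real.dist_eq]
  exact (hfg μ.1 μ.2).trans_lt (half_lt_self hε)

end IsInteraction

/-! ## Gradient measures as laws of pinned height functions -/

/-- The height function pinned at the origin. -/
def pinned (φ : HeightFn d k) : Site d → k.E := fun y => φ y - φ 0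

theorem measurable_pinned : Measurable (pinned (d := d) (k := k)) :=
  measurable_pi_lambda _ fun y => measurable_sub_gradAlgOn (mem_univ 0) (mem_univ y)

/-- A configuration, regarded as a point of the space carrying the gradient `σ`-algebra. -/
def toHeightFn (ψ : Site d → k.E) : HeightFn d k := ψ

theorem measurable_toHeightFn : Measurable (toHeightFn (d := d) (k := k)) :=
  measurable_pi_of_gradAlgOn (k := k) (Λ := (univ : Set (Site d))) measurable_id

/-- The law of the height function pinned at the origin. -/
def pinnedLaw (μ : ProbabilityMeasure (HeightFn d k)) : ProbabilityMeasure (Site d → k.E) :=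
  μ.map measurable_pinned.aemeasurable

/-- The restriction of a law on configurations to the gradient `σ`-algebra. -/
def gradientLaw (P : ProbabilityMeasure (Site d → k.E)) : ProbabilityMeasure (HeightFn d k) :=
  P.map measurable_toHeightFn.aemeasurable

/-- Pinning changes a height function by a constant, which gradient events cannot see. -/
theorem gradientLaw_pinnedLaw (μ : ProbabilityMeasure (HeightFn d k)) :
    gradientLaw (pinnedLaw μ) = μ := by
  refine Subtype.ext (Measure.ext fun s hs => ?_)
  refine (Measure.map_apply measurable_toHeightFn hs).trans ?_
  refine (Measure.map_apply measurable_pinned (measurable_toHeightFn hs)).trans ?_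
  refine congrArg (μ : Measure (HeightFn d k)) ?_
  ext φ
  have hm : Measurable fun φ : HeightFn d k => φ ∈ s := measurable_mem.2 hs
  refine iff_of_eq (eq_of_measurable_gradAlgOn (f := fun φ : HeightFn d k => φ ∈ s)
    (φ := toHeightFn (pinned φ)) (ψ := φ) hm fun x _ y _ => ?_)
  simp [toHeightFn, pinned]

theorem pinnedLaw_gradientLaw {P : ProbabilityMeasure (Site d → k.E)}
    (hP : ∀ᵐ ψ ∂(P : Measure (Site d → k.E)), ψ 0 = 0) : pinnedLaw (gradientLaw P) = P := by
  refine Subtype.ext ?_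
  refine (Measure.map_map measurable_pinned measurable_toHeightFn).trans ?_
  refine (Measure.map_congr (g := id) ?_).trans Measure.map_id
  filter_upwards [hP] with ψ hψ
  funext y
  simp [pinned, toHeightFn, hψ]

theorem integral_gradientLaw {f : HeightFn d k → ℝ} (hf : Measurable f)
    (P : ProbabilityMeasure (Site d → k.E)) :
    ∫ φ, f φ ∂(gradientLaw P : Measure (HeightFn d k))
      = ∫ ψ, f (toHeightFn ψ) ∂(P : Measure (Site d → k.E)) :=
  integral_map measurable_toHeightFn.aemeasurable hf.aestronglyMeasurable

theorem continuous_integral_of_bounded {f : (Site d → k.E) → ℝ} (hf : Continuous f) {B : ℝ}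
    (hB : ∀ ψ, |f ψ| ≤ B) : Continuous fun P : ProbabilityMeasure (Site d → k.E) =>
      ∫ ψ, f ψ ∂(P : Measure (Site d → k.E)) :=
  continuous_iff_continuousAt.2 fun _ => (ProbabilityMeasure.tendsto_iff_forall_integral_tendsto.1
    tendsto_id) (BoundedContinuousFunction.ofNormedAddCommGroup f hf B hB)

/-- Each test function of the weak local topology is bounded and continuous for the product
topology, so it is a test function for weak convergence of laws. -/
theorem continuous_gradientLaw :
    Continuous[_, weakLocalTopology d k] (gradientLaw (d := d) (k := k)) := by
  refine continuous_iInf_rng.2 fun f => continuous_iInf_rng.2 fun hf =>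
    continuous_induced_rng.2 ?_
  have hm := hf.1.measurable
  obtain ⟨⟨⟨Λ, hΛ⟩, B, hB⟩, hc⟩ := hf
  exact (continuous_integral_of_bounded (hc.continuous hΛ) hB).congr fun P =>
    (integral_gradientLaw hm P).symm

/-! ## Continuous cylinder functions determine a gradient measure -/

/-- The height function pinned at the origin and set to zero outside `Λ`. -/
def pinnedOn (Λ : Finset (Site d)) (φ : HeightFn d k) : Site d → k.E :=
  open Classical in fun y => if y ∈ Λ then φ y - φ 0 else 0

theorem measurable_pinnedOn {Λ : Finset (Site d)} (h0 : 0 ∈ Λ) :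
    Measurable[gradAlgOn d k (Λ : Set (Site d)), MeasurableSpace.pi]
      (pinnedOn (d := d) (k := k) Λ) := by
  refine @measurable_pi_lambda _ _ _ (gradAlgOn d k (Λ : Set (Site d))) _ _ fun y => ?_
  by_cases hy : y ∈ Λ
  · simp only [pinnedOn, if_pos hy]
    exact measurable_sub_gradAlgOn (Finset.mem_coe.2 h0) (Finset.mem_coe.2 hy)
  · simp only [pinnedOn, if_neg hy]
    exact measurable_const

theorem continuous_pinnedOn (Λ : Finset (Site d)) :
    Continuous fun ψ : Site d → k.E => pinnedOn (d := d) (k := k) Λ ψ := by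
  refine continuous_pi fun y => ?_
  by_cases hy : y ∈ Λ
  · simp only [pinnedOn, if_pos hy]
    exact (continuous_apply y).sub (continuous_apply 0)
  · simp only [pinnedOn, if_neg hy]
    exact continuous_const

/-- The box `[-n, n]^d`. -/
def centeredBox (d n : ℕ) : Finset (Site d) :=
  Fintype.piFinset fun _ => Finset.Icc (-(n : ℤ)) n

theorem zero_mem_centeredBox (n : ℕ) : (0 : Site d) ∈ centeredBox d n :=
  Fintype.mem_piFinset.2 fun i => Finset.mem_Icc.2 (by simp)

theorem eventually_mem_centeredBox (y : Site d) : ∀ᶠ n in atTop, y ∈ centeredBox d n := by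
  filter_upwards [eventually_ge_atTop (∑ i, (y i).natAbs)] with n hn
  refine Fintype.mem_piFinset.2 fun i => ?_
  have := Finset.single_le_sum (f := fun i => (y i).natAbs) (fun _ _ => Nat.zero_le _)
    (Finset.mem_univ i)
  rw [Finset.mem_Icc]
  omega

theorem tendsto_pinnedOn (φ : HeightFn d k) :
    Tendsto (fun n => pinnedOn (centeredBox d n) φ) atTop (𝓝 (pinned φ)) := by
  refine tendsto_pi_nhds.2 fun y => tendsto_const_nhds.congr' ?_
  filter_upwards [eventually_mem_centeredBox y] with n hn
  simp [pinnedOn, pinned, hn]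

theorem isBoundedCylinder_comp_pinnedOn (h : BoundedContinuousFunction (Site d → k.E) ℝ) (n : ℕ) :
    IsBoundedCylinder fun φ : HeightFn d k => h (pinnedOn (centeredBox d n) φ) :=
  ⟨⟨_, h.continuous.measurable.comp (measurable_pinnedOn (zero_mem_centeredBox n))⟩, ‖h‖,
    fun _ => h.norm_coe_le_norm _⟩

/-- Two gradient measures coincide if they give the same integrals to continuous cylinder
functions. -/
theorem eq_of_forall_integral_eq {μ ν : ProbabilityMeasure (HeightFn d k)}
    (h : ∀ f : HeightFn d k → ℝ, IsBoundedCylinder f → IsUniformlyTopContinuous f →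
      ∫ φ, f φ ∂(μ : Measure (HeightFn d k)) = ∫ φ, f φ ∂(ν : Measure (HeightFn d k))) :
    μ = ν := by
  rw [← gradientLaw_pinnedLaw μ, ← gradientLaw_pinnedLaw ν]
  refine congrArg gradientLaw (Subtype.ext ?_)
  change (pinnedLaw μ : Measure (Site d → k.E)) = (pinnedLaw ν : Measure (Site d → k.E))
  refine ext_of_forall_integral_eq_of_IsFiniteMeasure fun g => ?_
  -- A bounded continuous `g` of the pinned configuration is the pointwise limit of continuous
  -- cylinder functions, obtained by zeroing heights outside growing boxes; dominated convergence
  -- applies.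
  have key : ∀ κ : ProbabilityMeasure (HeightFn d k),
      Tendsto (fun n => ∫ φ, g (pinnedOn (centeredBox d n) φ) ∂(κ : Measure (HeightFn d k))) atTop
        (𝓝 (∫ ψ, g ψ ∂(pinnedLaw κ : Measure (Site d → k.E)))) := by
    intro κ
    have e : ∫ ψ, g ψ ∂(pinnedLaw κ : Measure (Site d → k.E))
        = ∫ φ, g (pinned φ) ∂(κ : Measure (HeightFn d k)) :=
      integral_map measurable_pinned.aemeasurable g.continuous.aestronglyMeasurable
    rw [e]
    refine tendsto_integral_of_dominated_convergence (fun _ => ‖g‖)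
      (fun n => (isBoundedCylinder_comp_pinnedOn g n).measurable.aestronglyMeasurable)
      (integrable_const _) (fun n => ae_of_all _ fun φ => g.norm_coe_le_norm _)
      (ae_of_all _ fun φ => (g.continuous.tendsto _).comp (tendsto_pinnedOn φ))
  refine tendsto_nhds_unique (key μ) ((key ν).congr fun n => ?_)
  exact (h _ (isBoundedCylinder_comp_pinnedOn g n) (isUniformlyTopContinuous_of_continuous
    (g.continuous.comp (continuous_pinnedOn _)))).symm

theorem t2Space_weakLocalTopology :
    @T2Space (ProbabilityMeasure (HeightFn d k)) (weakLocalTopology d k) := by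
  let _ := weakLocalTopology d k
  refine ⟨fun μ ν hne => ?_⟩
  by_contra hno
  refine hne (eq_of_forall_integral_eq fun f hf hc => ?_)
  by_contra hne'
  refine hno ?_
  obtain ⟨u, v, hu, hv, hμu, hνv, huv⟩ := t2_separation hne'
  have hcont := continuous_integral_weakLocalTopology hf hc
  exact ⟨_, _, hu.preimage hcont, hv.preimage hcont, hμu, hνv, huv.preimage _⟩

theorem measurable_shift (l : Site d) : Measurable (shift (k := k) l) := by
  rw [measurable_iff_comap_le]
  simp only [HeightFn.instMeasurableSpace, gradAlgOn, MeasurableSpace.comap_iSup,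
    MeasurableSpace.comap_comp]
  refine iSup₂_le fun x _ => iSup₂_le fun y _ => ?_
  rw [← measurable_iff_comap_le]
  exact measurable_sub_gradAlgOn (mem_univ (x + l)) (mem_univ (y + l))

theorem IsBoundedCylinder.comp_shift {f : HeightFn d k → ℝ} (hf : IsBoundedCylinder f)
    (l : Site d) : IsBoundedCylinder fun φ => f (shift l φ) := by
  obtain ⟨⟨Λ, hΛ⟩, B, hB⟩ := hf
  exact ⟨⟨_, hΛ.comp (measurable_shift_gradAlgOn l Λ)⟩, B, fun φ => hB _⟩

theorem IsUniformlyTopContinuous.comp_shift {f : HeightFn d k → ℝ} (hf : IsBoundedCylinder f)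
    (hc : IsUniformlyTopContinuous f) (l : Site d) :
    IsUniformlyTopContinuous fun φ => f (shift l φ) := by
  obtain ⟨⟨Λ, hΛ⟩, -⟩ := hf
  refine isUniformlyTopContinuous_of_continuous ?_
  exact (hc.continuous hΛ).comp (f := fun ψ : Site d → k.E => fun y => ψ (y + l))
    (continuous_pi fun y => continuous_apply (y + l))

/-- Since continuous cylinder functions determine a gradient measure, invariance is a family of
equations between continuous functionals. -/
theorem isClosed_invariantMeasures (L : AddSubgroup (Site d)) :
    IsClosed[weakLocalTopology d k] (invariantMeasures k L) := by
  let _ := weakLocalTopology d k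
  have e : invariantMeasures k L = ⋂ l ∈ L, ⋂ (f : HeightFn d k → ℝ) (_ : IsBoundedCylinder f)
      (_ : IsUniformlyTopContinuous f),
      {μ : ProbabilityMeasure (HeightFn d k) | ∫ φ, f (shift l φ) ∂(μ : Measure (HeightFn d k))
        = ∫ φ, f φ ∂(μ : Measure (HeightFn d k))} := by
    ext μ
    simp only [mem_iInter]
    refine ⟨fun hμ l hl f hf _ => integral_shift hμ hl hf.measurable, fun hμ l hl => ?_⟩
    refine ⟨measurable_shift l, ?_⟩
    have := eq_of_forall_integral_eq (μ := μ.map (measurable_shift l).aemeasurable) (ν := μ)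
      fun f hf hc => (integral_map (measurable_shift l).aemeasurable
        hf.measurable.aestronglyMeasurable).trans (hμ l hl f hf hc)
    exact congrArg Subtype.val this
  rw [e]
  exact isClosed_biInter fun l _ => isClosed_iInter fun f => isClosed_iInter fun hf =>
    isClosed_iInter fun hc => isClosed_eq
      (continuous_integral_weakLocalTopology (hf.comp_shift l) (hc.comp_shift hf l))
      (continuous_integral_weakLocalTopology hf hc)

/-! ## Compactness of the lower level sets -/

theorem HeightKind.toReal_eq_zero_iff : (k : HeightKind) → {a : k.E} → k.toReal a = 0 ↔ a = 0
  | .int, a => Int.cast_eq_zero (α := ℝ) (n := a)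
  | .real, _ => Iff.rfl

/-- The laws on pinned configurations that correspond to the elements of a lower level set. -/
def pinnedLevelSet (L : AddSubgroup (Site d)) (Φ : GradientPotential d k) (C : ℝ) :
    Set (ProbabilityMeasure (Site d → k.E)) :=
  {P | (∀ᵐ ψ ∂(P : Measure (Site d → k.E)), ψ 0 = 0) ∧ gradientLaw P ∈ lowerLevelSet L Φ C}

/-- Being pinned amounts to the vanishing of the integral of the bounded continuous function `min 1
|ψ 0|`. -/
theorem isClosed_setOf_ae_zero : IsClosed {P : ProbabilityMeasure (Site d → k.E) |
    ∀ᵐ ψ ∂(P : Measure (Site d → k.E)), ψ 0 = 0} := by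
  have hc : Continuous fun ψ : Site d → k.E => min 1 |k.toReal (ψ 0)| :=
    continuous_const.min (k.continuous_toReal.comp (continuous_apply 0)).abs
  have h0 : ∀ ψ : Site d → k.E, 0 ≤ min 1 |k.toReal (ψ 0)| := fun ψ =>
    le_min zero_le_one (abs_nonneg _)
  have hB : ∀ ψ : Site d → k.E, |min 1 (|k.toReal (ψ 0)|)| ≤ 1 := fun ψ => by
    rw [abs_of_nonneg (h0 ψ)]; exact min_le_left _ _
  have e : {P : ProbabilityMeasure (Site d → k.E) |
      ∀ᵐ ψ ∂(P : Measure (Site d → k.E)), ψ 0 = 0}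
      = {P : ProbabilityMeasure (Site d → k.E) | ∫ ψ, min 1 |k.toReal (ψ 0)| ∂(P : Measure (Site d → k.E)) = 0} := by
    ext P
    refine Iff.symm ((integral_eq_zero_iff_of_nonneg h0
      (integrable_of_abs_le hc.measurable hB)).trans ?_)
    refine eventually_congr (ae_of_all _ fun ψ => ?_)
    simp only [Pi.zero_apply]
    rw [← k.toReal_eq_zero_iff]
    constructor
    · intro h
      rcases min_choice 1 |k.toReal (ψ 0)| with h' | h'
      · linarith
      · exact abs_eq_zero.1 (h'.symm.trans h)
    · intro h
      simp [h]
  rw [e]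
  exact isClosed_eq (continuous_integral_of_bounded hc hB) continuous_const

namespace IsInteraction

variable {L : AddSubgroup (Site d)} {Ψ Ξ : GradientPotential d k}
  {A : SimpleGraph (Site d)} {q : Site d → Site d → ℝ} {K : ℝ} {N : ℕ}

theorem isClosed_lowerLevelSet (h : IsInteraction L Ψ Ξ A q K N) (C : ℝ) :
    IsClosed[weakLocalTopology d k] (lowerLevelSet L (Ψ + Ξ) C) := by
  let _ := weakLocalTopology d k
  rw [← isOpen_compl_iff, isOpen_iff_mem_nhds]
  intro μ hμ
  by_cases hμL : μ ∈ invariantMeasures k L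
  · have hlt : (C : EReal) < specificFreeEnergy (Ψ + Ξ) (μ : Measure (HeightFn d k)) :=
      not_le.1 fun hle => hμ ⟨hμL, hle⟩
    have h1 := eventually_nhdsWithin_iff.1 (h.lowerSemicontinuousOn_weakLocalTopology μ hμL _ hlt)
    filter_upwards [h1] with ν hν hνC
    exact absurd hνC.2 (not_le.2 (hν hνC.1))
  · filter_upwards [(isClosed_invariantMeasures (k := k) L).isOpen_compl.mem_nhds hμL]
      with ν hν hνC
    exact hν hνC.1

theorem isClosed_pinnedLevelSet (h : IsInteraction L Ψ Ξ A q K N) (C : ℝ) :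
    IsClosed (pinnedLevelSet L (Ψ + Ξ) C) :=
  isClosed_setOf_ae_zero.inter (@IsClosed.preimage _ _ _ (weakLocalTopology d k) _
    continuous_gradientLaw _ (h.isClosed_lowerLevelSet C))

/-- The constraint and the pinning bound each height deterministically, so all these laws live on
one compact product. Tightness is then immediate, and closedness upgrades Prokhorov's relative
compactness. -/
theorem isCompact_pinnedLevelSet (h : IsInteraction L Ψ Ξ A q K N) (C : ℝ) :
    IsCompact (pinnedLevelSet L (Ψ + Ξ) C) := by
  rw [← (h.isClosed_pinnedLevelSet C).closure_eq]
  refine isCompact_closure_of_isTightMeasureSet ?_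
  rw [isTightMeasureSet_iff_exists_isCompact_measure_compl_le]
  intro ε _
  choose M hM using exists_increment_bound (k := k) h.connected q
  refine ⟨univ.pi fun y => {a | |k.toReal a| ≤ max (M 0 y) (M y 0)},
    isCompact_univ_pi fun y => k.isCompact_abs_toReal_le _, ?_⟩
  rintro _ ⟨P, hP, rfl⟩
  -- The complement of the compact product has measure zero, so a single compact set serves every
  -- `ε`.
  refine le_trans (le_of_eq ?_) (zero_le (a := ε))
  have h1 : ∀ᵐ ψ ∂(P : Measure (Site d → k.E)), SatisfiesConstraint A q (toHeightFn ψ) :=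
    ae_of_ae_map measurable_toHeightFn.aemeasurable
      (h.isConstrained_of_mem_lowerLevelSet hP.2).ae
  refine measure_eq_zero_iff_ae_notMem.2 ?_
  filter_upwards [h1, hP.1] with ψ hψ hψ0
  have hz : k.toReal (0 : k.E) = 0 := k.toReal_eq_zero_iff.2 rfl
  refine fun hn => hn fun y _ => ?_
  have h2 := hM 0 y _ hψ
  have h3 := hM y 0 _ hψ
  simp only [toHeightFn, hψ0, hz, sub_zero, zero_sub] at h2 h3
  exact abs_le.2 ⟨by linarith [le_max_right (M 0 y) (M y 0)], h2.trans (le_max_left _ _)⟩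

/-- Passing from pinned laws to gradient measures is a continuous bijection from a compact space
onto a Hausdorff space, hence a homeomorphism; the source is compact metrizable, so Polish. -/
theorem compactSpace_and_polishSpace (h : IsInteraction L Ψ Ξ A q K N) (C : ℝ) :
    @CompactSpace (lowerLevelSet L (Ψ + Ξ) C)
        (subspaceTopology (weakLocalTopology d k) (lowerLevelSet L (Ψ + Ξ) C)) ∧
      @PolishSpace (lowerLevelSet L (Ψ + Ξ) C)
        (subspaceTopology (weakLocalTopology d k) (lowerLevelSet L (Ψ + Ξ) C)) := by
  let _ := weakLocalTopology d k
  have : T2Space (ProbabilityMeasure (HeightFn d k)) := t2Space_weakLocalTopology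
  have : CompactSpace (pinnedLevelSet L (Ψ + Ξ) C) :=
    isCompact_iff_compactSpace.1 (h.isCompact_pinnedLevelSet C)
  have hz : ∀ μ : ProbabilityMeasure (HeightFn d k),
      ∀ᵐ ψ ∂(pinnedLaw μ : Measure (Site d → k.E)), ψ 0 = 0 := by
    intro μ
    have hs : MeasurableSet {ψ : Site d → k.E | ψ 0 = 0} :=
      measurable_pi_apply 0 (measurableSet_singleton 0)
    exact (ae_map_iff measurable_pinned.aemeasurable hs).2 (ae_of_all _ fun φ => sub_self (φ 0))
  let e : pinnedLevelSet L (Ψ + Ξ) C ≃ lowerLevelSet L (Ψ + Ξ) C :=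
    { toFun := fun P => ⟨gradientLaw P.1, P.2.2⟩
      invFun := fun μ => ⟨pinnedLaw μ.1, hz μ.1, by rw [gradientLaw_pinnedLaw]; exact μ.2⟩
      left_inv := fun P => Subtype.ext (pinnedLaw_gradientLaw P.2.1)
      right_inv := fun μ => Subtype.ext (gradientLaw_pinnedLaw μ.1) }
  have he : Continuous e := (continuous_gradientLaw.comp continuous_subtype_val).subtype_mk _
  let E := he.homeoOfEquivCompactToT2
  have hc : CompactSpace (lowerLevelSet L (Ψ + Ξ) C) := E.compactSpace
  have : PolishSpace (pinnedLevelSet L (Ψ + Ξ) C) := by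
    let _ := TopologicalSpace.metrizableSpaceMetric (pinnedLevelSet L (Ψ + Ξ) C)
    infer_instance
  exact ⟨hc, E.symm.isClosedEmbedding.polishSpace⟩

end IsInteraction

end GradientModel

end

/-! ### The main theorem. -/

theorem theorem4p1 (d : ℕ) (hd : 2 ≤ d) (k : HeightKind)
    (L : AddSubgroup (Site d)) (hL : L.FiniteIndex)
    (Φ : GradientPotential d k) (hΦ : Φ ∈ strongInteractions k L + weakInteractions k L) :
    -- the limit exists
    (∀ μ ∈ invariantMeasures k L,
      Tendsto (normalizedFreeEnergy Φ (μ : Measure (HeightFn d k))) atTop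
        (𝓝 (specificFreeEnergy Φ (μ : Measure (HeightFn d k))))) ∧
    -- it is bounded below, in particular it has values in `ℝ ∪ {∞}`
    (∃ c : ℝ, ∀ μ ∈ invariantMeasures k L,
      (c : EReal) ≤ specificFreeEnergy Φ (μ : Measure (HeightFn d k))) ∧
    -- it is affine
    (∀ μ ∈ invariantMeasures k L, ∀ ν ∈ invariantMeasures k L, ∀ t : ℝ, 0 ≤ t → t ≤ 1 →
      specificFreeEnergy Φ
          (ENNReal.ofReal (1 - t) • (μ : Measure (HeightFn d k))
            + ENNReal.ofReal t • (ν : Measure (HeightFn d k)))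
        = ((1 - t : ℝ) : EReal) * specificFreeEnergy Φ (μ : Measure (HeightFn d k))
          + (t : EReal) * specificFreeEnergy Φ (ν : Measure (HeightFn d k))) ∧
    -- it is lower semicontinuous for both topologies
    (@LowerSemicontinuousOn (ProbabilityMeasure (HeightFn d k)) EReal (localTopology d k) _
      (fun μ => specificFreeEnergy Φ (μ : Measure (HeightFn d k))) (invariantMeasures k L)) ∧
    (@LowerSemicontinuousOn (ProbabilityMeasure (HeightFn d k)) EReal (weakLocalTopology d k) _
      (fun μ => specificFreeEnergy Φ (μ : Measure (HeightFn d k))) (invariantMeasures k L)) ∧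
    -- each lower level set is compact and Polish for both topologies, which coincide on it
    (∀ C : ℝ,
      @CompactSpace (lowerLevelSet L Φ C)
        (subspaceTopology (localTopology d k) (lowerLevelSet L Φ C)) ∧
      @PolishSpace (lowerLevelSet L Φ C)
        (subspaceTopology (localTopology d k) (lowerLevelSet L Φ C)) ∧
      @CompactSpace (lowerLevelSet L Φ C)
        (subspaceTopology (weakLocalTopology d k) (lowerLevelSet L Φ C)) ∧
      @PolishSpace (lowerLevelSet L Φ C)
        (subspaceTopology (weakLocalTopology d k) (lowerLevelSet L Φ C)) ∧
      subspaceTopology (localTopology d k) (lowerLevelSet L Φ C)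
        = subspaceTopology (weakLocalTopology d k) (lowerLevelSet L Φ C)) := by
  obtain ⟨Ψ, Ξ, A, q, K, N, rfl, h⟩ := exists_isInteraction (by omega) hL hΦ
  refine ⟨fun μ hμ => h.tendsto_normalizedFreeEnergy hμ, ⟨-siteCost Ξ K, fun μ hμ =>
    h.neg_siteCost_le_specificFreeEnergy hμ⟩, fun μ hμ ν hν t h0 h1 => ?_,
    h.lowerSemicontinuousOn_localTopology, h.lowerSemicontinuousOn_weakLocalTopology,
    fun C => ?_⟩
  -- The endpoints are separated because with weight zero an infinite value must drop out, whereas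
  -- the mixture lemma needs both weights positive.
  · rcases h0.eq_or_lt with rfl | h0
    · simp
    rcases h1.eq_or_lt with rfl | h1
    · simp
    exact h.specificFreeEnergy_mixture hμ hν h0 h1
  · have hw := h.compactSpace_and_polishSpace C
    rw [h.subspaceTopology_eq C]
    exact ⟨hw.1, hw.2, hw.1, hw.2, rfl⟩
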